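/- Let $B=\bigoplus_{i=1}^n B_i$, where each $B_i$ is a central simple algebra of finite dimension $m_i^2$ over a field $L_i$, and let $L=\bigoplus_{i=1}^n L_i$ be the center of $B$. Let $P$ be a Galois bimodule of rank $d\ge 1$ over $B$, i.e. a $B$-bimodule that is isomorphic to $B^d$ as a left $B$-module and as a right $B$-module, and such that $P\otimes_B P\cong P^d$ as $B$-bimodules. Let $$\mathcal Z(P)=\{z\in B : zx=xz \text{ for all } x\in P\}$$ be the center of $P$, and let $m$ be the least common multiple of $m_1,\dots,m_n$. For $a\in L$ let $\phi(a)$ be the left $B$-linear endomorphism $x\mapsto xa$ of $P$. Let $e_i$ be the unit of $B_i$, and let $\phi_i(a)$ be the restriction of $\phi(a)$ to $e_iP$, an $L_i$-linear endomorphism of this $dm_i^2$-dimensional left $L_i$-vector space. Let $\chi_{\phi_i(a)}(t)\in L_i[t]$ be its characteristic polynomial. Let $\chi_a\in L[t]=\bigoplus_i L_i[t]$ be the polynomial whose $i$-th component is $\chi_{\phi_i(a)}(t)^{m^2/m_i^2}$. Then every component of $\chi_a$ is monic of degree $dm^2$, and all the coefficients of $\chi_a$, which are elements of $L\subset B$,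 belong to $\mathcal Z(P)$. -/

import Mathlib

open MulOpposite Polynomial
open scoped TensorProduct

/-! ## Bimodules

An `A`-bimodule is an additive group `P` with commuting actions of `A` (the left action) and of
`Aᵐᵒᵖ` (the right action: `op a • x` is `x a`). -/

namespace GaloisBimod

section Tensor

variable (A : Type*) [Ring A]
variable (P : Type*) [AddCommGroup P] [Module A P] [Module Aᵐᵒᵖ P] [SMulCommClass A Aᵐᵒᵖ P]
variable (Q : Type*) [AddCommGroup Q] [Module A Q] [Module Aᵐᵒᵖ Q] [SMulCommClass A Aᵐᵒᵖ Q]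

/-- The relations `(x a) ⊗ y = x ⊗ (a y)` cutting `P ⊗_A Q` out of `P ⊗_ℤ Q`. -/
def balancedRel : AddSubgroup (P ⊗[ℤ] Q) :=
  AddSubgroup.closure {t | ∃ (x : P) (a : A) (y : Q),
    t = (op a • x) ⊗ₜ[ℤ] y - x ⊗ₜ[ℤ] (a • y)}

/-- The tensor product `P ⊗_A Q` of two bimodules over a (not necessarily commutative) ring `A`. -/
def BimodTensor : Type _ := (P ⊗[ℤ] Q) ⧸ balancedRel A P Q

noncomputable instance : AddCommGroup (BimodTensor A P Q) :=
  inferInstanceAs (AddCommGroup ((P ⊗[ℤ] Q) ⧸ balancedRel A P Q))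

/-- The projection `P ⊗_ℤ Q → P ⊗_A Q`. -/
noncomputable def BimodTensor.mk : P ⊗[ℤ] Q →+ BimodTensor A P Q :=
  QuotientAddGroup.mk' (balancedRel A P Q)

variable {P Q} in
/-- The class of `x ⊗ y` in `P ⊗_A Q`. -/
noncomputable def BimodTensor.tmul (x : P) (y : Q) : BimodTensor A P Q :=
  BimodTensor.mk A P Q (x ⊗ₜ[ℤ] y)

set_option linter.unusedSectionVars false in
variable {A P Q} in
theorem BimodTensor.hom_ext {M : Type*} [AddCommGroup M] {f g : BimodTensor A P Q →+ M}
    (h : ∀ x y, f (BimodTensor.tmul A x y) = g (BimodTensor.tmul A x y)) : f = g := by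
  refine DFunLike.ext _ _ fun t => ?_
  obtain ⟨t, rfl⟩ := QuotientAddGroup.mk'_surjective (balancedRel A P Q) t
  induction t using TensorProduct.induction_on with
  | zero =>
    exact (map_zero (f.comp (BimodTensor.mk A P Q))).trans
      (map_zero (g.comp (BimodTensor.mk A P Q))).symm
  | tmul x y => exact h x y
  | add s t hs ht =>
    exact (map_add (f.comp (BimodTensor.mk A P Q)) s t).trans
      ((congrArg₂ (· + ·) hs ht).trans (map_add (g.comp (BimodTensor.mk A P Q)) s t).symm)

/-- The left action: `a (x ⊗ y) = (a x) ⊗ y`. -/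
noncomputable def BimodTensor.lsmul (a : A) : BimodTensor A P Q →+ BimodTensor A P Q :=
  QuotientAddGroup.map (balancedRel A P Q) (balancedRel A P Q)
    (TensorProduct.map (DistribSMul.toAddMonoidHom P a).toIntLinearMap LinearMap.id).toAddMonoidHom
    (by
      rw [balancedRel, AddSubgroup.closure_le]
      rintro _ ⟨x, b, y, rfl⟩
      refine AddSubgroup.subset_closure ⟨a • x, b, y, ?_⟩
      simp [smul_comm a (op b) x])

/-- The right action: `(x ⊗ y) a = x ⊗ (y a)`. -/
noncomputable def BimodTensor.rsmul (a : Aᵐᵒᵖ) : BimodTensor A P Q →+ BimodTensor A P Q :=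
  QuotientAddGroup.map (balancedRel A P Q) (balancedRel A P Q)
    (TensorProduct.map LinearMap.id (DistribSMul.toAddMonoidHom Q a).toIntLinearMap).toAddMonoidHom
    (by
      rw [balancedRel, AddSubgroup.closure_le]
      rintro _ ⟨x, b, y, rfl⟩
      refine AddSubgroup.subset_closure ⟨x, b, a • y, ?_⟩
      simp [smul_comm b a y])

noncomputable instance : Module A (BimodTensor A P Q) where
  smul a t := BimodTensor.lsmul A P Q a t
  smul_zero a := map_zero (BimodTensor.lsmul A P Q a)
  smul_add a := map_add (BimodTensor.lsmul A P Q a)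
  one_smul t := DFunLike.congr_fun (f := BimodTensor.lsmul A P Q 1) (g := AddMonoidHom.id _)
    (BimodTensor.hom_ext fun x y =>
      congrArg (fun z => BimodTensor.tmul A z y) (one_smul A x)) t
  mul_smul a b t := DFunLike.congr_fun (f := BimodTensor.lsmul A P Q (a * b))
    (g := (BimodTensor.lsmul A P Q a).comp (BimodTensor.lsmul A P Q b))
    (BimodTensor.hom_ext fun x y =>
      congrArg (fun z => BimodTensor.tmul A z y) (mul_smul a b x)) t
  add_smul a b t := DFunLike.congr_fun (f := BimodTensor.lsmul A P Q (a + b))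
    (g := BimodTensor.lsmul A P Q a + BimodTensor.lsmul A P Q b)
    (BimodTensor.hom_ext fun x y =>
      (congrArg (fun z => BimodTensor.tmul A z y) (add_smul a b x)).trans
        (congrArg (BimodTensor.mk A P Q) (TensorProduct.add_tmul (a • x) (b • x) y))) t
  zero_smul t := DFunLike.congr_fun (f := BimodTensor.lsmul A P Q 0) (g := 0)
    (BimodTensor.hom_ext fun x y =>
      (congrArg (fun z => BimodTensor.tmul A z y) (zero_smul A x)).trans
        (congrArg (BimodTensor.mk A P Q) (TensorProduct.zero_tmul P y))) t

noncomputable instance : Module Aᵐᵒᵖ (BimodTensor A P Q) where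
  smul a t := BimodTensor.rsmul A P Q a t
  smul_zero a := map_zero (BimodTensor.rsmul A P Q a)
  smul_add a := map_add (BimodTensor.rsmul A P Q a)
  one_smul t := DFunLike.congr_fun (f := BimodTensor.rsmul A P Q 1) (g := AddMonoidHom.id _)
    (BimodTensor.hom_ext fun x y =>
      congrArg (fun z => BimodTensor.tmul A x z) (one_smul Aᵐᵒᵖ y)) t
  mul_smul a b t := DFunLike.congr_fun (f := BimodTensor.rsmul A P Q (a * b))
    (g := (BimodTensor.rsmul A P Q a).comp (BimodTensor.rsmul A P Q b))
    (BimodTensor.hom_ext fun x y =>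
      congrArg (fun z => BimodTensor.tmul A x z) (mul_smul a b y)) t
  add_smul a b t := DFunLike.congr_fun (f := BimodTensor.rsmul A P Q (a + b))
    (g := BimodTensor.rsmul A P Q a + BimodTensor.rsmul A P Q b)
    (BimodTensor.hom_ext fun x y =>
      (congrArg (fun z => BimodTensor.tmul A x z) (add_smul a b y)).trans
        (congrArg (BimodTensor.mk A P Q) (TensorProduct.tmul_add x (a • y) (b • y)))) t
  zero_smul t := DFunLike.congr_fun (f := BimodTensor.rsmul A P Q 0) (g := 0)
    (BimodTensor.hom_ext fun x y =>
      (congrArg (fun z => BimodTensor.tmul A x z) (zero_smul Aᵐᵒᵖ y)).trans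
        (congrArg (BimodTensor.mk A P Q) (TensorProduct.tmul_zero Q x))) t

end Tensor

section Galois

/-- A Galois bimodule of rank `d ≥ 1` over `A`: an `A`-bimodule `P` which is isomorphic to `A ^ d`
as a left module and as a right module, and with `P ⊗_A P ≅ P ^ d` as bimodules. (That `P ⊗_A P` embeds
into some `P ^ N`, the weakly Galois condition, is then automatic.) -/
structure IsGaloisBimodule (A : Type*) [Ring A] (P : Type*) [AddCommGroup P] [Module A P]
    [Module Aᵐᵒᵖ P] [SMulCommClass A Aᵐᵒᵖ P] (d : ℕ) : Prop where
  one_le : 1 ≤ d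
  left_free : Nonempty (P ≃ₗ[A] (Fin d → A))
  right_free : Nonempty (P ≃ₗ[Aᵐᵒᵖ] (Fin d → A))
  tensor_iso : ∃ e : BimodTensor A P P ≃ₗ[A] (Fin d → P),
    ∀ (a : Aᵐᵒᵖ) (t : BimodTensor A P P), e (a • t) = a • e t

/-- The center `{z | z x = x z for all x in P}` of a bimodule `P`. -/
def bimoduleCenter (A : Type*) [Ring A] (P : Type*) [AddCommGroup P] [Module A P]
    [Module Aᵐᵒᵖ P] [SMulCommClass A Aᵐᵒᵖ P] : Subring A where
  carrier := {z | ∀ x : P, z • x = op z • x}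
  one_mem' := fun x => by simp
  zero_mem' := fun x => by simp
  mul_mem' := fun {z w} hz hw x => by
    rw [mul_smul, hw x, smul_comm, hz x, op_mul, mul_smul]
  add_mem' := fun {z w} hz hw x => by
    rw [add_smul, hz x, hw x, op_add, add_smul]
  neg_mem' := fun {z} hz x => by
    rw [neg_smul, hz x, op_neg, neg_smul]

/-- The right action map `φ_P`: `φ_P(a)` is the left `A`-linear endomorphism `x ↦ x a` of `P`. -/
def rightAction (A : Type*) [Ring A] (P : Type*) [AddCommGroup P] [Module A P]
    [Module Aᵐᵒᵖ P] [SMulCommClass A Aᵐᵒᵖ P] (a : A) : Module.End A P where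
  toFun x := op a • x
  map_add' x y := smul_add _ x y
  map_smul' b x := (smul_comm b (op a) x).symm

end Galois

/-! ## Bimodules over a finite product `B = ∏ i, B i` -/

section Component

variable {ι : Type*} [DecidableEq ι] (B : ι → Type*) [∀ i, Ring (B i)]
variable (P : Type*) [AddCommGroup P] [Module (∀ i, B i) P]

/-- The summand `e_i P` of a left module `P` over `B = ∏ i, B i`, where `e_i` is the unit of
`B i`, regarded as a central idempotent of `B`. -/
def component (i : ι) : AddSubgroup P where
  carrier := {x | (Pi.single i 1 : ∀ i, B i) • x = x}
  zero_mem' := smul_zero _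
  add_mem' := fun {x y} hx hy => by
    simp only [Set.mem_ofPred_eq] at hx hy ⊢
    rw [smul_add, hx, hy]
  neg_mem' := fun {x} hx => by
    simp only [Set.mem_ofPred_eq] at hx ⊢
    rw [smul_neg, hx]

variable {B P}

theorem single_smul_mem_component (i : ι) (b : B i) (x : P) :
    (Pi.single i b : ∀ i, B i) • x ∈ component B P i := by
  change (Pi.single i 1 : ∀ i, B i) • (Pi.single i b : ∀ i, B i) • x = _
  rw [smul_smul, ← Pi.single_mul, one_mul]

/-- If `K` acts on the factor `B i`, it acts on `e_i P` through the left action of `B i`. -/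
instance componentModule {K : Type*} [Field K] (i : ι) [Algebra K (B i)] :
    Module K (component B P i) where
  smul z x := ⟨(Pi.single i (algebraMap K (B i) z) : ∀ i, B i) • (x : P),
    single_smul_mem_component i _ _⟩
  one_smul x := Subtype.ext (by
    change (Pi.single i (algebraMap K (B i) 1) : ∀ i, B i) • (x : P) = x
    rw [map_one]; exact x.2)
  mul_smul z w x := Subtype.ext (by
    change (Pi.single i (algebraMap K (B i) (z * w)) : ∀ i, B i) • (x : P) =
      (Pi.single i (algebraMap K (B i) z) : ∀ i, B i) •
        (Pi.single i (algebraMap K (B i) w) : ∀ i, B i) • (x : P)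
    rw [map_mul, Pi.single_mul, mul_smul])
  smul_zero z := Subtype.ext (smul_zero _)
  smul_add z x y := Subtype.ext (smul_add _ _ _)
  add_smul z w x := Subtype.ext (by
    change (Pi.single i (algebraMap K (B i) (z + w)) : ∀ i, B i) • (x : P) =
      (Pi.single i (algebraMap K (B i) z) : ∀ i, B i) • (x : P) +
        (Pi.single i (algebraMap K (B i) w) : ∀ i, B i) • (x : P)
    rw [map_add, Pi.single_add, add_smul])
  zero_smul x := Subtype.ext (by
    change (Pi.single i (algebraMap K (B i) 0) : ∀ i, B i) • (x : P) = 0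
    rw [map_zero, Pi.single_zero, zero_smul])

theorem coe_component_smul {K : Type*} [Field K] (i : ι) [Algebra K (B i)] (z : K)
    (x : component B P i) :
    ((z • x : component B P i) : P) =
      (Pi.single i (algebraMap K (B i) z) : ∀ i, B i) • (x : P) := rfl

/-- The `i`-th component of a left `B`-linear endomorphism `f` of `P`: its restriction to `e_i P`,
a `K`-linear map whenever `B i` is a `K`-algebra. -/
def componentEnd (K : Type*) [Field K] (i : ι) [Algebra K (B i)]
    (f : Module.End (∀ i, B i) P) : Module.End K (component B P i) where
  toFun x := ⟨f x, by
    change (Pi.single i 1 : ∀ i, B i) • f (x : P) = f x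
    rw [← map_smul]; exact congrArg f x.2⟩
  map_add' x y := Subtype.ext (map_add f (x : P) y)
  map_smul' z x := Subtype.ext (map_smul f _ (x : P))

theorem IsGaloisBimodule.finite_component [Module (∀ i, B i)ᵐᵒᵖ P]
    [SMulCommClass (∀ i, B i) (∀ i, B i)ᵐᵒᵖ P] {d : ℕ} (h : IsGaloisBimodule (∀ i, B i) P d)
    (K : Type*) [Field K] (i : ι) [Algebra K (B i)] [FiniteDimensional K (B i)] :
    Module.Finite K (component B P i) := by
  obtain ⟨e⟩ := h.left_free
  let g : (Fin d → B i) →ₗ[K] component B P i :=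
    { toFun := fun f => ⟨e.symm fun k => Pi.single i (f k), by
        change (Pi.single i 1 : ∀ i, B i) • _ = _
        rw [← map_smul]
        congr 1
        ext1 k
        change (Pi.single i 1 : ∀ i, B i) * Pi.single i (f k) = _
        rw [← Pi.single_mul, one_mul]⟩
      map_add' := fun f f' => Subtype.ext (by
        change e.symm _ = e.symm _ + e.symm _
        rw [← map_add]
        congr 1
        ext1 k
        exact Pi.single_add i _ _)
      map_smul' := fun z f => Subtype.ext (by
        rw [RingHom.id_apply, coe_component_smul]
        change e.symm _ = _ • e.symm _
        rw [← map_smul]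
        congr 1
        ext1 k
        change _ = (Pi.single i (algebraMap K (B i) z) : ∀ i, B i) * Pi.single i (f k)
        rw [← Pi.single_mul, Pi.smul_apply, Algebra.smul_def]) }
  refine Module.Finite.of_surjective g fun x => ⟨fun k => e (x : P) k i, Subtype.ext ?_⟩
  change e.symm (fun k => Pi.single i (e (x : P) k i)) = x
  rw [LinearEquiv.symm_apply_eq]
  have hx : (Pi.single i 1 : ∀ i, B i) • e (x : P) = e x := by
    rw [← map_smul]; exact congrArg e x.2
  rw [← hx]
  ext1 k
  change _ = (Pi.single i 1 : ∀ i, B i) * e (x : P) k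
  ext j
  by_cases hj : j = i
  · subst hj
    simp
  · simp [hj]

end Component

section Charpoly

variable {ι : Type*} [Fintype ι] [DecidableEq ι] {L : ι → Type*} [∀ i, Field (L i)]
  {B : ι → Type*} [∀ i, Ring (B i)] [∀ i, Algebra (L i) (B i)]
  {P : Type*} [AddCommGroup P] [Module (∀ i, B i) P] [Module (∀ i, B i)ᵐᵒᵖ P]
  [SMulCommClass (∀ i, B i) (∀ i, B i)ᵐᵒᵖ P]

variable (L B) in
/-- The inclusion of `L = ∏ i, L i` into `B = ∏ i, B i`. -/
def centerEmb : (∀ i, L i) →+* ∀ i, B i :=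
  RingHom.pi fun i => (algebraMap (L i) (B i)).comp (Pi.evalRingHom L i)

/-- The characteristic polynomial over `L i` of `φ_i(a)`, the right action of `a ∈ L` on the
`L i`-vector space `e_i P`. -/
noncomputable def componentCharpoly [∀ i, FiniteDimensional (L i) (B i)] {d : ℕ}
    (h : IsGaloisBimodule (∀ i, B i) P d) (a : ∀ i, L i) (i : ι) : (L i)[X] :=
  haveI := h.finite_component (L i) i
  (componentEnd (L i) i (rightAction (∀ i, B i) P (centerEmb L B a))).charpoly

/-- The polynomial `χ_a` over `L = ∏ i, L i` whose `i`-th component is the characteristic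
polynomial of `φ_i(a)` raised to the power `m² / (m i)²`, with `m` the least common multiple of
the `m i`. -/
noncomputable def normalizedCharpoly [∀ i, FiniteDimensional (L i) (B i)] (m : ι → ℕ) {d : ℕ}
    (h : IsGaloisBimodule (∀ i, B i) P d) (a : ∀ i, L i) : (∀ i, L i)[X] :=
  (Polynomial.piEquiv L).symm fun i =>
    componentCharpoly h a i ^ ((Finset.univ.lcm m) ^ 2 / m i ^ 2)

end Charpoly

end GaloisBimod

/-! A left basis of P turns the right action into a ring homomorphism φ : A → M_d(A), where A = Bᵒᵖ
= ∏ A_i, and a central z lies in the center of P exactly when φ(z) is the scalar matrix z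
(`bimoduleMatrix_eq_scalar_iff`). The isomorphism P ⊗ P ≅ P^d becomes an invertible matrix θ
conjugating the big matrix with entries φ(φ(x)_pq) into d diagonal copies of φ(x)
(`exists_intertwining_matrix`). Equivalently, the functor F(M) = M^d, with A acting through φ,
satisfies F ∘ F ≅ F^d. The rest uses only θ and the injectivity of φ, which comes from right
freeness.

Write φ_i for the i-th component of φ and e_j for the unit of A_j, and call i linked to j when
φ_i(e_j) ≠ 0. The matrix θ makes this relation transitive, and a rank comparison of conjugate
idempotents makes it an equivalence (`map_linkedIdem`). This reduces the theorem to the connected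
case, where every φ_i(e_j) is nonzero. There the central elements on which φ is scalar form a field
k (`isField_centralScalars`), A is finite-dimensional over k, and φ is k-linear. A k-basis b of A
can be chosen whose images under each φ_i are independent over L_i (`exists_centralScalars_basis`).

The heart is `finrank_mul_actionRank_le`: the rank of an element τ of R on F(M) is at least dim M /
dim R times its rank on F(R). It is applied to R = L_i ⊗_k A, M = A_i and τ = f(a) e_j. Here e_j
F(A) is a vector space over the field k(a_j), so ranks on F(R) are easy to bound below. For f = 1
the bounds add up, over j, to the total dimension, so they are equalities. For the divisors f of the
minimal polynomial of a_j they then fix the dimension of every kernel, and the characteristic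
polynomial of a on e_j F(A_i) is forced to be a power of that minimal polynomial
(`exists_charpoly_eq_pow`).

Thus the characteristic polynomial of a on F(A_i) is ∏_j minpoly_k(a_j)^{w_ij}, with w_ij
proportional to dim A_i = m_i² for fixed j. Raising it to the power m²/m_i² makes the exponents
independent of i: all components are images of one polynomial over k, whose coefficients are central
scalars. -/

namespace GaloisBimod

/-! ### Linear algebra: ranks, kernels and characteristic polynomials -/

section LinearAlgebra

open Module

/-- The image of `T` surjects onto a space containing the image of `T''`, and the kernel of that
surjection contains a copy of the image of `T'`. Exactness in the middle is not needed. -/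
theorem finrank_range_add_le {K V V' V'' : Type*} [Field K] [AddCommGroup V] [Module K V]
    [AddCommGroup V'] [Module K V'] [AddCommGroup V''] [Module K V''] [FiniteDimensional K V]
    (T : V →ₗ[K] V) (T' : V' →ₗ[K] V') (T'' : V'' →ₗ[K] V'')
    (i : V' →ₗ[K] V) (p : V →ₗ[K] V'') (hi : Function.Injective i) (hp : Function.Surjective p)
    (hpi : ∀ x, p (i x) = 0) (hT' : ∀ x, T (i x) = i (T' x)) (hT'' : ∀ x, p (T x) = T'' (p x)) :
    finrank K (LinearMap.range T') + finrank K (LinearMap.range T'') ≤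
      finrank K (LinearMap.range T) := by
  have h1 := (p.domRestrict (LinearMap.range T)).finrank_range_add_finrank_ker
  have h2 : LinearMap.range T'' ≤ LinearMap.range (p.domRestrict (LinearMap.range T)) := by
    rintro _ ⟨x, rfl⟩
    obtain ⟨y, rfl⟩ := hp x
    exact ⟨⟨T y, y, rfl⟩, hT'' y⟩
  have h3 : finrank K (LinearMap.range T') ≤
      finrank K (LinearMap.ker (p.domRestrict (LinearMap.range T))) := by
    let f : LinearMap.range T' →ₗ[K] LinearMap.ker (p.domRestrict (LinearMap.range T)) :=
      LinearMap.codRestrict _ (LinearMap.codRestrict _ (i.domRestrict _) (by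
        rintro ⟨_, x, rfl⟩
        exact ⟨i x, hT' x⟩)) (fun x => hpi x)
    refine LinearMap.finrank_le_finrank_of_injective (f := f) fun x y hxy => ?_
    exact Subtype.ext (hi (congrArg (fun z => (z.1 : V)) hxy))
  have h4 := Submodule.finrank_mono h2
  omega

theorem charpoly_eq_mul_of_invariant {K V : Type*} [Field K] [AddCommGroup V] [Module K V]
    [FiniteDimensional K V] (W : Submodule K V) (T : End K V) (hW : W ≤ W.comap T) :
    T.charpoly = (LinearMap.charpoly (T.restrict hW)) *
      (LinearMap.charpoly (W.mapQ W T hW)) := by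
  let m := Module.Free.ChooseBasisIndex K W
  let bW : Basis m K W := Module.Free.chooseBasis K W
  let n := Module.Free.ChooseBasisIndex K (V ⧸ W)
  let bQ : Basis n K (V ⧸ W) := Module.Free.chooseBasis K (V ⧸ W)
  let b := bW.sumQuot bQ
  let A : Matrix m m K := LinearMap.toMatrix bW bW (T.restrict hW)
  let B : Matrix m n K := Matrix.of fun i l ↦ (b.repr (T (b (Sum.inr l)))) (Sum.inl i)
  let D : Matrix n n K := LinearMap.toMatrix bQ bQ (W.mapQ W T hW)
  suffices LinearMap.toMatrix b b T = Matrix.fromBlocks A B 0 D by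
    rw [← LinearMap.charpoly_toMatrix T b, this, ← LinearMap.charpoly_toMatrix _ bW,
      ← LinearMap.charpoly_toMatrix _ bQ, Matrix.charpoly_fromBlocks_zero₂₁]
  ext u v
  cases u with
  | inl i =>
    cases v with
    | inl k =>
      simp only [b, Basis.sumQuot_inl, Matrix.fromBlocks_apply₁₁, A, LinearMap.toMatrix_apply]
      apply Basis.sumQuot_repr_inl_of_mem
    | inr l => simp [b, LinearMap.toMatrix_apply, Matrix.fromBlocks_apply₁₂, B]
  | inr j =>
    cases v with
    | inl k =>
      suffices W.mkQ (T (bW k)) = 0 by simp [LinearMap.toMatrix_apply, b, this]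
      rw [← LinearMap.mem_ker, Submodule.ker_mkQ]
      exact hW (Submodule.coe_mem (bW k))
    | inr l =>
      simp only [LinearMap.toMatrix_apply, Basis.sumQuot_repr_inr,
        Matrix.fromBlocks_apply₂₂, b, D]
      rw [← Basis.sumQuot_inr bW bQ l, W.mapQ_apply]
      simp

/-- Over K[X]/(p) the class of X is a root of the characteristic polynomial, hence an eigenvalue.
Since `q` annihilates the operator, it vanishes at this eigenvalue, which says that p divides q. -/
theorem dvd_of_dvd_charpoly {K V : Type*} [Field K] [AddCommGroup V] [Module K V]
    [FiniteDimensional K V] (T : End K V) (q p : K[X]) (hp : Irreducible p)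
    (hT : aeval T q = 0) (hd : p ∣ T.charpoly) : p ∣ q := by
  have := Fact.mk hp
  let F := AdjoinRoot p
  have h1 : (T.baseChange F).charpoly.IsRoot (AdjoinRoot.root p) := by
    rw [LinearMap.charpoly_baseChange, IsRoot, eval_map_algebraMap, ← AdjoinRoot.mk_eq_zero.2 hd,
      AdjoinRoot.aeval_eq]
  have h2 : Module.End.HasEigenvalue (T.baseChange F) (AdjoinRoot.root p) :=
    (Module.End.hasEigenvalue_iff_isRoot_charpoly _ _).2 h1
  obtain ⟨v, hv⟩ := h2.exists_hasEigenvector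
  have h3 := Module.End.aeval_apply_of_hasEigenvector (p := q.map (algebraMap K F)) hv
  have h4 : aeval (T.baseChange F) (q.map (algebraMap K F)) = 0 := by
    rw [aeval_map_algebraMap]
    have := Polynomial.aeval_algHom_apply (Module.End.baseChangeHom K F V) T q
    rw [hT, map_zero] at this
    exact this
  rw [h4, eval_map_algebraMap, AdjoinRoot.aeval_eq] at h3
  rw [← AdjoinRoot.mk_eq_zero]
  by_contra h
  exact hv.2 ((smul_eq_zero.1 h3.symm).resolve_left h)

theorem charpoly_eq_pow_of_irreducible {K V : Type*} [Field K] [AddCommGroup V] [Module K V]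
    [FiniteDimensional K V] (T : End K V) (q : K[X]) (hq : Irreducible q) (hm : q.Monic)
    (hT : aeval T q = 0) : ∃ e : ℕ, T.charpoly = q ^ e := by
  have hχ := T.charpoly_monic
  have hf : FiniteMultiplicity q T.charpoly :=
    FiniteMultiplicity.of_not_isUnit hq.not_isUnit hχ.ne_zero
  obtain ⟨r, hr, hnr⟩ := hf.exists_eq_pow_mul_and_not_dvd
  refine ⟨multiplicity q T.charpoly, ?_⟩
  have hrm : r.Monic := (hm.pow _).of_mul_monic_left (hr ▸ hχ)
  have : r = 1 := by
    refine hrm.eq_one_of_isUnit ?_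
    by_contra hu
    obtain ⟨p, hp, hpr⟩ := WfDvdMonoid.exists_irreducible_factor hu hrm.ne_zero
    have hpq := dvd_of_dvd_charpoly T q p hp hT (hr ▸ hpr.mul_left _)
    exact hnr ((hp.associated_of_dvd hq hpq).symm.dvd.trans hpr)
  rw [this, mul_one] at hr
  exact hr

theorem aeval_apply_of_intertwining {K V V' : Type*} [CommRing K] [AddCommGroup V] [Module K V]
    [AddCommGroup V'] [Module K V'] (T : End K V) (T' : End K V') (i : V' →ₗ[K] V)
    (h : ∀ x, T (i x) = i (T' x)) (f : K[X]) (x : V') :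
    aeval T f (i x) = i (aeval T' f x) := by
  have hpow : ∀ (n : ℕ) (x : V'), (T ^ n) (i x) = i ((T' ^ n) x) := by
    intro n
    induction n with
    | zero => intro x; simp
    | succ n ih => intro x; rw [pow_succ, pow_succ, End.mul_apply, End.mul_apply, h, ih]
  induction f using Polynomial.induction_on' with
  | add p q hp hq => simp only [map_add, LinearMap.add_apply, hp, hq]
  | monomial n a => simp [aeval_monomial, hpow]

theorem ker_aeval_le_comap {K V : Type*} [Field K] [AddCommGroup V] [Module K V] (T : End K V)
    (f : K[X]) : LinearMap.ker (aeval T f) ≤ (LinearMap.ker (aeval T f)).comap T := fun x hx => by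
  rw [Submodule.mem_comap, LinearMap.mem_ker,
    aeval_apply_of_intertwining T T T (fun _ => rfl) f x, LinearMap.mem_ker.1 hx, map_zero]

theorem finrank_ker_restrict {K V : Type*} [Field K] [AddCommGroup V] [Module K V]
    (W : Submodule K V) (T : End K V) (hW : W ≤ W.comap T) (f : K[X])
    (hf : LinearMap.ker (aeval T f) ≤ W) :
    finrank K (LinearMap.ker (aeval (LinearMap.restrict T hW : End K W) f)) =
      finrank K (LinearMap.ker (aeval T f)) := by
  have h1 : LinearMap.ker (aeval T f) =
      (LinearMap.ker (aeval (LinearMap.restrict T hW : End K W) f)).map W.subtype := by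
    ext x
    constructor
    · intro hx
      refine ⟨⟨x, hf hx⟩, Subtype.ext ?_, rfl⟩
      exact (aeval_apply_of_intertwining T _ W.subtype (fun _ => rfl) f ⟨x, hf hx⟩).symm.trans hx
    · rintro ⟨y, hy, rfl⟩
      rw [LinearMap.mem_ker, aeval_apply_of_intertwining T (LinearMap.restrict T hW : End K W)
        W.subtype (fun _ => rfl) f y,
        LinearMap.mem_ker.1 hy, map_zero]
  rw [h1, Submodule.finrank_map_subtype_eq]

/-- Split off an irreducible factor, g = q g', and put W = ker g'(T). Induction applies to W, while
q kills V/W, so the quotient contributes q^e. Counting dimensions gives e = w. All monic divisors of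
g enter the hypothesis so that it passes to W. -/
theorem charpoly_eq_pow_of_finrank_ker {K : Type*} [Field K] (w n : ℕ) : ∀ (g : K[X])
    {V : Type*} [AddCommGroup V] [Module K V] [FiniteDimensional K V] (T : End K V),
    g.natDegree = n → g.Monic → aeval T g = 0 →
    (∀ f, f ∣ g → f.Monic → finrank K (LinearMap.ker (aeval T f)) = w * f.natDegree) →
    T.charpoly = g ^ w := by
  induction n using Nat.strong_induction_on with
  | _ n ih =>
  intro g V _ _ _ T hn hg hT hk
  by_cases hu : IsUnit g
  · obtain rfl := hg.eq_one_of_isUnit hu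
    have h0 := hk 1 dvd_rfl monic_one
    rw [hT, LinearMap.ker_zero, finrank_top, natDegree_one, mul_zero] at h0
    rw [one_pow]
    exact T.charpoly_monic.natDegree_eq_zero.1 (by rw [LinearMap.charpoly_natDegree, h0])
  · obtain ⟨q, hqm, hq, g', rfl⟩ := exists_monic_irreducible_factor g hu
    have hg' : g'.Monic := hqm.of_mul_monic_left hg
    have hdeg : (q * g').natDegree = q.natDegree + g'.natDegree := hqm.natDegree_mul hg'
    have hq0 : 0 < q.natDegree := hq.natDegree_pos
    set W := LinearMap.ker (aeval T g') with hWdef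
    have hW : W ≤ W.comap T := ker_aeval_le_comap T g'
    have h1 : LinearMap.charpoly (T.restrict hW) = g' ^ w := by
      refine ih g'.natDegree (by omega) g' (LinearMap.restrict T hW : End K W) rfl hg' ?_ ?_
      · refine LinearMap.ext fun x => Subtype.ext ?_
        exact (aeval_apply_of_intertwining T (LinearMap.restrict T hW : End K W) W.subtype
          (fun _ => rfl) g' x).symm.trans x.2
      · intro f hf hfm
        rw [finrank_ker_restrict, hk f (hf.mul_left _) hfm]
        obtain ⟨r, rfl⟩ := hf
        intro x hx
        rw [hWdef, LinearMap.mem_ker, mul_comm, map_mul, End.mul_apply, LinearMap.mem_ker.1 hx,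
          map_zero]
    obtain ⟨e, h2⟩ := charpoly_eq_pow_of_irreducible (W.mapQ W T hW : End K (V ⧸ W)) q hq hqm (by
      refine LinearMap.ext fun x => ?_
      obtain ⟨x, rfl⟩ := W.mkQ_surjective x
      rw [aeval_apply_of_intertwining (W.mapQ W T hW : End K (V ⧸ W)) T W.mkQ (fun _ => rfl)]
      refine (Submodule.Quotient.mk_eq_zero _).2 ?_
      rw [hWdef, LinearMap.mem_ker, ← End.mul_apply, ← map_mul, mul_comm, hT]
      rfl)
    have h3 := congrArg natDegree h2
    rw [LinearMap.charpoly_natDegree, hqm.natDegree_pow] at h3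
    have h4 := W.finrank_quotient_add_finrank
    have h5 := hk _ dvd_rfl hg
    rw [hT, LinearMap.ker_zero, finrank_top, hdeg] at h5
    have h6 := hk g' (dvd_mul_left _ _) hg'
    have h7 : e = w := by
      refine Nat.eq_of_mul_eq_mul_right hq0 ?_
      rw [← hWdef] at h6
      rw [h5, h6, h3, mul_add] at h4
      omega
    rw [charpoly_eq_mul_of_invariant W T hW, h1, h2, h7, mul_pow, mul_comm]

/-- If g = f h, the image of f(T) lies in ker h(T), so the upper bounds on the kernels of f(T) and
h(T) force each other to be sharp. The exponent is an integer because the kernel of an irreducible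
factor q has dimension e · deg q. -/
theorem exists_charpoly_eq_pow {K V : Type*} [Field K] [AddCommGroup V] [Module K V]
    [FiniteDimensional K V] (T : End K V) (g : K[X]) (hg : g.Monic) (hg0 : 0 < g.natDegree)
    (hT : aeval T g = 0)
    (hr : ∀ f, f ∣ g → f.Monic → finrank K V * (g.natDegree - f.natDegree) ≤
      g.natDegree * finrank K (LinearMap.range (aeval T f))) :
    ∃ w : ℕ, T.charpoly = g ^ w ∧ w * g.natDegree = finrank K V := by
  have hle : ∀ f, f ∣ g → f.Monic →
      g.natDegree * finrank K (LinearMap.ker (aeval T f)) ≤ finrank K V * f.natDegree := by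
    intro f hf hfm
    have h1 := hr f hf hfm
    have h2 := (aeval T f).finrank_range_add_finrank_ker
    have h3 := natDegree_le_of_dvd hf hg.ne_zero
    zify [h3] at *
    nlinarith
  have heq : ∀ f, f ∣ g → f.Monic →
      g.natDegree * finrank K (LinearMap.ker (aeval T f)) = finrank K V * f.natDegree := by
    intro f hf hfm
    refine le_antisymm (hle f hf hfm) ?_
    obtain ⟨h, rfl⟩ := hf
    have hh : h.Monic := hfm.of_mul_monic_left hg
    have h1 := hle h (dvd_mul_left _ _) hh
    have h2 := (aeval T f).finrank_range_add_finrank_ker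
    have h3 : finrank K (LinearMap.range (aeval T f)) ≤
        finrank K (LinearMap.ker (aeval T h)) := by
      refine Submodule.finrank_mono ?_
      rintro _ ⟨x, rfl⟩
      rw [LinearMap.mem_ker, ← End.mul_apply, ← map_mul, mul_comm, hT]
      rfl
    have h4 := hfm.natDegree_mul hh
    nlinarith
  obtain ⟨q, hqm, hq, hqg⟩ := exists_monic_irreducible_factor g
    (fun h => by rw [hg.eq_one_of_isUnit h, natDegree_one] at hg0; exact lt_irrefl _ hg0)
  set W := LinearMap.ker (aeval T q)
  have hW : W ≤ W.comap T := ker_aeval_le_comap T q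
  obtain ⟨e, he⟩ := charpoly_eq_pow_of_irreducible (LinearMap.restrict T hW : End K W) q hq hqm (by
    refine LinearMap.ext fun x => Subtype.ext ?_
    exact (aeval_apply_of_intertwining T (LinearMap.restrict T hW : End K W) W.subtype
          (fun _ => rfl) q x).symm.trans x.2)
  have h3 := congrArg natDegree he
  rw [LinearMap.charpoly_natDegree, hqm.natDegree_pow] at h3
  have h4 := heq q hqg hqm
  have hw : e * g.natDegree = finrank K V := by
    rw [h3] at h4
    refine Nat.eq_of_mul_eq_mul_right hq.natDegree_pos ?_
    rw [← h4]; ring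
  refine ⟨e, charpoly_eq_pow_of_finrank_ker e _ g T rfl hg hT fun f hf hfm => ?_, hw⟩
  have h5 := heq f hf hfm
  rw [← hw] at h5
  refine Nat.eq_of_mul_eq_mul_left hg0 ?_
  rw [h5]; ring

/-- V is a vector space over the field K[X]/(q); its basis is multiplied by the power basis of that
field. -/
theorem exists_basis_pow {K V : Type*} [Field K] [AddCommGroup V] [Module K V]
    [FiniteDimensional K V] (T : End K V) (q : K[X]) (hq : Irreducible q)
    (hT : aeval T q = 0) : ∃ (w : ℕ) (u : Fin w → V) (v : Basis (Fin q.natDegree × Fin w) K V),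
      ∀ l s, v (l, s) = (T ^ (l : ℕ)) (u s) := by
  have := Fact.mk hq
  let φ : AdjoinRoot q →ₐ[K] End K V :=
    Ideal.Quotient.liftₐ (Ideal.span {q}) (aeval T) fun a ha => by
      obtain ⟨r, rfl⟩ := Ideal.mem_span_singleton.1 ha
      rw [map_mul, hT, zero_mul]
  let _ : Module (AdjoinRoot q) V := Module.compHom V (φ : AdjoinRoot q →+* End K V)
  have hsm : ∀ (x : AdjoinRoot q) (v : V), x • v = φ x v := fun _ _ => rfl
  have : IsScalarTower K (AdjoinRoot q) V := ⟨fun c x v => by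
    rw [hsm, hsm, map_smul]; rfl⟩
  have : Module.Finite (AdjoinRoot q) V := Module.Finite.of_restrictScalars_finite K _ _
  let b := Module.finBasis (AdjoinRoot q) V
  let pb := AdjoinRoot.powerBasis hq.ne_zero
  have hdim : pb.dim = q.natDegree := AdjoinRoot.powerBasis_dim _
  let c := (pb.basis.smulTower b).reindex
    (Equiv.prodCongr (finCongr hdim) (Equiv.refl (Fin (finrank (AdjoinRoot q) V))))
  refine ⟨_, b, c, fun l s => ?_⟩
  simp only [c, Basis.reindex_apply]
  have h1 : (pb.basis.smulTower b) (((finCongr hdim).prodCongr (Equiv.refl _)).symm (l, s)) =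
      (AdjoinRoot.root q ^ (l : ℕ)) • b s := by
    change (pb.basis.smulTower b) (Fin.cast hdim.symm l, s) = _
    rw [Basis.smulTower_apply, pb.basis_eq_pow]
    rfl
  rw [h1, hsm, map_pow]
  congr 2
  exact (Ideal.Quotient.liftₐ_apply ..).trans (aeval_X T)

/-- With u_s a basis of W over k[X]/(q), a tuple of polynomials h_s over K of degree below deg q is
recovered from ∑ h_s(S) u_s. Tuples of multiples f r_s with deg r_s < deg q - deg f give elements in
the image of f(S), which are therefore independent enough. A polynomial q that becomes reducible
over K causes no harm. -/
theorem finrank_mul_le_finrank_range_aeval_baseChange {k K W : Type*} [Field k] [Field K]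
    [Algebra k K] [AddCommGroup W] [Module k W] [FiniteDimensional k W] (S : End k W) (q : k[X])
    (hq : Irreducible q) (hS : aeval S q = 0) (f : K[X]) (hf : f ≠ 0) :
    finrank k W * (q.natDegree - f.natDegree) ≤
      q.natDegree *
        finrank K (LinearMap.range (aeval (LinearMap.baseChange K S : End K (K ⊗[k] W)) f)) := by
  obtain ⟨w, u, v, hv⟩ := exists_basis_pow S q hq hS
  set S' : End K (K ⊗[k] W) := LinearMap.baseChange K S with hS'
  let vB := v.baseChange K
  have hpow : ∀ (l : ℕ) (x : W), (S' ^ l) (1 ⊗ₜ x) = 1 ⊗ₜ[k] (S ^ l) x := by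
    intro l
    induction l with
    | zero => intro x; rfl
    | succ l ih => intro x; rw [pow_succ, pow_succ, End.mul_apply, End.mul_apply, ← ih]; rfl
  let Ψ : (Fin w → K[X]) →ₗ[K] K ⊗[k] W :=
    { toFun := fun h => ∑ s, aeval S' (h s) (1 ⊗ₜ u s)
      map_add' := fun h h' => by simp [Finset.sum_add_distrib]
      map_smul' := fun c h => by simp [Finset.smul_sum] }
  have hΨ : ∀ h : Fin w → K[X], (∀ s, (h s).natDegree < q.natDegree) →
      Ψ h = ∑ p : Fin q.natDegree × Fin w, (h p.2).coeff p.1 • vB p := by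
    intro h hh
    rw [Fintype.sum_prod_type_right]
    change ∑ s, aeval S' (h s) (1 ⊗ₜ u s) = _
    refine Finset.sum_congr rfl fun s _ => ?_
    rw [aeval_eq_sum_range' (hh s), LinearMap.sum_apply, ← Fin.sum_univ_eq_sum_range
      (fun i => ((h s).coeff i • S' ^ i : End K (K ⊗[k] W)) (1 ⊗ₜ[k] u s))]
    refine Finset.sum_congr rfl fun l _ => ?_
    rw [LinearMap.smul_apply, hpow, ← hv, Basis.baseChange_apply]
  have hinj : ∀ h : Fin w → K[X], (∀ s, (h s).natDegree < q.natDegree) → Ψ h = 0 → h = 0 := by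
    intro h hh h0
    rw [hΨ h hh] at h0
    have := Fintype.linearIndependent_iff.1 vB.linearIndependent
      (fun p => (h p.2).coeff p.1) h0
    ext s l
    by_cases hl : l < q.natDegree
    · exact this (⟨l, hl⟩, s)
    · exact coeff_eq_zero_of_natDegree_lt (lt_of_lt_of_le (hh s) (not_lt.1 hl))
  -- The subtraction truncates: for deg f ≥ deg q the space of admissible r is zero and the bound is
  -- trivial.
  set m := q.natDegree - f.natDegree
  have hdeg : ∀ r ∈ degreeLT K m, (f * r).natDegree < q.natDegree := by
    intro r hr
    rcases eq_or_ne r 0 with rfl | hr0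
    · rw [mul_zero, natDegree_zero]; exact hq.natDegree_pos
    · rw [mem_degreeLT, ← natDegree_lt_iff_degree_lt hr0] at hr
      rw [natDegree_mul hf hr0]
      omega
  let Φ : (Fin w → degreeLT K m) →ₗ[K] LinearMap.range (aeval S' f) :=
    { toFun := fun h => ⟨Ψ fun s => f * (h s : K[X]), ∑ s, aeval S' (h s : K[X]) (1 ⊗ₜ u s), by
        rw [map_sum]
        refine Finset.sum_congr rfl fun s _ => ?_
        rw [← End.mul_apply, ← map_mul]⟩
      map_add' := fun h h' => Subtype.ext (by
        rw [Submodule.coe_add, ← map_add]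
        exact congrArg Ψ (funext fun s => mul_add _ _ _))
      map_smul' := fun c h => Subtype.ext (by
        rw [RingHom.id_apply, Submodule.coe_smul, ← map_smul]
        exact congrArg Ψ (funext fun s => mul_smul_comm _ _ _)) }
  have hΦ : Function.Injective Φ := by
    refine (injective_iff_map_eq_zero Φ).2 fun h h0 => ?_
    have := hinj (fun s => f * (h s : K[X])) (fun s => hdeg _ (h s).2) (congrArg Subtype.val h0)
    ext1 s
    refine Subtype.ext ?_
    exact (mul_eq_zero.1 (congrFun this s)).resolve_left hf
  have h1 := LinearMap.finrank_le_finrank_of_injective hΦ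
  have hd : finrank K (degreeLT K m) = m := by
    rw [(degreeLTEquiv K m).finrank_eq, finrank_fin_fun]
  rw [finrank_pi_fintype, Finset.sum_const, Finset.card_univ, Fintype.card_fin, hd,
    smul_eq_mul] at h1
  rw [finrank_eq_card_basis v, Fintype.card_prod, Fintype.card_fin, Fintype.card_fin, mul_assoc]
  exact Nat.mul_le_mul_left _ h1

theorem range_le_comap_of_commute {K V : Type*} [Field K] [AddCommGroup V] [Module K V]
    {T E : End K V} (h : Commute T E) : LinearMap.range E ≤ (LinearMap.range E).comap T := by
  rintro _ ⟨x, rfl⟩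
  exact ⟨T x, (LinearMap.congr_fun h.eq x).symm⟩

theorem finrank_range_aeval_restrict {K V : Type*} [Field K] [AddCommGroup V] [Module K V]
    {T E : End K V} (h : Commute T E) (f : K[X]) :
    finrank K (LinearMap.range (aeval (LinearMap.restrict T (range_le_comap_of_commute h) :
      End K (LinearMap.range E)) f)) = finrank K (LinearMap.range (aeval T f * E)) := by
  have h1 : LinearMap.range (aeval T f * E) =
      (LinearMap.range (aeval (LinearMap.restrict T (range_le_comap_of_commute h) :
      End K (LinearMap.range E)) f)).map (LinearMap.range E).subtype := by
    rw [← LinearMap.range_comp]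
    ext x
    constructor
    · rintro ⟨y, rfl⟩
      refine ⟨⟨E y, y, rfl⟩, ?_⟩
      exact (aeval_apply_of_intertwining T (LinearMap.restrict T (range_le_comap_of_commute h) :
        End K (LinearMap.range E)) (LinearMap.range E).subtype (fun _ => rfl) f ⟨E y, y, rfl⟩).symm
    · rintro ⟨⟨_, y, rfl⟩, rfl⟩
      refine ⟨y, ?_⟩
      exact (aeval_apply_of_intertwining T (LinearMap.restrict T (range_le_comap_of_commute h) :
        End K (LinearMap.range E)) (LinearMap.range E).subtype (fun _ => rfl) f ⟨E y, y, rfl⟩)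
  rw [h1, Submodule.finrank_map_subtype_eq]

theorem charpoly_blockDiagonal' {R ι : Type*} [CommRing R] [Fintype ι] [DecidableEq ι]
    {n : ι → Type*} [∀ i, Fintype (n i)] [∀ i, DecidableEq (n i)]
    (M : ∀ i, Matrix (n i) (n i) R) :
    (Matrix.blockDiagonal' M).charpoly = ∏ i, (M i).charpoly := by
  let e := Fintype.equivFin ι
  let b : (Σ i, n i) → Fin (Fintype.card ι) := fun x => e x.1
  have h : (Matrix.blockDiagonal' M).charmatrix.BlockTriangular b := by
    refine Matrix.BlockTriangular.charmatrix fun x y hxy => ?_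
    exact Matrix.blockDiagonal'_apply_ne M x.2 y.2 fun h => hxy.ne (congrArg e h).symm
  rw [Matrix.charpoly, h.det_fintype, ← e.prod_comp]
  refine Finset.prod_congr rfl fun i _ => ?_
  let r : n i ≃ {x : Σ i, n i // b x = e i} :=
    { toFun := fun a => ⟨⟨i, a⟩, rfl⟩
      invFun := fun x => (e.injective x.2 : x.1.1 = i) ▸ x.1.2
      left_inv := fun a => rfl
      right_inv := by
        rintro ⟨⟨j, a⟩, h⟩
        obtain rfl := e.injective h
        rfl }
  rw [← Matrix.charmatrix_toSquareBlock, ← Matrix.charpoly,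
    ← Matrix.charpoly_reindex r (M i)]
  congr 1
  ext x y
  obtain ⟨a, rfl⟩ := r.surjective x
  obtain ⟨c, rfl⟩ := r.surjective y
  simp only [Matrix.reindex_apply, Matrix.submatrix_apply, Equiv.symm_apply_apply]
  exact Matrix.blockDiagonal'_apply_eq M i a c

theorem charpoly_eq_prod_of_idempotents {K V ι : Type*} [Field K] [AddCommGroup V] [Module K V]
    [FiniteDimensional K V] [Fintype ι] [DecidableEq ι] (T : End K V) (E : ι → End K V)
    (hc : ∀ i, Commute T (E i)) (ho : ∀ i j, i ≠ j → E i * E j = 0) (hs : ∑ i, E i = 1) :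
    T.charpoly = ∏ i, LinearMap.charpoly (T.restrict (range_le_comap_of_commute (hc i))) ∧
      finrank K V = ∑ i, finrank K (LinearMap.range (E i)) := by
  have hid : ∀ i, E i * E i = E i := by
    intro i
    conv_rhs => rw [← mul_one (E i), ← hs, Finset.mul_sum]
    exact (Finset.sum_eq_single i (fun j _ hj => ho i j hj.symm) (by simp)).symm
  have hint : DirectSum.IsInternal fun i => LinearMap.range (E i) := by
    refine DirectSum.isInternal_submodule_of_iSupIndep_of_iSup_eq_top ?_ ?_
    · intro i
      have : ⨆ j, ⨆ (_ : j ≠ i), LinearMap.range (E j) ≤ LinearMap.ker (E i) := by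
        refine iSup₂_le fun j hj => ?_
        rintro _ ⟨y, rfl⟩
        exact LinearMap.congr_fun (ho i j hj.symm) y
      refine Disjoint.mono_right this ?_
      rw [Submodule.disjoint_def]
      rintro _ ⟨y, rfl⟩ hy
      rw [LinearMap.mem_ker, ← End.mul_apply, hid] at hy
      exact hy
    · refine eq_top_iff.2 fun x _ => ?_
      have : x = ∑ i, E i x := by rw [← LinearMap.sum_apply, hs]; rfl
      rw [this]
      exact Submodule.sum_mem _ fun i _ => Submodule.mem_iSup_of_mem i ⟨x, rfl⟩
  let b := fun i => Module.finBasis K (LinearMap.range (E i))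
  have hf : ∀ i, Set.MapsTo T (LinearMap.range (E i)) (LinearMap.range (E i)) :=
    fun i => range_le_comap_of_commute (hc i)
  constructor
  · rw [← LinearMap.charpoly_toMatrix T (hint.collectedBasis b),
      LinearMap.toMatrix_directSum_collectedBasis_eq_blockDiagonal' hint hint b b hf,
      charpoly_blockDiagonal']
    exact Finset.prod_congr rfl fun i _ => LinearMap.charpoly_toMatrix _ (b i)
  · rw [finrank_eq_card_basis (hint.collectedBasis b), Fintype.card_sigma]
    simp

/-- The previous bound is applied to the range of the idempotent, whose base change embeds by
flatness and is fixed by the base change of `E`. -/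
theorem finrank_mul_le_finrank_range_aeval_baseChange_mul {k K W : Type*} [Field k] [Field K]
    [Algebra k K] [AddCommGroup W] [Module k W] [FiniteDimensional k W] (S E : End k W)
    (hSE : Commute S E) (hE : E * E = E) (q : k[X])
    (hq : Irreducible q) (hS : aeval S q * E = 0) (f : K[X]) (hf : f ≠ 0) :
    finrank k (LinearMap.range E) * (q.natDegree - f.natDegree) ≤
      q.natDegree *
        finrank K (LinearMap.range (aeval (LinearMap.baseChange K S : End K (K ⊗[k] W)) f *
          LinearMap.baseChange K E)) := by
  let S' : End k (LinearMap.range E) := LinearMap.restrict S (range_le_comap_of_commute hSE)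
  have hS' : aeval S' q = 0 := by
    refine LinearMap.ext ?_
    rintro ⟨_, x, rfl⟩
    refine Subtype.ext ?_
    refine (aeval_apply_of_intertwining S S' (LinearMap.range E).subtype
      (fun _ => rfl) q ⟨E x, x, rfl⟩).symm.trans ?_
    exact LinearMap.congr_fun hS x
  refine (finrank_mul_le_finrank_range_aeval_baseChange S' q hq hS' f hf).trans
    (Nat.mul_le_mul_left _ ?_)
  let i := LinearMap.baseChange K (LinearMap.range E).subtype
  have hi : Function.Injective i :=
    Module.Flat.lTensor_preserves_injective_linearMap _ (LinearMap.range E).injective_subtype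
  rw [(Submodule.equivMapOfInjective i hi _).finrank_eq]
  refine Submodule.finrank_mono ?_
  rintro _ ⟨_, ⟨x, rfl⟩, rfl⟩
  refine ⟨i x, ?_⟩
  have h1 : LinearMap.baseChange K E (i x) = i x := by
    change (LinearMap.baseChange K E ∘ₗ i) x = i x
    congr 1
    rw [← LinearMap.baseChange_comp]
    congr 1
    ext ⟨_, y, rfl⟩
    exact LinearMap.congr_fun hE y
  rw [End.mul_apply, h1]
  refine aeval_apply_of_intertwining _ (LinearMap.baseChange K S' : End K _) i (fun y => ?_) f x
  change (LinearMap.baseChange K S ∘ₗ i) y = (i ∘ₗ LinearMap.baseChange K S') y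
  rw [← LinearMap.baseChange_comp, ← LinearMap.baseChange_comp]
  rfl

end LinearAlgebra

/-! ### Linear endomorphisms of a central simple algebra -/

section CentralSimple

open Module

/-- A is a simple module over A ⊗ Aᵒᵖ, since submodules are two-sided ideals, and its endomorphisms
are the elements of L. By Jacobson density an L-linear map agrees with the action of some tensor on
a finite basis, hence everywhere. -/
theorem exists_eq_sum_mul_mul {L A : Type*} [Field L] [Ring A] [Algebra L A] [IsSimpleRing A]
    [Algebra.IsCentral L A] [FiniteDimensional L A] (f : End L A) :
    ∃ (n : ℕ) (u c : Fin n → A), ∀ x, f x = ∑ s, u s * x * c s := by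
  classical
  let _ : Module (A ⊗[L] Aᵐᵒᵖ) A := TensorProduct.Algebra.module
  have hsm : ∀ (a b x : A), (a ⊗ₜ[L] op b : A ⊗[L] Aᵐᵒᵖ) • x = a * x * b := fun a b x => by
    rw [TensorProduct.Algebra.smul_def]
    simp [mul_assoc]
  -- Such an endomorphism is multiplication by its value at 1, which commutes with A on both sides
  -- and is therefore in L.
  have hL : ∀ (g : End (A ⊗[L] Aᵐᵒᵖ) A), ∃ z : L, ∀ x, g x = z • x := by
    intro g
    have h1 : ∀ a x, g (a * x) = a * g x := fun a x => by
      have := map_smul g (a ⊗ₜ[L] op 1 : A ⊗[L] Aᵐᵒᵖ) x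
      rwa [hsm, hsm, mul_one, mul_one] at this
    have h2 : ∀ a x, g (x * a) = g x * a := fun a x => by
      have := map_smul g (1 ⊗ₜ[L] op a : A ⊗[L] Aᵐᵒᵖ) x
      rwa [hsm, hsm, one_mul, one_mul] at this
    have h3 : g 1 ∈ Subalgebra.center L A := by
      rw [Subalgebra.mem_center_iff]
      intro b
      rw [← h1, ← h2, mul_one, one_mul]
    rw [Algebra.IsCentral.center_eq_bot, Algebra.mem_bot] at h3
    obtain ⟨z, hz⟩ := h3
    refine ⟨z, fun x => ?_⟩
    rw [Algebra.smul_def, hz, ← h2, one_mul]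
  have hsimple : IsSimpleModule (A ⊗[L] Aᵐᵒᵖ) A := by
    refine isSimpleModule_iff .. |>.2 ⟨fun N => ?_⟩
    rw [or_iff_not_imp_left]
    intro hN
    obtain ⟨x, hx, hx0⟩ := N.ne_bot_iff.1 hN
    let I : TwoSidedIdeal A := TwoSidedIdeal.mk' N N.zero_mem (fun h h' => N.add_mem h h')
      (fun h => N.neg_mem h)
      (fun {a y} h => by
        have := N.smul_mem (a ⊗ₜ[L] op 1 : A ⊗[L] Aᵐᵒᵖ) h
        rwa [hsm, mul_one] at this)
      (fun {y a} h => by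
        have := N.smul_mem (1 ⊗ₜ[L] op a : A ⊗[L] Aᵐᵒᵖ) h
        rwa [hsm, one_mul] at this)
    have hI : ∀ y, y ∈ I ↔ y ∈ N := fun y => TwoSidedIdeal.mem_mk' ..
    have : I = ⊤ := (eq_bot_or_eq_top I).resolve_left fun h => hx0 (by
      have := (hI x).2 hx
      rwa [h, TwoSidedIdeal.mem_bot] at this)
    refine eq_top_iff.2 fun y _ => (hI y).1 (this ▸ TwoSidedIdeal.mem_top _)
  let F : End (End (A ⊗[L] Aᵐᵒᵖ) A) A :=
    { toFun := f
      map_add' := map_add f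
      map_smul' := fun g x => by
        obtain ⟨z, hz⟩ := hL g
        rw [RingHom.id_apply, End.smul_def, End.smul_def, hz, hz, map_smul] }
  obtain ⟨r, hr⟩ := jacobson_density F (Finset.univ.image (Module.finBasis L A))
  have hlin : ∀ (r : A ⊗[L] Aᵐᵒᵖ), ∃ (n : ℕ) (u c : Fin n → A),
      ∀ x, r • x = ∑ s, u s * x * c s := by
    intro r
    induction r with
    | zero => exact ⟨0, Fin.elim0, Fin.elim0, fun x => by
      have h := hsm 0 0 x
      rw [TensorProduct.zero_tmul, mul_zero] at h
      rw [Fin.sum_univ_zero]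
      exact h⟩
    | tmul a b => exact ⟨1, fun _ => a, fun _ => b.unop, fun x => by simpa using hsm a b.unop x⟩
    | add r r' h h' =>
      obtain ⟨n, u, c, h⟩ := h
      obtain ⟨n', u', c', h'⟩ := h'
      refine ⟨n + n', Fin.append u u', Fin.append c c', fun x => ?_⟩
      simp [Fin.sum_univ_add, add_smul, h, h']
  obtain ⟨n, u, c, h⟩ := hlin r
  refine ⟨n, u, c, fun x => ?_⟩
  let f' : End L A := ∑ s, LinearMap.mulLeft L (u s) ∘ₗ LinearMap.mulRight L (c s)
  have : f = f' := by
    refine (Module.finBasis L A).ext fun i => ?_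
    refine (hr _ (Finset.mem_image_of_mem _ (Finset.mem_univ i))).trans ?_
    rw [h]
    simp [f', mul_assoc]
  rw [this]
  simp [f', mul_assoc]

end CentralSimple

/-! ### The functor F(M) = M^d and the rank inequality -/

section Twist

open Module

/-- The action of a matrix over a ring on column vectors with entries in a module. -/
def matVec {R M a b : Type*} [Ring R] [AddCommGroup M] [Module R M] [Fintype b]
    (T : Matrix a b R) (y : b → M) : a → M := fun i => ∑ j, T i j • y j

theorem matVec_mul {R M a b c : Type*} [Ring R] [AddCommGroup M] [Module R M] [Fintype b]
    [Fintype c] (S : Matrix a b R) (T : Matrix b c R) (y : c → M) :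
    matVec (S * T) y = matVec S (matVec T y) := by
  ext i
  simp only [matVec, Matrix.mul_apply, Finset.sum_smul, Finset.smul_sum, mul_smul]
  exact Finset.sum_comm

theorem matVec_one {R M a : Type*} [Ring R] [AddCommGroup M] [Module R M] [Fintype a]
    [DecidableEq a] (y : a → M) : matVec (1 : Matrix a a R) y = y := by
  ext i
  simp [matVec, Matrix.one_apply, ite_smul]

theorem matVec_add {R M a b : Type*} [Ring R] [AddCommGroup M] [Module R M] [Fintype b]
    (T : Matrix a b R) (y z : b → M) : matVec T (y + z) = matVec T y + matVec T z := by
  ext i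
  simp [matVec, Finset.sum_add_distrib]

theorem add_matVec {R M a b : Type*} [Ring R] [AddCommGroup M] [Module R M] [Fintype b]
    (S T : Matrix a b R) (y : b → M) : matVec (S + T) y = matVec S y + matVec T y := by
  ext i
  simp [matVec, Finset.sum_add_distrib, add_smul]

theorem matVec_zero {R M a b : Type*} [Ring R] [AddCommGroup M] [Module R M] [Fintype b]
    (T : Matrix a b R) : matVec T (0 : b → M) = 0 := by
  ext i
  simp [matVec]

theorem zero_matVec {R M a b : Type*} [Ring R] [AddCommGroup M] [Module R M] [Fintype b]
    (y : b → M) : matVec (0 : Matrix a b R) y = 0 := by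
  ext i
  simp [matVec]

variable {K R : Type*} [Field K] [Ring R] [Algebra K R] {d : ℕ}

/-- The module `F(M) = M ^ d` on which `r : R` acts through the matrix `φ r`. -/
def Twist (_φ : R →ₐ[K] Matrix (Fin d) (Fin d) R) (M : Type*) := Fin d → M

namespace Twist

@[ext]
theorem ext {φ : R →ₐ[K] Matrix (Fin d) (Fin d) R} {M : Type*} {y z : Twist φ M}
    (h : ∀ p, y p = z p) : y = z := funext h

variable (φ : R →ₐ[K] Matrix (Fin d) (Fin d) R)
variable (M : Type*) [AddCommGroup M] [Module K M] [Module R M] [IsScalarTower K R M]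

instance : AddCommGroup (Twist φ M) := inferInstanceAs (AddCommGroup (Fin d → M))

instance : Module K (Twist φ M) := inferInstanceAs (Module K (Fin d → M))

instance [FiniteDimensional K M] : FiniteDimensional K (Twist φ M) :=
  inferInstanceAs (FiniteDimensional K (Fin d → M))

instance : Module R (Twist φ M) where
  smul r y := matVec (M := M) (φ r) y
  one_smul y := (congrArg (fun T => matVec (M := M) T y) (map_one φ)).trans (matVec_one _)
  mul_smul r s y :=
    (congrArg (fun T => matVec (M := M) T y) (map_mul φ r s)).trans (matVec_mul _ _ _)
  smul_zero _ := matVec_zero _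
  smul_add _ _ _ := matVec_add _ _ _
  add_smul r s y :=
    (congrArg (fun T => matVec (M := M) T y) (map_add φ r s)).trans (add_matVec _ _ _)
  zero_smul y :=
    (congrArg (fun T => matVec (M := M) T y) (map_zero φ)).trans (zero_matVec _)

variable {M}

instance : IsScalarTower K R (Twist φ M) where
  smul_assoc c r y := by
    ext p
    change ∑ q, φ (c • r) p q • y q = c • ∑ q, φ r p q • y q
    rw [map_smul, Finset.smul_sum]
    exact Finset.sum_congr rfl fun q _ => smul_assoc _ _ _

variable {N : Type*} [AddCommGroup N] [Module K N] [Module R N] [IsScalarTower K R N]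

/-- Functoriality of `Twist`. -/
def map (f : M →ₗ[R] N) : Twist φ M →ₗ[R] Twist φ N where
  toFun y := fun p => f (y p)
  map_add' y z := funext fun p => map_add f (y p) (z p)
  map_smul' r y := funext fun p => by
    change f (∑ q, φ r p q • y q) = ∑ q, φ r p q • f (y q)
    rw [map_sum]
    exact Finset.sum_congr rfl fun q _ => map_smul f _ _

/-- `Twist` commutes with finite powers. -/
def piEquiv (ι : Type*) : Twist φ (ι → M) ≃ₗ[R] (ι → Twist φ M) where
  toFun y := fun i p => y p i
  invFun y := fun p i => y i p
  map_add' y z := rfl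
  map_smul' r y := by
    ext i p
    change (∑ q, φ r p q • y q) i = ∑ q, φ r p q • y q i
    simp
  left_inv y := rfl
  right_inv y := rfl

/-- The matrix of the action on `F(F(M))`. -/
def iterMatrix {R : Type*} [Ring R] (φ : R →+* Matrix (Fin d) (Fin d) R) (r : R) :
    Matrix (Fin d × Fin d) (Fin d × Fin d) R :=
  Matrix.of fun x y => φ (φ r x.1 y.1) x.2 y.2

/-- The matrix of the action on `F(M) ^ d`. -/
def diagMatrix {R : Type*} [Ring R] (φ : R →+* Matrix (Fin d) (Fin d) R) (r : R) :
    Matrix (Fin d × Fin d) (Fin d × Fin d) R :=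
  Matrix.of fun x y => if x.1 = y.1 then φ r x.2 y.2 else 0

/-- An invertible matrix intertwining the two actions identifies `F(F(M))` with `F(M) ^ d`. -/
def twistEquiv (θ θ' : Matrix (Fin d × Fin d) (Fin d × Fin d) R) (h1 : θ * θ' = 1)
    (h2 : θ' * θ = 1)
    (hθ : ∀ r, iterMatrix (φ : R →+* _) r * θ = θ * diagMatrix (φ : R →+* _) r) :
    Twist φ (Twist φ M) ≃ₗ[R] (Fin d → Twist φ M) where
  toFun y := fun p q => matVec θ' (fun x => y x.1 x.2) (p, q)
  invFun y := fun p q => matVec θ (fun x => y x.1 x.2) (p, q)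
  map_add' y z := by
    ext p q
    exact congrFun (matVec_add θ' (fun x => y x.1 x.2) (fun x => z x.1 x.2)) (p, q)
  map_smul' r y := by
    have e1 : ∀ y : Twist φ (Twist φ M), (fun x : Fin d × Fin d => (r • y) x.1 x.2) =
        matVec (iterMatrix (φ : R →+* _) r) (fun x => y x.1 x.2) := by
      intro y
      ext ⟨p, k⟩
      change (∑ q, φ r p q • y q) k = _
      rw [matVec, Fintype.sum_prod_type]
      exact Finset.sum_apply k _ _
    have e2 : ∀ y : Fin d × Fin d → M, ∀ p q, matVec (diagMatrix (φ : R →+* _) r) y (p, q) =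
        matVec (φ r) (fun l => y (p, l)) q := by
      intro y p q
      simp [matVec, diagMatrix, Fintype.sum_prod_type, ite_smul]
    ext p q
    change matVec θ' (fun x : Fin d × Fin d => (r • y) x.1 x.2) (p, q) = _
    rw [e1, ← matVec_mul]
    have e3 : θ' * iterMatrix (φ : R →+* _) r = diagMatrix (φ : R →+* _) r * θ' := by
      calc _ = θ' * (iterMatrix (φ : R →+* _) r * θ) * θ' := by
            rw [mul_assoc, mul_assoc, h1, mul_one]
        _ = _ := by rw [hθ, ← mul_assoc, h2, one_mul]
    rw [e3, matVec_mul, e2]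
    rfl
  left_inv y := by
    have := matVec_mul θ θ' (fun x : Fin d × Fin d => y x.1 x.2)
    rw [h1, matVec_one] at this
    ext p q
    exact (congrFun this (p, q)).symm
  right_inv y := by
    have := matVec_mul θ' θ (fun x : Fin d × Fin d => y x.1 x.2)
    rw [h2, matVec_one] at this
    ext p q
    exact (congrFun this (p, q)).symm

end Twist

/-- The rank over `K` of the action of `τ` on a module. -/
noncomputable def actionRank (K : Type*) {R : Type*} [Field K] [Ring R] [Algebra K R] (τ : R)
    (M : Type*) [AddCommGroup M] [Module K M] [Module R M] [IsScalarTower K R M] : ℕ :=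
  finrank K (LinearMap.range (Algebra.lsmul K K M τ))

section

variable (τ : R) {M M' M'' : Type*} [AddCommGroup M] [Module K M] [Module R M]
  [IsScalarTower K R M] [AddCommGroup M'] [Module K M'] [Module R M'] [IsScalarTower K R M']
  [AddCommGroup M''] [Module K M''] [Module R M''] [IsScalarTower K R M'']

theorem actionRank_add_le [FiniteDimensional K M] (i : M' →ₗ[R] M) (p : M →ₗ[R] M'')
    (hi : Function.Injective i) (hp : Function.Surjective p) (h : ∀ x, p (i x) = 0) :
    actionRank K τ M' + actionRank K τ M'' ≤ actionRank K τ M :=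
  finrank_range_add_le (Algebra.lsmul K K M τ) (Algebra.lsmul K K M' τ) (Algebra.lsmul K K M'' τ)
    (i.restrictScalars K) (p.restrictScalars K) hi hp h (fun x => (map_smul i τ x).symm)
    (fun x => map_smul p τ x)

theorem actionRank_congr (e : M ≃ₗ[R] M') : actionRank K τ M = actionRank K τ M' := by
  have h : LinearMap.range (Algebra.lsmul K K M' τ) =
      (LinearMap.range (Algebra.lsmul K K M τ)).map (e.restrictScalars K : M →ₗ[K] M') := by
    ext x
    constructor
    · rintro ⟨y, rfl⟩
      exact ⟨τ • e.symm y, ⟨_, rfl⟩, by simp⟩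
    · rintro ⟨_, ⟨y, rfl⟩, rfl⟩
      exact ⟨e y, by simp⟩
  rw [actionRank, actionRank, h, LinearEquiv.finrank_map_eq]

theorem actionRank_pi [FiniteDimensional K M] (s : ℕ) :
    actionRank K τ (Fin s → M) = s * actionRank K τ M := by
  let f : LinearMap.range (Algebra.lsmul K K (Fin s → M) τ) ≃ₗ[K]
      (Fin s → LinearMap.range (Algebra.lsmul K K M τ)) :=
    { toFun := fun y i => ⟨y.1 i, by obtain ⟨_, x, rfl⟩ := y; exact ⟨x i, rfl⟩⟩
      invFun := fun y => ⟨fun i => y i, by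
        choose x hx using fun i => (y i).2
        exact ⟨x, funext hx⟩⟩
      map_add' := fun _ _ => rfl
      map_smul' := fun _ _ => rfl
      left_inv := fun _ => rfl
      right_inv := fun _ => rfl }
  rw [actionRank, f.finrank_eq, finrank_pi_fintype]
  simp [actionRank]

end

/-- The family `y` of matrices is separated by the maps `Y ↦ ∑ s, u s * Y (p s) (q s) * c s`. -/
def HasDualSystem {ν R : Type*} [DecidableEq ν] [Ring R] {d : ℕ}
    (y : ν → Matrix (Fin d) (Fin d) R) : Prop :=
  ∀ μ, ∃ (N : ℕ) (u c : Fin N → R) (p q : Fin N → Fin d),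
    ∀ κ, ∑ s, u s * y κ (p s) (q s) * c s = if κ = μ then 1 else 0

section RankInequality

variable (φ : R →ₐ[K] Matrix (Fin d) (Fin d) R) {r : ℕ} (b : Basis (Fin r) K R)

theorem Twist.finrank_eq {M : Type*} [AddCommGroup M] [Module K M] [FiniteDimensional K M] :
    finrank K (Twist φ M) = d * finrank K M :=
  (finrank_pi_fintype K).trans (by simp)

/-- The vector of `F(M)` with one nonzero entry. -/
def Twist.single {M : Type*} [AddCommGroup M] (q : Fin d) (m : M) : Twist φ M :=
  (Pi.single q m : Fin d → M)

theorem Twist.smul_single_apply {M : Type*} [AddCommGroup M] [Module K M] [Module R M]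
    [IsScalarTower K R M] (x : R) (q p : Fin d) (m : M) :
    (x • Twist.single φ q m) p = φ x p q • m := by
  change ∑ q', φ x p q' • (Pi.single q m : Fin d → M) q' = _
  rw [Finset.sum_eq_single q]
  · simp
  · intro q' _ hq'
    simp [hq']
  · simp

/-- The map `R ^ s → (F(M) ^ d) ^ r` given by a family of `s` elements of `M`. -/
noncomputable def familyMap {M : Type*} [AddCommGroup M] [Module K M] [Module R M]
    [IsScalarTower K R M] {s : ℕ} (m : Fin s → M) :
    (Fin s → R) →ₗ[R] (Fin r → Fin d → Twist φ M) :=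
  LinearMap.pi fun κ => LinearMap.pi fun q =>
    ∑ t, (LinearMap.toSpanSingleton R (Twist φ M)
      (Twist.single φ q (b κ • m t))).comp (LinearMap.proj t)

theorem familyMap_apply {M : Type*} [AddCommGroup M] [Module K M] [Module R M]
    [IsScalarTower K R M] {s : ℕ} (m : Fin s → M) (x : Fin s → R) (κ : Fin r) (q p : Fin d) :
    familyMap φ b m x κ q p = ∑ t, φ (x t) p q • b κ • m t := by
  have h : familyMap φ b m x κ q =
      ∑ t, x t • Twist.single φ q (b κ • m t) := by
    simp [familyMap, LinearMap.toSpanSingleton_apply]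
  rw [h]
  refine (Finset.sum_apply p _ _).trans ?_
  exact Finset.sum_congr rfl fun t _ => Twist.smul_single_apply φ _ _ _ _

/-- The dual system recovers the coordinates of y in R from sums of terms u φ(y)_pq c. From an
element of the kernel it therefore extracts relations among the basis vectors `m t` whose
coefficients, the coordinates of the x_t, lie in K and so vanish. -/
theorem familyMap_injective (hdual : HasDualSystem fun κ => φ (b κ)) {M : Type*} [AddCommGroup M]
    [Module K M] [Module R M] [IsScalarTower K R M] {s : ℕ} (m : Basis (Fin s) K M) :
    Function.Injective (familyMap φ b m) := by
  refine (injective_iff_map_eq_zero _).2 fun x hx => ?_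
  -- Vanishing for the basis elements `b κ` extends to all c, which makes room for the right factors
  -- of the dual system.
  have h1 : ∀ p q (c : R), ∑ t, φ (x t) p q • c • m t = 0 := by
    intro p q c
    let f : R →ₗ[K] M := ∑ t, (Algebra.lsmul K K M (φ (x t) p q)) ∘ₗ
      (LinearMap.toSpanSingleton R M (m t)).restrictScalars K
    have hf : f = 0 := b.ext fun κ => by
      have : familyMap φ b m x κ q p = 0 := by rw [hx]; rfl
      rw [familyMap_apply] at this
      simpa [f, LinearMap.toSpanSingleton_apply] using this
    simpa [f, LinearMap.toSpanSingleton_apply] using LinearMap.congr_fun hf c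
  have h2 : ∀ μ t, b.repr (x t) μ = 0 := by
    intro μ
    obtain ⟨N, u, c, p, q, h⟩ := hdual μ
    have h3 : ∀ y : R, ∑ s, u s * φ y (p s) (q s) * c s = b.repr y μ • 1 := by
      intro y
      let f : R →ₗ[K] R := ∑ s, LinearMap.mulLeft K (u s) ∘ₗ LinearMap.mulRight K (c s) ∘ₗ
        (Matrix.entryLinearMap K R (p s) (q s)) ∘ₗ φ.toLinearMap
      have hf : f = (LinearMap.toSpanSingleton K R 1) ∘ₗ b.coord μ := b.ext fun κ => by
        have := h κ
        simp only [f, LinearMap.sum_apply, LinearMap.comp_apply, LinearMap.mulLeft_apply,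
          LinearMap.mulRight_apply, Matrix.entryLinearMap_apply, AlgHom.toLinearMap_apply,
          ← mul_assoc]
        rw [this]
        simp [Finsupp.single_apply, ite_smul]
      have := LinearMap.congr_fun hf y
      simpa [f, mul_assoc] using this
    have h4 : ∑ t, b.repr (x t) μ • m t = 0 := by
      calc _ = ∑ t, ∑ s, u s • φ (x t) (p s) (q s) • c s • m t := by
            refine Finset.sum_congr rfl fun t _ => ?_
            simp_rw [← mul_smul, ← mul_assoc]
            rw [← Finset.sum_smul, h3, smul_assoc, one_smul]
        _ = 0 := by
            rw [Finset.sum_comm]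
            refine Finset.sum_eq_zero fun s _ => ?_
            rw [← Finset.smul_sum, h1, smul_zero]
    exact Fintype.linearIndependent_iff.1 m.linearIndependent _ h4
  ext t
  exact b.repr.map_eq_zero_iff.1 (Finsupp.ext fun μ => h2 μ t)

theorem Twist.map_injective {M N : Type*} [AddCommGroup M] [Module K M] [Module R M]
    [IsScalarTower K R M] [AddCommGroup N] [Module K N] [Module R N] [IsScalarTower K R N]
    (f : M →ₗ[R] N) (hf : Function.Injective f) : Function.Injective (Twist.map φ f) :=
  fun _ _ h => funext fun p => hf (congrFun h p)

theorem Twist.map_surjective {M N : Type*} [AddCommGroup M] [Module K M] [Module R M]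
    [IsScalarTower K R M] [AddCommGroup N] [Module K N] [Module R N] [IsScalarTower K R N]
    (f : M →ₗ[R] N) (hf : Function.Surjective f) : Function.Surjective (Twist.map φ f) :=
  fun y => by
    choose x hx using fun p => hf (y p)
    exact ⟨x, funext hx⟩

theorem actionRank_twist_pi (τ : R) {M : Type*} [AddCommGroup M] [Module K M] [Module R M]
    [IsScalarTower K R M] [FiniteDimensional K M] (s : ℕ) :
    actionRank K τ (Twist φ (Fin s → M)) = s * actionRank K τ (Twist φ M) := by
  rw [actionRank_congr τ (Twist.piEquiv φ (Fin s)), actionRank_pi]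

/-- With s = dim M, apply F to the embedding of R^s into F(M)^{dr} and to its cokernel. Because F ∘
F ≅ F^d, the middle term becomes r d² copies of F(M). The cokernel has dimension (r d² - r) dim M,
and `hc` bounds its rank below; superadditivity of the rank concludes. -/
theorem mul_actionRank_ge_of_forall [FiniteDimensional K R]
    (hdual : HasDualSystem fun κ => φ (b κ))
    (θ θ' : Matrix (Fin d × Fin d) (Fin d × Fin d) R) (h1 : θ * θ' = 1) (h2 : θ' * θ = 1)
    (hθ : ∀ x, Twist.iterMatrix (φ : R →+* _) x * θ = θ * Twist.diagMatrix (φ : R →+* _) x)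
    (τ : R) (c : ℝ) {M : Type*} [AddCommGroup M] [Module K M] [Module R M] [IsScalarTower K R M]
    [FiniteDimensional K M]
    (hc : ∀ (N : Submodule R (Fin r → Fin d → Twist φ M)),
      c * finrank K ((Fin r → Fin d → Twist φ M) ⧸ N) ≤
        actionRank K τ (Twist φ ((Fin r → Fin d → Twist φ M) ⧸ N))) :
    finrank K M * (actionRank K τ (Twist φ R) : ℝ) + c * (r * (d * d) - r) * finrank K M ≤
      r * (d * d) * actionRank K τ (Twist φ M) := by
  let m := Module.finBasis K M
  let Ψ := familyMap φ b m
  have hΨ : Function.Injective Ψ := familyMap_injective φ b hdual m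
  have e1 := actionRank_add_le (K := K) τ (Twist.map φ Ψ) (Twist.map φ (LinearMap.range Ψ).mkQ)
    (Twist.map_injective φ _ hΨ) (Twist.map_surjective φ _ (Submodule.mkQ_surjective _))
    (fun x => funext fun p => (Submodule.Quotient.mk_eq_zero _).2 ⟨x p, rfl⟩)
  rw [actionRank_twist_pi φ τ (M := R), actionRank_twist_pi φ τ (M := Fin d → Twist φ M),
    actionRank_twist_pi φ τ (M := Twist φ M),
    actionRank_congr τ (Twist.twistEquiv (M := M) φ θ θ' h1 h2 hθ), actionRank_pi] at e1
  have e2 := hc (LinearMap.range Ψ)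
  have e3 : finrank K ((Fin r → Fin d → Twist φ M) ⧸ LinearMap.range Ψ) + r * finrank K M =
      r * (d * d) * finrank K M := by
    have e4 := ((LinearMap.range Ψ).restrictScalars K).finrank_quotient_add_finrank
    have e5 : finrank K ((LinearMap.range Ψ).restrictScalars K) = r * finrank K M := by
      have := ((LinearEquiv.ofInjective Ψ hΨ).restrictScalars K).finrank_eq
      rw [finrank_pi_fintype, Finset.sum_const, Finset.card_univ, Fintype.card_fin,
        smul_eq_mul, finrank_eq_card_basis b, Fintype.card_fin, mul_comm] at this
      exact this.symm
    rw [e5, finrank_pi_fintype, Finset.sum_const, Finset.card_univ, Fintype.card_fin,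
      finrank_pi_fintype, Finset.sum_const, Finset.card_univ, Fintype.card_fin, Twist.finrank_eq,
      smul_eq_mul, smul_eq_mul] at e4
    rw [mul_assoc, mul_assoc]
    exact e4
  have e1' : (finrank K M * actionRank K τ (Twist φ R) : ℝ) + actionRank K τ
      (Twist φ ((Fin r → Fin d → Twist φ M) ⧸ LinearMap.range Ψ)) ≤
      r * (d * (d * actionRank K τ (Twist φ M))) := by exact_mod_cast e1
  have e3' : (finrank K ((Fin r → Fin d → Twist φ M) ⧸ LinearMap.range Ψ) : ℝ) +
      r * finrank K M = r * (d * d) * finrank K M := by exact_mod_cast e3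
  have e6 : (finrank K ((Fin r → Fin d → Twist φ M) ⧸ LinearMap.range Ψ) : ℝ) =
      (r * (d * d) - r) * finrank K M := by linarith
  rw [e6] at e2
  linarith

/-- The rank of `τ` on `F(M)` is at least `dim M / dim R` times its rank on `F(R)`. -/
theorem finrank_mul_actionRank_le.{w} [FiniteDimensional K R]
    (hdual : HasDualSystem fun κ => φ (b κ))
    (θ θ' : Matrix (Fin d × Fin d) (Fin d × Fin d) R) (h1 : θ * θ' = 1) (h2 : θ' * θ = 1)
    (hθ : ∀ x, Twist.iterMatrix (φ : R →+* _) x * θ = θ * Twist.diagMatrix (φ : R →+* _) x)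
    (τ : R) (M : Type w) [AddCommGroup M] [Module K M] [Module R M] [IsScalarTower K R M]
    [FiniteDimensional K M] :
    finrank K M * actionRank K τ (Twist φ R) ≤ finrank K R * actionRank K τ (Twist φ M) := by
  rcases Nat.eq_zero_or_pos (finrank K M) with hM | hM
  · simp [hM]
  rcases Nat.eq_zero_or_pos d with hd | hd
  · subst hd
    have : actionRank K τ (Twist φ R) = 0 := by
      refine Nat.le_zero.1 (le_trans (Submodule.finrank_le _) ?_)
      rw [Twist.finrank_eq, zero_mul]
    simp [this]
  have hr : finrank K R = r := by rw [finrank_eq_card_basis b, Fintype.card_fin]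
  have hr0 : 0 < r := by
    by_contra h
    have hr0 : finrank K R = 0 := by omega
    have : Subsingleton R := finrank_zero_iff.1 hr0
    have : Subsingleton M := Module.subsingleton R M
    rw [finrank_zero_of_subsingleton] at hM
    exact lt_irrefl _ hM
  -- The supremum of C is the best constant in rank ≥ c · dim, over all modules in the universe of
  -- M. The cokernels used below lie in the same universe, so the bound applies to them.
  let C : Set ℝ := {c | ∀ (M : Type w) [AddCommGroup M] [Module K M] [Module R M]
    [IsScalarTower K R M] [FiniteDimensional K M],
    c * finrank K M ≤ actionRank K τ (Twist φ M)}
  have hC0 : (0 : ℝ) ∈ C := fun M _ _ _ _ _ => by rw [zero_mul]; positivity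
  have hCb : ∀ (M : Type w) [AddCommGroup M] [Module K M] [Module R M]
      [IsScalarTower K R M] [FiniteDimensional K M], 0 < finrank K M → ∀ c ∈ C,
      c ≤ actionRank K τ (Twist φ M) / finrank K M := fun M _ _ _ _ _ hM c hc => by
    rw [le_div_iff₀ (by exact_mod_cast hM)]
    exact hc M
  have hCs : sSup C ∈ C := by
    intro M _ _ _ _ _
    rcases Nat.eq_zero_or_pos (finrank K M) with hM | hM
    · rw [hM, Nat.cast_zero, mul_zero]; positivity
    · rw [← le_div_iff₀ (by exact_mod_cast hM)]
      exact csSup_le ⟨0, hC0⟩ (hCb M hM)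
  have hr' : (0 : ℝ) < r := by exact_mod_cast hr0
  have hd' : (0 : ℝ) < d := by exact_mod_cast hd
  -- One round of the inequality produces another admissible constant. It cannot exceed the
  -- supremum, which gives rank F(R) ≤ r · sSup C.
  have hstep : (actionRank K τ (Twist φ R) + sSup C * (r * (d * d) - r)) / (r * (d * d)) ∈ C := by
    intro M _ _ _ _ _
    have := mul_actionRank_ge_of_forall φ b hdual θ θ' h1 h2 hθ τ (sSup C) (M := M)
      (fun N => hCs _)
    rw [div_mul_eq_mul_div, div_le_iff₀ (by positivity)]
    linarith
  have hle := le_csSup ⟨_, hCb M hM⟩ hstep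
  rw [div_le_iff₀ (by positivity)] at hle
  have hfin := hCs M
  rw [hr]
  have : (finrank K M * actionRank K τ (Twist φ R) : ℝ) ≤ r * actionRank K τ (Twist φ M) := by
    have h3 : (actionRank K τ (Twist φ R) : ℝ) ≤ r * sSup C := by linarith
    calc _ ≤ finrank K M * (r * sSup C) := by gcongr
      _ = r * (sSup C * finrank K M) := by ring
      _ ≤ _ := by gcongr
  exact_mod_cast this

end RankInequality

end Twist

/-! ### Extension of scalars and ranks on one factor -/

section BaseChange

open Module

variable {k A : Type*} [Field k] [Ring A] [Algebra k A] {d : ℕ}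

/-- The action of `A` on `A' ^ d` through `φ` and a ring homomorphism `A → A'`. -/
def vecEnd (K : Type*) {A A' : Type*} [Field K] [Ring A] [Ring A'] [Algebra K A']
    (φ : A →+* Matrix (Fin d) (Fin d) A) (π : A →+* A') : A →+* End K (Fin d → A') where
  toFun x :=
    { toFun := fun y => matVec ((φ x).map π) y
      map_add' := matVec_add _
      map_smul' := fun c y => by
        ext p
        simp [matVec, Finset.smul_sum] }
  map_one' := by
    refine LinearMap.ext fun y => ?_
    change matVec ((φ 1).map π) y = y
    rw [map_one, Matrix.map_one _ (map_zero π) (map_one π), matVec_one]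
  map_mul' x x' := by
    refine LinearMap.ext fun y => ?_
    change matVec ((φ (x * x')).map π) y = matVec ((φ x).map π) (matVec ((φ x').map π) y)
    rw [map_mul, Matrix.map_mul, matVec_mul]
  map_zero' := by
    refine LinearMap.ext fun y => ?_
    change matVec ((φ 0).map π) y = 0
    rw [map_zero, Matrix.map_zero _ (map_zero π), zero_matVec]
  map_add' x x' := by
    refine LinearMap.ext fun y => ?_
    change matVec ((φ (x + x')).map π) y = matVec ((φ x).map π) y + matVec ((φ x').map π) y
    rw [map_add, Matrix.map_add _ (map_add π), add_matVec]

theorem vecEnd_apply (K : Type*) {A A' : Type*} [Field K] [Ring A] [Ring A'] [Algebra K A']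
    (φ : A →+* Matrix (Fin d) (Fin d) A) (π : A →+* A') (x : A) (y : Fin d → A') (p : Fin d) :
    vecEnd K φ π x y p = ∑ q, π (φ x p q) * y q := rfl

variable (K : Type*) [Field K]

theorem commute_ofId {C : Type*} [Ring C] [Algebra K C] {D : Type*} (g : D → C) (x : K) (y : D) :
    Commute (Algebra.ofId K C x) (g y) :=
  Algebra.commutes x _

theorem actionRank_aeval_mul {R : Type*} [Ring R] [Algebra K R] (x e : R) (f : K[X])
    (M : Type*) [AddCommGroup M] [Module K M] [Module R M] [IsScalarTower K R M] :
    actionRank K (aeval x f * e) M = finrank K (LinearMap.range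
      (aeval (Algebra.lsmul K K M x) f * Algebra.lsmul K K M e)) := by
  rw [actionRank, map_mul, Polynomial.aeval_algHom_apply]

theorem finrank_range_aeval_mul_congr {V V' : Type*} [AddCommGroup V] [Module K V]
    [AddCommGroup V'] [Module K V'] (T E : End K V) (T' E' : End K V') (i : V' ≃ₗ[K] V)
    (hT : ∀ x, T (i x) = i (T' x)) (hE : ∀ x, E (i x) = i (E' x)) (f : K[X]) :
    finrank K (LinearMap.range (aeval T f * E)) =
      finrank K (LinearMap.range (aeval T' f * E')) := by
  have h : LinearMap.range (aeval T f * E) =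
      (LinearMap.range (aeval T' f * E')).map (i : V' →ₗ[K] V) := by
    have h1 : ∀ x, (aeval T f * E) (i x) = i ((aeval T' f * E') x) := fun x => by
      rw [End.mul_apply, hE]
      exact aeval_apply_of_intertwining T T' (i : V' →ₗ[K] V) hT f _
    ext x
    constructor
    · rintro ⟨y, rfl⟩
      refine ⟨_, ⟨i.symm y, rfl⟩, ?_⟩
      refine (h1 _).symm.trans ?_
      rw [LinearEquiv.apply_symm_apply]
    · rintro ⟨_, ⟨y, rfl⟩, rfl⟩
      exact ⟨i y, h1 y⟩
  rw [h, LinearEquiv.finrank_map_eq]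

variable [Algebra k K] (φ : A →ₐ[k] Matrix (Fin d) (Fin d) A)

/-- The base change of `φ` to a field extension. -/
noncomputable def baseChangeHom : K ⊗[k] A →ₐ[K] Matrix (Fin d) (Fin d) (K ⊗[k] A) :=
  Algebra.TensorProduct.lift (Algebra.ofId K _)
    ((Algebra.TensorProduct.includeRight (R := k) (A := K) (B := A)).mapMatrix.comp φ)
    (commute_ofId K _)

theorem baseChangeHom_tmul (c : K) (a : A) :
    baseChangeHom K φ (c ⊗ₜ a) = c • (φ a).map fun x => (1 : K) ⊗ₜ[k] x := by
  rw [baseChangeHom, Algebra.TensorProduct.lift_tmul, Algebra.ofId_apply, ← Algebra.smul_def]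
  rfl

theorem baseChangeHom_one_tmul (a : A) :
    baseChangeHom K φ (1 ⊗ₜ a) = (φ a).map fun x => (1 : K) ⊗ₜ[k] x := by
  rw [baseChangeHom_tmul, one_smul]

theorem baseChangeHom_intertwining (θ : Matrix (Fin d × Fin d) (Fin d × Fin d) A)
    (hθ : ∀ x, Twist.iterMatrix (φ : A →+* Matrix (Fin d) (Fin d) A) x * θ =
      θ * Twist.diagMatrix (φ : A →+* Matrix (Fin d) (Fin d) A) x)
    (x : K ⊗[k] A) :
    Twist.iterMatrix (baseChangeHom K φ : K ⊗[k] A →+* Matrix (Fin d) (Fin d) _) x *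
        θ.map (fun x => (1 : K) ⊗ₜ[k] x) =
      θ.map (fun x => (1 : K) ⊗ₜ[k] x) *
        Twist.diagMatrix (baseChangeHom K φ : K ⊗[k] A →+* Matrix (Fin d) (Fin d) _) x := by
  let j : A →ₐ[k] K ⊗[k] A := Algebra.TensorProduct.includeRight
  induction x using TensorProduct.induction_on with
  | zero =>
    have h1 : Twist.iterMatrix (baseChangeHom K φ : K ⊗[k] A →+* Matrix (Fin d) (Fin d) _) 0 = 0 := by
      ext x y; simp [Twist.iterMatrix]
    have h2 : Twist.diagMatrix (baseChangeHom K φ : K ⊗[k] A →+* Matrix (Fin d) (Fin d) _) 0 = 0 := by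
      ext x y; simp [Twist.diagMatrix]
    rw [h1, h2, mul_zero, zero_mul]
  | add x y hx hy =>
    have h1 : Twist.iterMatrix (baseChangeHom K φ : K ⊗[k] A →+* Matrix (Fin d) (Fin d) _) (x + y) =
        Twist.iterMatrix (baseChangeHom K φ : K ⊗[k] A →+* Matrix (Fin d) (Fin d) _) x +
        Twist.iterMatrix (baseChangeHom K φ : K ⊗[k] A →+* Matrix (Fin d) (Fin d) _) y := by
      ext x y; simp [Twist.iterMatrix]
    have h2 : Twist.diagMatrix (baseChangeHom K φ : K ⊗[k] A →+* Matrix (Fin d) (Fin d) _) (x + y) =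
        Twist.diagMatrix (baseChangeHom K φ : K ⊗[k] A →+* Matrix (Fin d) (Fin d) _) x +
        Twist.diagMatrix (baseChangeHom K φ : K ⊗[k] A →+* Matrix (Fin d) (Fin d) _) y := by
      ext x y
      simp only [Twist.diagMatrix, Matrix.of_apply, Matrix.add_apply, map_add]
      split_ifs <;> simp
    rw [h1, h2, mul_add, add_mul, hx, hy]
  | tmul c a =>
    have h1 : Twist.iterMatrix (baseChangeHom K φ : K ⊗[k] A →+* Matrix (Fin d) (Fin d) _) (c ⊗ₜ a) =
        c • (Twist.iterMatrix (φ : A →+* Matrix (Fin d) (Fin d) A) a).map j := by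
      ext x y
      simp [Twist.iterMatrix, baseChangeHom_tmul, j]
    have h2 : Twist.diagMatrix (baseChangeHom K φ : K ⊗[k] A →+* Matrix (Fin d) (Fin d) _) (c ⊗ₜ a) =
        c • (Twist.diagMatrix (φ : A →+* Matrix (Fin d) (Fin d) A) a).map j := by
      ext x y
      simp only [Twist.diagMatrix, Matrix.of_apply, Matrix.smul_apply, Matrix.map_apply]
      split_ifs with h
      · simp [baseChangeHom_tmul, j]
      · rw [map_zero, smul_zero]
    rw [h1, h2, Matrix.smul_mul, Matrix.mul_smul]
    change c • ((Twist.iterMatrix (φ : A →+* Matrix (Fin d) (Fin d) A) a).map j * θ.map j) =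
      c • (θ.map j * (Twist.diagMatrix (φ : A →+* Matrix (Fin d) (Fin d) A) a).map j)
    rw [← Matrix.map_mul, ← Matrix.map_mul, hθ]

/-- A dual system consists of explicit elements and identities, so it survives a base change after
which no structure as a product of central simple algebras is available. -/
theorem HasDualSystem.baseChange {ν : Type*} [DecidableEq ν] {y : ν → A}
    (h : HasDualSystem fun κ => φ (y κ)) :
    HasDualSystem fun κ => baseChangeHom K φ (1 ⊗ₜ y κ) := by
  intro μ
  obtain ⟨N, u, c, p, q, h⟩ := h μ
  let j : A →ₐ[k] K ⊗[k] A := Algebra.TensorProduct.includeRight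
  refine ⟨N, fun s => j (u s), fun s => j (c s), p, q, fun κ => ?_⟩
  have := congrArg j (h κ)
  rw [map_sum, apply_ite j, map_one, map_zero] at this
  rw [← this]
  refine Finset.sum_congr rfl fun s _ => ?_
  rw [map_mul, map_mul]
  exact congrArg (fun Y => j (u s) * Y (p s) (q s) * j (c s)) (baseChangeHom_one_tmul K φ (y κ))

/-- The rank inequality over K ⊗ A compares f(a)e on F(A') with f(a)e on F(K ⊗ A) = K ⊗ F(A). On the
latter, q(a)e = 0 with q irreducible over k gives the lower bound from linear algebra. -/
theorem finrank_mul_le_finrank_range_vecEnd [FiniteDimensional k A]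
    {r : ℕ} (b : Basis (Fin r) k A) (hdual : HasDualSystem fun κ => φ (b κ))
    (θ θ' : Matrix (Fin d × Fin d) (Fin d × Fin d) A) (h1 : θ * θ' = 1) (h2 : θ' * θ = 1)
    (hθ : ∀ x, Twist.iterMatrix (φ : A →+* Matrix (Fin d) (Fin d) A) x * θ =
      θ * Twist.diagMatrix (φ : A →+* Matrix (Fin d) (Fin d) A) x)
    {A' : Type*} [Ring A'] [Algebra K A'] [Algebra k A'] [IsScalarTower k K A']
    [FiniteDimensional K A'] (π : A →ₐ[k] A') (a e : A) (hae : Commute a e) (he : e * e = e)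
    (q : k[X]) (hq : Irreducible q) (hqe : aeval a q * e = 0) (f : K[X]) (hf : f ≠ 0) :
    finrank K A' * (finrank k (LinearMap.range (Algebra.lsmul k k (Twist φ A) e)) *
      (q.natDegree - f.natDegree)) ≤
    finrank k A * (q.natDegree * finrank K (LinearMap.range
      (aeval (vecEnd K (φ : A →+* Matrix (Fin d) (Fin d) A) (π : A →+* A') a) f *
        vecEnd K (φ : A →+* Matrix (Fin d) (Fin d) A) (π : A →+* A') e))) := by
  let j : A →ₐ[k] K ⊗[k] A := Algebra.TensorProduct.includeRight
  let ρ : K ⊗[k] A →ₐ[K] A' := Algebra.TensorProduct.lift (Algebra.ofId K _) π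
    (commute_ofId K _)
  let _ : Module (K ⊗[k] A) A' := Module.compHom A' (ρ : K ⊗[k] A →+* A')
  have hsm : ∀ (x : K ⊗[k] A) (y : A'), x • y = ρ x * y := fun _ _ => rfl
  have : IsScalarTower K (K ⊗[k] A) A' := ⟨fun c x y => by
    rw [hsm, hsm, map_smul, smul_mul_assoc]⟩
  have hρ : ∀ x, ρ (1 ⊗ₜ x) = π x := fun x => by
    simp [ρ]
  have key := finrank_mul_actionRank_le (baseChangeHom K φ) (b.baseChange K) (by
      simp only [Basis.baseChange_apply]
      exact hdual.baseChange K φ) (θ.map j) (θ'.map j)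
    (by rw [← Matrix.map_mul, h1, Matrix.map_one _ (map_zero j) (map_one j)])
    (by rw [← Matrix.map_mul, h2, Matrix.map_one _ (map_zero j) (map_one j)])
    (baseChangeHom_intertwining K φ θ hθ) (aeval (j a) f * j e) A'
  rw [actionRank_aeval_mul, actionRank_aeval_mul, finrank_baseChange] at key
  have e1 : ∀ x, Algebra.lsmul K K (Twist (baseChangeHom K φ) A') (j x) =
      vecEnd K (φ : A →+* Matrix (Fin d) (Fin d) A) (π : A →+* A') x := by
    intro x
    refine LinearMap.ext fun y => funext fun p => ?_
    change ∑ q, baseChangeHom K φ (1 ⊗ₜ x) p q • y q = ∑ q, π (φ x p q) * y q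
    refine Finset.sum_congr rfl fun q _ => ?_
    rw [baseChangeHom_one_tmul, hsm, Matrix.map_apply, hρ]
  have e2 : finrank K (LinearMap.range
      (aeval (Algebra.lsmul K K (Twist (baseChangeHom K φ) A') (j a)) f *
        Algebra.lsmul K K (Twist (baseChangeHom K φ) A') (j e))) = finrank K (LinearMap.range
      (aeval (vecEnd K (φ : A →+* Matrix (Fin d) (Fin d) A) (π : A →+* A') a) f *
        vecEnd K (φ : A →+* Matrix (Fin d) (Fin d) A) (π : A →+* A') e)) :=
    finrank_range_aeval_mul_congr K _ _ _ _ (LinearEquiv.refl K (Fin d → A'))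
      (fun y => LinearMap.congr_fun (e1 a) y) (fun y => LinearMap.congr_fun (e1 e) y) f
  rw [e2] at key
  let S : A → End k (Twist φ A) := fun x => Algebra.lsmul k k (Twist φ A) x
  let i : K ⊗[k] (Twist φ A) ≃ₗ[K] Twist (baseChangeHom K φ) (K ⊗[k] A) :=
    TensorProduct.piRight k K K (fun _ : Fin d => A)
  have hi : ∀ x y, Algebra.lsmul K K (Twist (baseChangeHom K φ) (K ⊗[k] A)) (j x) (i y) =
      i (LinearMap.baseChange K (S x) y) := by
    intro x y
    induction y using TensorProduct.induction_on with
    | zero => simp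
    | add y z hy hz => rw [map_add, map_add, hy, hz, map_add, map_add]
    | tmul c y =>
      rw [LinearMap.baseChange_tmul]
      refine funext fun p => ?_
      change ∑ q, baseChangeHom K φ (1 ⊗ₜ x) p q * (c ⊗ₜ y q) = c ⊗ₜ (∑ q, φ x p q * y q)
      rw [TensorProduct.tmul_sum]
      refine Finset.sum_congr rfl fun q _ => ?_
      rw [baseChangeHom_one_tmul, Matrix.map_apply, Algebra.TensorProduct.tmul_mul_tmul, one_mul]
  have e3 := finrank_range_aeval_mul_congr K _ _ (LinearMap.baseChange K (S a))
    (LinearMap.baseChange K (S e)) i (hi a) (hi e) f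
  rw [e3] at key
  have e4 := finrank_mul_le_finrank_range_aeval_baseChange_mul (K := K) (S a) (S e)
    (hae.map (Algebra.lsmul k k (Twist φ A))) (by
      change Algebra.lsmul k k (Twist φ A) e * Algebra.lsmul k k (Twist φ A) e = _
      rw [← map_mul, he]) q hq (by
      change aeval (Algebra.lsmul k k (Twist φ A) a) q * Algebra.lsmul k k (Twist φ A) e = 0
      rw [Polynomial.aeval_algHom_apply, ← map_mul, hqe, map_zero]) f hf
  calc _ ≤ finrank K A' * (q.natDegree * _) := Nat.mul_le_mul_left _ e4
    _ = q.natDegree * (finrank K A' * _) := by ring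
    _ ≤ q.natDegree * _ := Nat.mul_le_mul_left _ key
    _ = _ := by ring

end BaseChange

/-! ### The connected case: the field of central scalars -/

section Connected

open Module

theorem exists_fin_sum {S R : Type*} [Fintype S] [Ring R] {d : ℕ} (u c : S → R)
    (p q : S → Fin d) : ∃ (N : ℕ) (u' c' : Fin N → R) (p' q' : Fin N → Fin d),
      ∀ Y : Matrix (Fin d) (Fin d) R,
        ∑ s, u' s * Y (p' s) (q' s) * c' s = ∑ s, u s * Y (p s) (q s) * c s := by
  let e := (Fintype.equivFin S).symm
  exact ⟨_, u ∘ e, c ∘ e, p ∘ e, q ∘ e, fun Y =>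
    e.sum_comp (fun s => u s * Y (p s) (q s) * c s)⟩

/-- Extend the dual coordinate to a linear form on all matrices. On each entry it is an L-linear map
A → L ⊂ A, hence of the form x ↦ ∑ u x c. -/
theorem hasDualSystem_of_linearIndependent {L A ν : Type*} [DecidableEq ν] [Field L] [Ring A]
    [Algebra L A] [IsSimpleRing A] [Algebra.IsCentral L A] [FiniteDimensional L A] {d : ℕ}
    (y : ν → Matrix (Fin d) (Fin d) A) (hy : LinearIndependent L y) : HasDualSystem y := by
  intro μ
  obtain ⟨g, hg⟩ := LinearMap.exists_extend
    ((Finsupp.lapply μ : (ν →₀ L) →ₗ[L] L) ∘ₗ (hy.repr : _ →ₗ[L] ν →₀ L))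
  have hgy : ∀ κ, g (y κ) = if κ = μ then 1 else 0 := by
    intro κ
    have h1 := LinearMap.congr_fun hg ⟨y κ, Submodule.subset_span ⟨κ, rfl⟩⟩
    have h2 : hy.repr ⟨y κ, Submodule.subset_span ⟨κ, rfl⟩⟩ = Finsupp.single κ 1 :=
      hy.repr_eq_single κ _ rfl
    refine h1.trans ?_
    change hy.repr ⟨y κ, Submodule.subset_span ⟨κ, rfl⟩⟩ μ = _
    rw [h2, Finsupp.single_apply]
  have hf : ∀ p q : Fin d, ∃ (n : ℕ) (u c : Fin n → A), ∀ x,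
      algebraMap L A (g (Matrix.single p q x)) = ∑ s, u s * x * c s := fun p q =>
    exists_eq_sum_mul_mul ((Algebra.linearMap L A) ∘ₗ g ∘ₗ Matrix.singleLinearMap L p q)
  choose n u c h using hf
  obtain ⟨N, u', c', p', q', h'⟩ := exists_fin_sum
    (S := Σ x : Fin d × Fin d, Fin (n x.1 x.2)) (fun s => u s.1.1 s.1.2 s.2)
    (fun s => c s.1.1 s.1.2 s.2) (fun s => s.1.1) (fun s => s.1.2)
  refine ⟨N, u', c', p', q', fun κ => ?_⟩
  rw [h', Fintype.sum_sigma, Fintype.sum_prod_type]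
  simp only [← h]
  rw [← (algebraMap L A).map_one, ← (algebraMap L A).map_zero, ← apply_ite, ← hgy κ]
  conv_rhs => rw [Matrix.matrix_eq_sum_single (y κ)]
  simp only [map_sum]

variable {ι : Type*} {L : ι → Type*} [∀ i, Field (L i)]
  {A : ι → Type*} [∀ i, Ring (A i)] [∀ i, Algebra (L i) (A i)] {d : ℕ}

/-- The `i`-th component of a matrix representation over `∏ i, A i`. -/
def compHom (φ : (∀ i, A i) →+* Matrix (Fin d) (Fin d) (∀ i, A i)) (i : ι) :
    (∀ i, A i) →+* Matrix (Fin d) (Fin d) (A i) :=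
  (Pi.evalRingHom A i).mapMatrix.comp φ

theorem compHom_apply (φ : (∀ i, A i) →+* Matrix (Fin d) (Fin d) (∀ i, A i)) (i : ι)
    (x : ∀ i, A i) (p q : Fin d) : compHom φ i x p q = φ x p q i := rfl

theorem centerEmb_apply (z : ∀ i, L i) (i : ι) :
    centerEmb L A z i = algebraMap (L i) (A i) (z i) := rfl

theorem centerEmb_commute (z : ∀ i, L i) (x : ∀ i, A i) : Commute (centerEmb L A z) x :=
  funext fun i => Algebra.commutes (z i) (x i)

theorem scalar_centerEmb_mul {n : Type*} [Fintype n] [DecidableEq n] (z : ∀ i, L i)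
    (M : Matrix n n (∀ i, A i)) :
    Matrix.scalar n (centerEmb L A z) * M = M * Matrix.scalar n (centerEmb L A z) :=
  Matrix.scalar_comm _ (fun x => centerEmb_commute z x) M

variable (φ : (∀ i, A i) →+* Matrix (Fin d) (Fin d) (∀ i, A i))

/-- A relation ∑ z_κ φ_j(b_κ) = 0 with z_κ in L_j survives conjugation by θ, since the z_κ are
central, and becomes ∑ z_κ φ_j(φ(b_κ)_pq) = 0. Inserting a dual system for the family φ_i(b_κ) under
φ_j leaves z_μ φ_j(e_i) = 0. -/
theorem linearIndependent_compHom_of_linearIndependent [DecidableEq ι] [∀ i, IsSimpleRing (A i)]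
    [∀ i, Algebra.IsCentral (L i) (A i)] [∀ i, FiniteDimensional (L i) (A i)]
    (θ θ' : Matrix (Fin d × Fin d) (Fin d × Fin d) (∀ i, A i)) (h1 : θ * θ' = 1)
    (hθ : ∀ x, Twist.iterMatrix φ x * θ = θ * Twist.diagMatrix φ x)
    {ν : Type*} [Fintype ν] [DecidableEq ν] (b : ν → ∀ i, A i) (i j : ι)
    (hij : compHom φ j (Pi.single i 1) ≠ 0)
    (hb : LinearIndependent (L i) fun κ => compHom φ i (b κ)) :
    LinearIndependent (L j) fun κ => compHom φ j (b κ) := by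
  rw [Fintype.linearIndependent_iff]
  intro z hz μ
  obtain ⟨N, u, c, p, q, h⟩ := hasDualSystem_of_linearIndependent _ hb μ
  let w : ν → ∀ i, L i := fun κ => Pi.single j (z κ)
  have hiter : ∀ x, Twist.iterMatrix φ x = θ * Twist.diagMatrix φ x * θ' := fun x => by
    rw [← hθ, mul_assoc, h1, mul_one]
  have e1 : ∑ κ, Matrix.scalar _ (centerEmb L A (w κ)) * Twist.diagMatrix φ (b κ) = 0 := by
    ext x y j'
    rw [Matrix.sum_apply, Finset.sum_apply]
    have e2 := congrFun (congrFun hz x.2) y.2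
    rw [Matrix.sum_apply] at e2
    by_cases hj : j' = j
    · subst hj
      by_cases hxy : x.1 = y.1
      · refine Eq.trans (Finset.sum_congr rfl fun κ _ => ?_) e2
        simp [Twist.diagMatrix, hxy, centerEmb_apply, w, compHom_apply, Algebra.smul_def]
      · simp [Twist.diagMatrix, hxy]
    · simp [centerEmb_apply, w, hj]
  have e3 : ∑ κ, Matrix.scalar _ (centerEmb L A (w κ)) * Twist.iterMatrix φ (b κ) = 0 := by
    calc _ = θ * (∑ κ, Matrix.scalar _ (centerEmb L A (w κ)) * Twist.diagMatrix φ (b κ)) * θ' := by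
          rw [Finset.mul_sum, Finset.sum_mul]
          refine Finset.sum_congr rfl fun κ _ => ?_
          rw [hiter, ← mul_assoc, ← mul_assoc, scalar_centerEmb_mul, mul_assoc θ]
      _ = 0 := by rw [e1, mul_zero, zero_mul]
  have e4 : ∀ p q, ∑ κ, z κ • compHom φ j (φ (b κ) p q) = 0 := by
    intro p q
    ext k l
    have := congrFun (congrFun (congrFun e3 (p, k)) (q, l)) j
    rw [Matrix.sum_apply, Finset.sum_apply] at this
    rw [Matrix.sum_apply]
    refine Eq.trans (Finset.sum_congr rfl fun κ _ => ?_) this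
    simp [Twist.iterMatrix, centerEmb_apply, w, compHom_apply, Algebra.smul_def]
  have e5 : ∀ κ, ∑ s, (Pi.single i (u s) : ∀ i, A i) * φ (b κ) (p s) (q s) * Pi.single i (c s) =
      Pi.single i (if κ = μ then 1 else 0) := by
    intro κ
    rw [← h κ]
    ext i'
    rw [Finset.sum_apply]
    by_cases hi : i' = i
    · subst hi
      simp [compHom_apply]
    · simp [hi]
  have e6 : ∑ κ, z κ • compHom φ j (Pi.single i (if κ = μ then 1 else 0)) = 0 := by
    simp_rw [← e5, map_sum, map_mul, Finset.smul_sum]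
    rw [Finset.sum_comm]
    refine Finset.sum_eq_zero fun s _ => ?_
    calc _ = compHom φ j (Pi.single i (u s)) * (∑ κ, z κ • compHom φ j (φ (b κ) (p s) (q s))) *
          compHom φ j (Pi.single i (c s)) := by
          rw [Finset.mul_sum, Finset.sum_mul]
          refine Finset.sum_congr rfl fun κ _ => ?_
          rw [mul_smul_comm, smul_mul_assoc]
      _ = 0 := by rw [e4, mul_zero, zero_mul]
  rw [Finset.sum_eq_single μ] at e6
  · rw [if_pos rfl] at e6
    exact (smul_eq_zero.1 e6).resolve_right hij
  · intro κ _ hκ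
    rw [if_neg hκ, Pi.single_zero, map_zero, smul_zero]
  · simp

theorem finrank_span_compHom_le [DecidableEq ι] [∀ i, IsSimpleRing (A i)]
    [∀ i, Algebra.IsCentral (L i) (A i)] [∀ i, FiniteDimensional (L i) (A i)]
    (θ θ' : Matrix (Fin d × Fin d) (Fin d × Fin d) (∀ i, A i)) (h1 : θ * θ' = 1)
    (hθ : ∀ x, Twist.iterMatrix φ x * θ = θ * Twist.diagMatrix φ x) (i j : ι)
    (hij : compHom φ j (Pi.single i 1) ≠ 0) :
    finrank (L i) (Submodule.span (L i) (Set.range (compHom φ i))) ≤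
      finrank (L j) (Submodule.span (L j) (Set.range (compHom φ j))) := by
  obtain ⟨y, hy, -, hli⟩ :=
    Submodule.exists_fun_fin_finrank_span_eq (L i) (Set.range (compHom φ i))
  choose b hb using hy
  obtain rfl : (fun κ => compHom φ i (b κ)) = y := funext hb
  have h2 := linearIndependent_compHom_of_linearIndependent φ θ θ' h1 hθ b i j hij hli
  have h3 := finrank_span_eq_card h2
  rw [Fintype.card_fin] at h3
  rw [← h3]
  refine Submodule.finrank_mono (Submodule.span_mono ?_)
  rintro _ ⟨κ, rfl⟩
  exact ⟨b κ, rfl⟩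

/-- The central elements on which `φ` is scalar. -/
def centralScalars : Subring (∀ i, L i) :=
  RingHom.eqLocus (φ.comp (centerEmb L A)) ((Matrix.scalar (Fin d)).comp (centerEmb L A))

theorem mem_centralScalars {z : ∀ i, L i} :
    z ∈ centralScalars φ ↔ φ (centerEmb L A z) = Matrix.scalar (Fin d) (centerEmb L A z) :=
  Iff.rfl

theorem mul_eq_of_intertwining {n R : Type*} [Fintype n] [DecidableEq n] [Ring R]
    {S D θ θ' : Matrix n n R} (h1 : θ * θ' = 1) (h : S * θ = θ * D) : S = θ * D * θ' := by
  rw [← h, mul_assoc, h1, mul_one]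

/-- Linking in all directions makes the L_i-spans of the φ_i(A) equidimensional, so one family b
gives a basis of each, and φ(x) = ∑ z_κ φ(b_κ) with unique z_κ in L. Conjugation by θ gives the same
expansion with φ(b_κ)_pq under φ, whereas applying φ to the entries replaces z_κ by φ(z_κ). The dual
system separates the terms and yields φ(z_κ) = z_κ. -/
theorem exists_centralScalars_basis [Fintype ι] [DecidableEq ι] [Nonempty ι]
    [∀ i, IsSimpleRing (A i)]
    [∀ i, Algebra.IsCentral (L i) (A i)] [∀ i, FiniteDimensional (L i) (A i)]
    (hφ : Function.Injective φ)
    (θ θ' : Matrix (Fin d × Fin d) (Fin d × Fin d) (∀ i, A i)) (h1 : θ * θ' = 1)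
    (hθ : ∀ x, Twist.iterMatrix φ x * θ = θ * Twist.diagMatrix φ x)
    (hconn : ∀ i j, compHom φ i (Pi.single j 1) ≠ 0) :
    ∃ (r : ℕ) (b : Fin r → ∀ i, A i),
      (∀ i, LinearIndependent (L i) fun κ => compHom φ i (b κ)) ∧
      HasDualSystem (fun κ => φ (b κ)) ∧
      ∀ x, ∃ g : Fin r → ∀ i, L i, (∀ κ, g κ ∈ centralScalars φ) ∧
        x = ∑ κ, centerEmb L A (g κ) * b κ := by
  obtain ⟨i₀⟩ := ‹Nonempty ι›
  obtain ⟨y, hy, -, hli⟩ :=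
    Submodule.exists_fun_fin_finrank_span_eq (L i₀) (Set.range (compHom φ i₀))
  choose b hb using hy
  obtain rfl : (fun κ => compHom φ i₀ (b κ)) = y := funext hb
  have hind : ∀ i, LinearIndependent (L i) fun κ => compHom φ i (b κ) := fun i =>
    linearIndependent_compHom_of_linearIndependent φ θ θ' h1 hθ b i₀ i (hconn i i₀) hli
  have hspan : ∀ i, Submodule.span (L i) (Set.range fun κ => compHom φ i (b κ)) =
      Submodule.span (L i) (Set.range (compHom φ i)) := by
    intro i
    refine Submodule.eq_of_le_of_finrank_le (Submodule.span_mono ?_) ?_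
    · rintro _ ⟨κ, rfl⟩
      exact ⟨b κ, rfl⟩
    · rw [finrank_span_eq_card (hind i), Fintype.card_fin]
      exact finrank_span_compHom_le φ θ θ' h1 hθ i i₀ (hconn i₀ i)
  have hdual : HasDualSystem fun κ => φ (b κ) := by
    intro μ
    choose N u c p q h using fun i => hasDualSystem_of_linearIndependent _ (hind i) μ
    obtain ⟨N', u', c', p', q', h'⟩ := exists_fin_sum (S := Σ i, Fin (N i))
      (fun s => (Pi.single s.1 (u s.1 s.2) : ∀ i, A i))
      (fun s => (Pi.single s.1 (c s.1 s.2) : ∀ i, A i))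
      (fun s => p s.1 s.2) (fun s => q s.1 s.2)
    refine ⟨N', u', c', p', q', fun κ => ?_⟩
    rw [h', Fintype.sum_sigma]
    ext i
    rw [Finset.sum_apply, Finset.sum_eq_single i]
    · rw [Finset.sum_apply]
      have h3 := h i κ
      simp only [compHom_apply] at h3
      simp only [Pi.mul_apply, Pi.single_eq_same, h3]
      split_ifs <;> rfl
    · intro i' _ hi'
      rw [Finset.sum_apply]
      refine Finset.sum_eq_zero fun s _ => ?_
      simp [hi'.symm]
    · simp
  refine ⟨_, b, hind, hdual, fun x => ?_⟩
  have hex : ∀ i, ∃ g : Fin _ → L i, ∑ κ, g κ • compHom φ i (b κ) = compHom φ i x := fun i =>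
    Submodule.mem_span_range_iff_exists_fun (L i) |>.1
      (hspan i ▸ Submodule.subset_span ⟨x, rfl⟩)
  choose g hg using hex
  let z : Fin _ → ∀ i, L i := fun κ i => g i κ
  have hx : ∀ p q, φ x p q = ∑ κ, centerEmb L A (z κ) * φ (b κ) p q := by
    intro p q
    ext i
    have := congrFun (congrFun (hg i) p) q
    rw [Matrix.sum_apply] at this
    rw [Finset.sum_apply]
    refine this.symm.trans (Finset.sum_congr rfl fun κ _ => ?_)
    simp [compHom_apply, centerEmb_apply, z, Algebra.smul_def]
  have hD : Twist.diagMatrix φ x =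
      ∑ κ, Matrix.scalar _ (centerEmb L A (z κ)) * Twist.diagMatrix φ (b κ) := by
    ext1 s t
    rw [Matrix.sum_apply]
    by_cases hst : s.1 = t.1 <;> simp [Twist.diagMatrix, hst, hx]
  have hI : Twist.iterMatrix φ x =
      ∑ κ, Matrix.scalar _ (centerEmb L A (z κ)) * Twist.iterMatrix φ (b κ) := by
    rw [mul_eq_of_intertwining h1 (hθ x), hD, Finset.mul_sum, Finset.sum_mul]
    refine Finset.sum_congr rfl fun κ _ => ?_
    rw [mul_eq_of_intertwining h1 (hθ (b κ)), scalar_centerEmb_mul (z κ) (Twist.diagMatrix φ (b κ)),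
      scalar_centerEmb_mul]
    simp only [mul_assoc]
    rw [scalar_centerEmb_mul (z κ) θ']
  -- Z κ is the defect of z κ from being a central scalar. It commutes with φ(A), so the left
  -- factors of a dual system can be moved across it.
  let Z : Fin _ → Matrix (Fin d) (Fin d) (∀ i, A i) := fun κ =>
    φ (centerEmb L A (z κ)) - Matrix.scalar _ (centerEmb L A (z κ))
  have hZ : ∀ p q, ∑ κ, Z κ * φ (φ (b κ) p q) = 0 := by
    intro p q
    simp only [Z, sub_mul, Finset.sum_sub_distrib, sub_eq_zero]
    have h3 : φ (φ x p q) = ∑ κ, φ (centerEmb L A (z κ)) * φ (φ (b κ) p q) := by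
      rw [hx, map_sum]
      exact Finset.sum_congr rfl fun κ _ => map_mul _ _ _
    rw [← h3]
    ext1 k l
    have h4 := congrFun (congrFun hI (p, k)) (q, l)
    rw [Matrix.sum_apply] at h4
    rw [Matrix.sum_apply]
    refine h4.trans (Finset.sum_congr rfl fun κ _ => ?_)
    simp [Twist.iterMatrix]
  have hcomm : ∀ κ u, φ u * Z κ = Z κ * φ u := by
    intro κ u
    simp only [Z, mul_sub, sub_mul]
    rw [scalar_centerEmb_mul, ← map_mul, ← map_mul, (centerEmb_commute (z κ) u).eq]
  have hz : ∀ μ, Z μ = 0 := by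
    intro μ
    obtain ⟨N, u, c, p, q, h⟩ := hdual μ
    calc Z μ = ∑ κ, Z κ * φ (if κ = μ then 1 else 0) := by
          rw [Finset.sum_eq_single μ]
          · simp
          · intro κ _ hκ
            simp [hκ]
          · simp
      _ = ∑ s, φ (u s) * (∑ κ, Z κ * φ (φ (b κ) (p s) (q s))) * φ (c s) := by
          simp_rw [← h, map_sum, map_mul, Finset.mul_sum, Finset.sum_mul]
          rw [Finset.sum_comm]
          refine Finset.sum_congr rfl fun s _ => Finset.sum_congr rfl fun κ _ => ?_
          rw [← mul_assoc (φ (u s)), hcomm]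
          simp only [mul_assoc]
      _ = 0 := Finset.sum_eq_zero fun s _ => by rw [hZ, mul_zero, zero_mul]
  have hzmem : ∀ κ, z κ ∈ centralScalars φ := fun κ => sub_eq_zero.1 (hz κ)
  refine ⟨z, hzmem, hφ ?_⟩
  ext1 p q
  rw [hx, map_sum, Matrix.sum_apply]
  refine Finset.sum_congr rfl fun κ _ => ?_
  rw [map_mul, (mem_centralScalars φ).1 (hzmem κ)]
  simp

/-- If z_j ≠ 0 and z_i = 0, then e_j is a multiple of z while φ_i(z) = 0, so φ_i(e_j) = 0, contrary
to connectedness. Hence a nonzero central scalar is invertible in every coordinate, and φ is scalar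
on its inverse too. -/
theorem isField_centralScalars [DecidableEq ι] [Nonempty ι] [∀ i, Nontrivial (A i)]
    (hconn : ∀ i j, compHom φ i (Pi.single j 1) ≠ 0) :
    IsField (centralScalars (L := L) φ) where
  exists_pair_ne := ⟨0, 1, fun h => by
    obtain ⟨i⟩ := ‹Nonempty ι›
    exact zero_ne_one (congrFun (congrArg Subtype.val h) i)⟩
  mul_comm := mul_comm
  mul_inv_cancel := by
    rintro ⟨z, hz⟩ hz0
    have hz' := (mem_centralScalars φ).1 hz
    obtain ⟨j, hj⟩ : ∃ j, z j ≠ 0 := by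
      by_contra! h
      exact hz0 (Subtype.ext (funext h))
    have hne : ∀ i, z i ≠ 0 := by
      intro i hi
      refine hconn i j ?_
      have h1 : (Pi.single j 1 : ∀ i, A i) =
          centerEmb L A z * centerEmb L A (Pi.single j (z j)⁻¹) := by
        rw [← map_mul]
        ext i'
        by_cases h : i' = j
        · subst h
          simp [centerEmb_apply, hj]
        · simp [centerEmb_apply, h]
      rw [h1, map_mul]
      have h2 : compHom φ i (centerEmb L A z) = 0 := by
        ext p q
        rw [compHom_apply, hz']
        by_cases hpq : p = q
        · simp [hpq, centerEmb_apply, hi]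
        · simp [hpq]
      rw [h2, zero_mul]
    have hinv : z * (fun i => (z i)⁻¹) = 1 := funext fun i => mul_inv_cancel₀ (hne i)
    refine ⟨⟨fun i => (z i)⁻¹, ?_⟩, Subtype.ext hinv⟩
    rw [mem_centralScalars]
    set z' : ∀ i, L i := fun i => (z i)⁻¹
    have h3 : centerEmb L A z * centerEmb L A z' = 1 := by rw [← map_mul, hinv, map_one]
    have h4 : centerEmb L A z' * centerEmb L A z = 1 := by
      rw [← map_mul, mul_comm, hinv, map_one]
    calc φ (centerEmb L A z') = Matrix.scalar _ (centerEmb L A z') *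
          (Matrix.scalar _ (centerEmb L A z) * φ (centerEmb L A z')) := by
          rw [← mul_assoc, ← map_mul, h4, map_one, one_mul]
      _ = _ := by rw [← hz', ← map_mul, h3, map_one, mul_one]

end Connected

/-! ### The connected case: characteristic polynomials as products of minimal polynomials -/

section ConnectedCharpoly

open Module

theorem finrank_twist_eq_sum {k : Type*} [Field k] {R ι : Type*} [Ring R] [Algebra k R]
    [FiniteDimensional k R] [Fintype ι] [DecidableEq ι] {d : ℕ}
    (φ : R →ₐ[k] Matrix (Fin d) (Fin d) R) (e : ι → R) (ho : ∀ i j, i ≠ j → e i * e j = 0)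
    (hs : ∑ i, e i = 1) :
    d * finrank k R =
      ∑ i, finrank k (LinearMap.range (Algebra.lsmul k k (Twist φ R) (e i))) := by
  rw [← Twist.finrank_eq φ]
  refine (charpoly_eq_prod_of_idempotents (1 : End k (Twist φ R))
    (fun i => Algebra.lsmul k k (Twist φ R) (e i)) (fun i => Commute.one_left _) ?_ ?_).2
  · intro i j hij
    rw [← map_mul, ho i j hij, map_zero]
  · rw [← map_sum, hs, map_one]

variable {ι : Type*} [DecidableEq ι] {L : ι → Type*} [∀ i, Field (L i)]
  {A : ι → Type*} [∀ i, Ring (A i)] [∀ i, Algebra (L i) (A i)] {d : ℕ}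

theorem aeval_centerEmb_mul_single {k : Type*} [Field k] [∀ i, Algebra k (L i)]
    [∀ i, Algebra k (A i)] [∀ i, IsScalarTower k (L i) (A i)] (a : ∀ i, L i) (j : ι) (q : k[X])
    (hq : aeval (a j) q = 0) :
    aeval (centerEmb L A a) q * (Pi.single j 1 : ∀ i, A i) = 0 := by
  ext i
  by_cases hij : i = j
  · subst hij
    have h1 : aeval (centerEmb L A a) q i = aeval (algebraMap (L i) (A i) (a i)) q :=
      (Polynomial.aeval_algHom_apply (Pi.evalAlgHom k A i) (centerEmb L A a) q).symm
    rw [Pi.mul_apply, h1, Polynomial.aeval_algebraMap_apply, hq, map_zero, zero_mul]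
    rfl
  · simp [hij]

theorem single_mul_single_of_ne (i j : ι) (h : i ≠ j) :
    (Pi.single i 1 : ∀ i, A i) * Pi.single j 1 = 0 := by
  ext l
  by_cases hl : l = i
  · subst hl
    simp [h]
  · simp [hl]

theorem sum_single_one [Fintype ι] : ∑ i, (Pi.single i 1 : ∀ i, A i) = 1 :=
  Finset.univ_sum_single (1 : ∀ i, A i)

theorem aeval_vecEnd_map {k : Type*} [Field k] (K : Type*) [Field K] [Algebra k K]
    {R A' : Type*} [Ring R] [Algebra k R]
    [Ring A'] [Algebra k A'] [Algebra K A'] [IsScalarTower k K A']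
    (φ : R →ₐ[k] Matrix (Fin d) (Fin d) R) (π : R →ₐ[k] A') (x : R) (g : k[X]) :
    aeval (vecEnd K (φ : R →+* Matrix (Fin d) (Fin d) R) (π : R →+* A') x)
      (g.map (algebraMap k K)) =
    vecEnd K (φ : R →+* Matrix (Fin d) (Fin d) R) (π : R →+* A') (aeval x g) := by
  let T : R →ₐ[k] End K (Fin d → A') :=
    { vecEnd K (φ : R →+* Matrix (Fin d) (Fin d) R) (π : R →+* A') with
      commutes' := fun c => by
        refine LinearMap.ext fun y => funext fun p => ?_
        change ∑ q, π (φ (algebraMap k R c) p q) * y q = c • y p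
        rw [AlgHom.commutes, Finset.sum_eq_single p]
        · rw [Matrix.algebraMap_matrix_apply, if_pos rfl, AlgHom.commutes, Algebra.smul_def]
        · intro q _ hq
          rw [Matrix.algebraMap_matrix_apply, if_neg hq.symm, map_zero, zero_mul]
        · simp }
  rw [aeval_map_algebraMap]
  exact Polynomial.aeval_algHom_apply T x g

/-- The idempotents e_j split F(A_i), and on each piece a satisfies the irreducible minimal
polynomial of a_j over k. The rank bounds make its characteristic polynomial a power of that
polynomial. The second clause shows that, for fixed j, the exponent depends on i only through a
factor dim A_i. -/
theorem charpoly_vecEnd_component [Fintype ι]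
    [∀ i, FiniteDimensional (L i) (A i)] {k : Type*} [Field k] [∀ i, Algebra k (L i)]
    [∀ i, Algebra k (A i)] [∀ i, IsScalarTower k (L i) (A i)] [∀ i, Nontrivial (A i)]
    [FiniteDimensional k (∀ i, A i)]
    (φ : (∀ i, A i) →ₐ[k] Matrix (Fin d) (Fin d) (∀ i, A i))
    {r : ℕ} (b : Basis (Fin r) k (∀ i, A i)) (hdual : HasDualSystem fun κ => φ (b κ))
    (θ θ' : Matrix (Fin d × Fin d) (Fin d × Fin d) (∀ i, A i)) (h1 : θ * θ' = 1) (h2 : θ' * θ = 1)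
    (hθ : ∀ x, Twist.iterMatrix (φ : (∀ i, A i) →+* Matrix (Fin d) (Fin d) (∀ i, A i)) x * θ =
      θ * Twist.diagMatrix (φ : (∀ i, A i) →+* Matrix (Fin d) (Fin d) (∀ i, A i)) x)
    (a : ∀ i, L i) (i : ι) :
    ∃ w : ι → ℕ,
      (vecEnd (L i) (φ : (∀ i, A i) →+* Matrix (Fin d) (Fin d) (∀ i, A i))
        (Pi.evalRingHom A i) (centerEmb L A a)).charpoly =
          (∏ j, minpoly k (a j) ^ w j).map (algebraMap k (L i)) ∧
      ∀ j, finrank (L i) (A i) *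
        finrank k (LinearMap.range
          (Algebra.lsmul k k (Twist φ (∀ i, A i)) (Pi.single j 1 : ∀ i, A i))) =
          finrank k (∀ i, A i) * (w j * (minpoly k (a j)).natDegree) := by
  let ψ := (φ : (∀ i, A i) →+* Matrix (Fin d) (Fin d) (∀ i, A i))
  let T := vecEnd (L i) ψ (Pi.evalRingHom A i)
  let e : ι → ∀ i, A i := fun j => Pi.single j 1
  let D : ι → ℕ := fun j =>
    finrank k (LinearMap.range (Algebra.lsmul k k (Twist φ (∀ i, A i)) (e j)))
  have hcomm : ∀ j, Commute (centerEmb L A a) (e j) := fun j => centerEmb_commute a (e j)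
  have hTc : ∀ j, Commute (T (centerEmb L A a)) (T (e j)) := fun j => (hcomm j).map T
  have hee : ∀ j, e j * e j = e j := fun j => by
    rw [← Pi.single_mul, one_mul]
  have hint : ∀ j, IsIntegral k (a j) := by
    intro j
    have hfin : Module.Finite k (A j) := Module.Finite.of_surjective
      (Pi.evalAlgHom k A j).toLinearMap (Function.surjective_eval j)
    have := Algebra.IsIntegral.isIntegral (R := k) (algebraMap (L j) (A j) (a j))
    exact (isIntegral_algebraMap_iff (algebraMap (L j) (A j)).injective).1 this
  have hsplit := charpoly_eq_prod_of_idempotents (T (centerEmb L A a)) (fun j => T (e j)) hTc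
    (fun j j' h => by rw [← map_mul, single_mul_single_of_ne j j' h, map_zero])
    (by rw [← map_sum, sum_single_one, map_one])
  have hdim : finrank (L i) (Fin d → A i) = d * finrank (L i) (A i) := by
    rw [finrank_pi_fintype]; simp
  have hD : d * finrank k (∀ i, A i) = ∑ j, D j :=
    finrank_twist_eq_sum φ e single_mul_single_of_ne sum_single_one
  have hbound := fun j f hf => finrank_mul_le_finrank_range_vecEnd (L i) φ b hdual θ θ' h1 h2 hθ
    (Pi.evalAlgHom k A i) (centerEmb L A a) (e j) (hcomm j) (hee j) (minpoly k (a j))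
    (minpoly.irreducible (hint j)) (aeval_centerEmb_mul_single a j _ (minpoly.aeval k (a j))) f hf
  have hpos : ∀ j, 0 < (minpoly k (a j)).natDegree := fun j => minpoly.natDegree_pos (hint j)
  -- The rank bound at f = 1 compares the dimensions of the pieces e_j F(A_i) and e_j F(A).
  have hle : ∀ j, finrank (L i) (A i) * D j ≤
      finrank k (∀ i, A i) * finrank (L i) (LinearMap.range (T (e j))) := by
    intro j
    have h3 := hbound j 1 one_ne_zero
    rw [map_one, one_mul, natDegree_one, Nat.sub_zero] at h3
    refine le_of_mul_le_mul_right ?_ (hpos j)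
    calc finrank (L i) (A i) * D j * (minpoly k (a j)).natDegree = _ := mul_assoc _ _ _
      _ ≤ _ := h3
      _ = finrank k (∀ i, A i) * finrank (L i) (LinearMap.range (T (e j))) *
          (minpoly k (a j)).natDegree := by
        rw [mul_assoc, mul_comm (minpoly k (a j)).natDegree]
        rfl
  -- Summed over j, both sides equal d · dim A_i · dim_k A, so no single inequality can be strict.
  have heq : ∀ j, finrank (L i) (A i) * D j =
      finrank k (∀ i, A i) * finrank (L i) (LinearMap.range (T (e j))) := by
    have h3 : ∑ j, finrank (L i) (A i) * D j =
        ∑ j, finrank k (∀ i, A i) * finrank (L i) (LinearMap.range (T (e j))) := by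
      rw [← Finset.mul_sum, ← Finset.mul_sum, ← hD, ← hsplit.2, hdim]
      ring
    exact fun j => (Finset.sum_eq_sum_iff_of_le fun j _ => hle j).1 h3 j (Finset.mem_univ j)
  have hn : 0 < finrank k (∀ i, A i) := by
    have : Nontrivial (∀ i, A i) := Pi.nontrivial_at i
    exact finrank_pos
  have hpow : ∀ j, ∃ w : ℕ, LinearMap.charpoly
      ((T (centerEmb L A a)).restrict (range_le_comap_of_commute (hTc j))) =
        ((minpoly k (a j)).map (algebraMap k (L i))) ^ w ∧
      w * (minpoly k (a j)).natDegree = finrank (L i) (LinearMap.range (T (e j))) := by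
    intro j
    have hmon := (minpoly.monic (hint j)).map (algebraMap k (L i))
    have hnd := (minpoly.monic (hint j)).natDegree_map (algebraMap k (L i))
    have h3 := exists_charpoly_eq_pow (LinearMap.restrict (T (centerEmb L A a))
        (range_le_comap_of_commute (hTc j)) : End (L i) (LinearMap.range (T (e j)))) _ hmon
      (by rw [hnd]; exact hpos j) ?_ ?_
    · rwa [hnd] at h3
    · refine LinearMap.ext ?_
      rintro ⟨_, x, rfl⟩
      refine Subtype.ext ?_
      refine (aeval_apply_of_intertwining (T (centerEmb L A a)) (LinearMap.restrict _
        (range_le_comap_of_commute (hTc j)) : End (L i) (LinearMap.range (T (e j))))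
        (LinearMap.range (T (e j))).subtype (fun _ => rfl) _ ⟨T (e j) x, x, rfl⟩).symm.trans ?_
      have h4 := aeval_vecEnd_map (L i) φ (Pi.evalAlgHom k A i) (centerEmb L A a)
        (minpoly k (a j))
      refine (congrArg (fun S => S (T (e j) x)) h4).trans ?_
      change (T _ * T (e j)) x = 0
      rw [← map_mul, aeval_centerEmb_mul_single a j _ (minpoly.aeval k (a j)), map_zero]
      rfl
    · intro f hf hfm
      rw [finrank_range_aeval_restrict (hTc j), hnd]
      refine Nat.le_of_mul_le_mul_left ?_ hn
      calc _ = finrank (L i) (A i) * (D j * ((minpoly k (a j)).natDegree - f.natDegree)) := by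
            rw [← mul_assoc, ← heq, mul_assoc]
        _ ≤ _ := hbound j f hfm.ne_zero
  choose w hw1 hw2 using hpow
  refine ⟨w, ?_, fun j => ?_⟩
  · refine hsplit.1.trans ?_
    rw [Polynomial.map_prod]
    refine Finset.prod_congr rfl fun j _ => ?_
    rw [hw1, Polynomial.map_pow]
  · rw [hw2]
    exact heq j

end ConnectedCharpoly

/-! ### The connected case: the coefficients lie in k -/

section ConnectedScalars

open Module

variable {ι : Type*} [Fintype ι] [DecidableEq ι] {L : ι → Type*} [∀ i, Field (L i)]
  {A : ι → Type*} [∀ i, Ring (A i)] [∀ i, Algebra (L i) (A i)] {d : ℕ}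
  (φ : (∀ i, A i) →+* Matrix (Fin d) (Fin d) (∀ i, A i))

/-- After raising to the power M²/m_i², the exponents of the minimal polynomials no longer depend on
i, so the same polynomial over k gives every component. The coefficient is obtained as a single
element c of k, which is what makes the tuple of coefficients a central scalar. -/
theorem exists_charpoly_pow_coeff_eq [Nonempty ι] [∀ i, FiniteDimensional (L i) (A i)]
    [∀ i, Nontrivial (A i)] (m : ι → ℕ) (hm : ∀ i, finrank (L i) (A i) = m i ^ 2) (M : ℕ)
    (hM : ∀ i, m i ∣ M) {k : Type*} [Field k] (j : k →+* ∀ i, L i)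
    (hj : ∀ c, j c ∈ centralScalars φ) {r : ℕ} (b : Fin r → ∀ i, A i)
    (hind : ∀ i, LinearIndependent (L i) fun κ => compHom φ i (b κ))
    (hdual : HasDualSystem fun κ => φ (b κ))
    (hspan : ∀ x, ∃ g : Fin r → k, x = ∑ κ, centerEmb L A (j (g κ)) * b κ)
    (θ θ' : Matrix (Fin d × Fin d) (Fin d × Fin d) (∀ i, A i)) (h1 : θ * θ' = 1)
    (h2 : θ' * θ = 1) (hθ : ∀ x, Twist.iterMatrix φ x * θ = θ * Twist.diagMatrix φ x)
    (a : ∀ i, L i) (n : ℕ) :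
    ∃ c : k, ∀ i, ((vecEnd (L i) φ (Pi.evalRingHom A i) (centerEmb L A a)).charpoly ^
      (M ^ 2 / m i ^ 2)).coeff n = j c i := by
  let : ∀ i, Algebra k (L i) := fun i => ((Pi.evalRingHom L i).comp j).toAlgebra
  let : ∀ i, Algebra k (A i) := fun i => RingHom.toAlgebra'
    ((algebraMap (L i) (A i)).comp ((Pi.evalRingHom L i).comp j))
    (fun c x => Algebra.commutes (j c i) x)
  have : ∀ i, IsScalarTower k (L i) (A i) := fun i => IsScalarTower.of_algebraMap_eq fun _ => rfl
  have hsmul : ∀ (c : k) (x : ∀ i, A i), c • x = centerEmb L A (j c) * x := fun c x =>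
    funext fun i => Algebra.smul_def c (x i)
  let Φ : (∀ i, A i) →ₐ[k] Matrix (Fin d) (Fin d) (∀ i, A i) :=
    { φ with
      commutes' := fun c => by
        change φ (centerEmb L A (j c)) = _
        rw [(mem_centralScalars φ).1 (hj c)]
        rfl }
  have hli : LinearIndependent k b := by
    rw [Fintype.linearIndependent_iff]
    intro c hc κ
    obtain ⟨i⟩ := ‹Nonempty ι›
    have h3 := Fintype.linearIndependent_iff.1 (hind i) (fun κ => j (c κ) i) (by
      have h4 := congrArg (compHom φ i) hc
      rw [map_sum, map_zero] at h4
      rw [← h4]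
      refine Finset.sum_congr rfl fun κ _ => ?_
      rw [hsmul, map_mul]
      ext p q
      have h5 : compHom φ i (centerEmb L A (j (c κ))) =
          Matrix.scalar (Fin d) (algebraMap (L i) (A i) (j (c κ) i)) := by
        change (φ (centerEmb L A (j (c κ)))).map (Pi.evalRingHom A i) = _
        rw [(mem_centralScalars φ).1 (hj (c κ))]
        ext p q
        by_cases hpq : p = q
        · subst hpq
          simp [centerEmb_apply]
        · simp [hpq]
      rw [h5]
      simp [Algebra.smul_def]) κ
    exact ((Pi.evalRingHom L i).comp j).injective (h3.trans (map_zero _).symm)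
  have htop : ⊤ ≤ Submodule.span k (Set.range b) := by
    rintro x -
    obtain ⟨g, rfl⟩ := hspan x
    refine Submodule.sum_mem _ fun κ _ => ?_
    rw [← hsmul]
    exact Submodule.smul_mem _ _ (Submodule.subset_span ⟨κ, rfl⟩)
  let bb : Basis (Fin r) k (∀ i, A i) := Basis.mk hli htop
  have hbb : ∀ κ, bb κ = b κ := fun κ => Basis.mk_apply hli htop κ
  have : FiniteDimensional k (∀ i, A i) := bb.finiteDimensional_of_finite
  choose w hw1 hw2 using fun i => charpoly_vecEnd_component Φ bb (by
      simp only [hbb]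
      exact hdual)
    θ θ' h1 h2 hθ a i
  have hint : ∀ j, IsIntegral k (a j) := by
    intro j
    have hfin : Module.Finite k (A j) := Module.Finite.of_surjective
      (Pi.evalAlgHom k A j).toLinearMap (Function.surjective_eval j)
    have := Algebra.IsIntegral.isIntegral (R := k) (algebraMap (L j) (A j) (a j))
    exact (isIntegral_algebraMap_iff (algebraMap (L j) (A j)).injective).1 this
  have hn : 0 < finrank k (∀ i, A i) := by
    obtain ⟨i⟩ := ‹Nonempty ι›
    have : Nontrivial (∀ i, A i) := Pi.nontrivial_at i
    exact finrank_pos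
  -- The left side does not involve i; this is where the normalization by m_i² enters.
  have hE : ∀ i l, M ^ 2 * finrank k (LinearMap.range
      (Algebra.lsmul k k (Twist Φ (∀ i, A i)) (Pi.single l 1 : ∀ i, A i))) =
      finrank k (∀ i, A i) * ((w i l * (M ^ 2 / m i ^ 2)) * (minpoly k (a l)).natDegree) := by
    intro i l
    have h3 := hw2 i l
    rw [hm] at h3
    rw [← Nat.div_mul_cancel (pow_dvd_pow_of_dvd (hM i) 2), mul_assoc, h3,
      Nat.mul_div_cancel _ (by
        rw [← hm]
        exact finrank_pos)]
    ring
  obtain ⟨i₀⟩ := ‹Nonempty ι›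
  have hexp : ∀ i l, w i l * (M ^ 2 / m i ^ 2) = w i₀ l * (M ^ 2 / m i₀ ^ 2) := fun i l =>
    Nat.eq_of_mul_eq_mul_right (minpoly.natDegree_pos (hint l))
      (Nat.eq_of_mul_eq_mul_left hn ((hE i l).symm.trans (hE i₀ l)))
  refine ⟨(∏ l, minpoly k (a l) ^ (w i₀ l * (M ^ 2 / m i₀ ^ 2))).coeff n, fun i => ?_⟩
  have h4 : (vecEnd (L i) φ (Pi.evalRingHom A i) (centerEmb L A a)).charpoly =
    (∏ l, minpoly k (a l) ^ w i l).map (algebraMap k (L i)) := hw1 i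
  rw [h4, ← Polynomial.map_pow, ← Finset.prod_pow, Polynomial.coeff_map]
  simp only [← pow_mul, hexp]
  rfl

theorem charpoly_pow_coeff_mem_centralScalars [∀ i, IsSimpleRing (A i)]
    [∀ i, Algebra.IsCentral (L i) (A i)] [∀ i, FiniteDimensional (L i) (A i)]
    (m : ι → ℕ) (hm : ∀ i, finrank (L i) (A i) = m i ^ 2) (M : ℕ)
    (hM : ∀ i, m i ∣ M) (hφ : Function.Injective φ)
    (θ θ' : Matrix (Fin d × Fin d) (Fin d × Fin d) (∀ i, A i)) (h1 : θ * θ' = 1)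
    (h2 : θ' * θ = 1) (hθ : ∀ x, Twist.iterMatrix φ x * θ = θ * Twist.diagMatrix φ x)
    (hconn : ∀ i j, compHom φ i (Pi.single j 1) ≠ 0)
    (a : ∀ i, L i) (n : ℕ) :
    (fun i => ((vecEnd (L i) φ (Pi.evalRingHom A i) (centerEmb L A a)).charpoly ^
      (M ^ 2 / m i ^ 2)).coeff n) ∈ centralScalars φ := by
  rcases isEmpty_or_nonempty ι with hι | hι
  · rw [Subsingleton.elim (fun i => _) (0 : ∀ i, L i)]
    exact zero_mem _
  obtain ⟨r, b, hind, hdual, hspan⟩ :=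
    exists_centralScalars_basis (L := L) φ hφ θ θ' h1 hθ hconn
  let : Field (centralScalars (L := L) φ) :=
    (isField_centralScalars φ hconn).toField
  obtain ⟨c, hc⟩ := exists_charpoly_pow_coeff_eq φ m hm M hM (centralScalars φ).subtype
    (fun c => c.2) b hind hdual (fun x => by
      obtain ⟨g, hg, hx⟩ := hspan x
      exact ⟨fun κ => ⟨g κ, hg κ⟩, hx⟩) θ θ' h1 h2 hθ a n
  exact (funext hc : _ = (c : ∀ i, L i)) ▸ c.2

end ConnectedScalars

/-! ### Linking of factors is an equivalence relation -/

section Linked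

open Module

/-- The relations place Q R inside S R, and S = u Q v bounds the dimension of S R by that of Q R.
Hence S R = Q R, so Q S = S, while Q S = Q by hypothesis. -/
theorem eq_of_eq_mul_mul_idempotent (K : Type*) {R : Type*} [Field K] [Ring R] [Algebra K R]
    [FiniteDimensional K R] {S Q u v : R} (hQQ : Q * Q = Q) (hQS : Q * S = Q) (hSQ : S * Q = Q)
    (hS : S = u * Q * v) : S = Q := by
  have hle : LinearMap.range (LinearMap.mulLeft K Q) ≤ LinearMap.range (LinearMap.mulLeft K S) := by
    rintro _ ⟨x, rfl⟩
    exact ⟨Q * x, by simp [← mul_assoc, hSQ]⟩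
  have hrank : finrank K (LinearMap.range (LinearMap.mulLeft K S)) ≤
      finrank K (LinearMap.range (LinearMap.mulLeft K Q)) := by
    refine (Submodule.finrank_mono ?_).trans
      (Submodule.finrank_map_le (LinearMap.mulLeft K u) (LinearMap.range (LinearMap.mulLeft K Q)))
    rintro _ ⟨x, rfl⟩
    exact ⟨_, ⟨v * x, rfl⟩, by simp [hS, mul_assoc]⟩
  obtain ⟨r, hr⟩ : S ∈ LinearMap.range (LinearMap.mulLeft K Q) :=
    Submodule.eq_of_le_of_finrank_le hle hrank ▸ ⟨1, by simp⟩
  rw [LinearMap.mulLeft_apply] at hr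
  rw [← hr, ← hQQ, mul_assoc, hr, hQS, hQQ]

variable {ι : Type*} {L : ι → Type*} [∀ i, Field (L i)]
  {A : ι → Type*} [∀ i, Ring (A i)] [∀ i, Algebra (L i) (A i)] {d : ℕ}
  (φ : (∀ i, A i) →+* Matrix (Fin d) (Fin d) (∀ i, A i))

variable {φ}

theorem injective_iff_compHom : Function.Injective φ ↔ ∀ x, (∀ i, compHom φ i x = 0) → x = 0 := by
  rw [injective_iff_map_eq_zero]
  refine forall_congr' fun x => imp_congr_left ⟨fun h i => ?_, fun h => ?_⟩
  · change (φ x).map (Pi.evalRingHom A i) = 0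
    rw [h, Matrix.map_zero _ rfl]
  · ext p q i
    exact congrFun (congrFun (h i) p) q

theorem map_evalRingHom_eq_mul {n : Type*} [Fintype n] {S D θ θ' : Matrix n n (∀ i, A i)}
    (h : S = θ * D * θ') (i : ι) : S.map (Pi.evalRingHom A i) =
      θ.map (Pi.evalRingHom A i) * D.map (Pi.evalRingHom A i) * θ'.map (Pi.evalRingHom A i) := by
  rw [h, Matrix.map_mul, Matrix.map_mul]

variable (φ) [DecidableEq ι]

/-- The `i`-th component of `φ` does not kill the `j`-th factor. -/
def Linked (i j : ι) : Prop := compHom φ i (Pi.single j 1) ≠ 0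

variable {φ}

variable (φ) in
open Classical in
/-- The sum of the units of the factors on which the `i`-th component of `φ` does not vanish. -/
noncomputable def linkedIdem (i : ι) : ∀ j, A j := fun j => if Linked φ i j then 1 else 0

theorem linkedIdem_apply_of_linked {i j : ι} (h : Linked φ i j) : linkedIdem φ i j = 1 := if_pos h

theorem linkedIdem_mul_self (i : ι) : linkedIdem φ i * linkedIdem φ i = linkedIdem φ i := by
  ext j
  by_cases h : Linked φ i j <;> simp [linkedIdem, h]

theorem linkedIdem_commute (i : ι) (x : ∀ i, A i) : Commute (linkedIdem φ i) x := by
  ext j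
  by_cases h : Linked φ i j <;> simp [linkedIdem, h]

variable [Fintype ι] [∀ i, IsSimpleRing (A i)]

/-- The kernel of φ_i meets each A_j in a two-sided ideal of a simple ring, so φ_i is either zero or
injective there. -/
theorem compHom_eq_zero_iff (i : ι) (x : ∀ i, A i) :
    compHom φ i x = 0 ↔ ∀ j, Linked φ i j → x j = 0 := by
  constructor
  · intro hx j hj
    let I : TwoSidedIdeal (A j) := TwoSidedIdeal.mk'
      {y | compHom φ i (Pi.single j y) = 0}
      (by simp)
      (fun {y z} hy hz => by
        change compHom φ i (Pi.single j (y + z)) = 0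
        rw [Pi.single_add, map_add, hy, hz, add_zero])
      (fun {y} hy => by
        change compHom φ i (Pi.single j (-y)) = 0
        rw [Pi.single_neg, map_neg, hy, neg_zero])
      (fun {y z} hz => by
        change compHom φ i (Pi.single j (y * z)) = 0
        rw [Pi.single_mul, map_mul, hz, mul_zero])
      (fun {y z} hy => by
        change compHom φ i (Pi.single j (y * z)) = 0
        rw [Pi.single_mul, map_mul, hy, zero_mul])
    have hI : ∀ y, y ∈ I ↔ compHom φ i (Pi.single j y) = 0 := fun y =>
      TwoSidedIdeal.mem_mk' _ _ _ _ _ _ _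
    have hxI : x j ∈ I := by
      rw [hI]
      have : (Pi.single j (x j) : ∀ i, A i) = Pi.single j 1 * x := by
        ext l
        by_cases hl : l = j
        · subst hl
          simp
        · simp [hl]
      rw [this, map_mul, hx, mul_zero]
    rcases eq_bot_or_eq_top I with h | h
    · rw [h] at hxI
      exact (TwoSidedIdeal.mem_bot _).1 hxI
    · refine absurd ((hI 1).1 ?_) hj
      rw [h]
      trivial
  · intro h
    rw [← Finset.univ_sum_single x, map_sum]
    refine Finset.sum_eq_zero fun j _ => ?_
    by_cases hj : Linked φ i j
    · rw [h j hj, Pi.single_zero, map_zero]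
    · have : (Pi.single j (x j) : ∀ i, A i) = Pi.single j 1 * Pi.single j (x j) := by
        rw [← Pi.single_mul, one_mul]
      rw [this, map_mul, not_not.1 hj, zero_mul]

variable {θ θ' : Matrix (Fin d × Fin d) (Fin d × Fin d) (∀ i, A i)}

/-- If φ_i(e_k) = 0, then conjugation by θ gives φ_i(φ(e_k)_pq) = 0 for all p, q. As φ_i is
injective on A_j, the component φ_j(e_k) vanishes. -/
theorem Linked.trans (h1 : θ * θ' = 1)
    (hθ : ∀ x, Twist.iterMatrix φ x * θ = θ * Twist.diagMatrix φ x) {i j k : ι}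
    (hij : Linked φ i j) (hjk : Linked φ j k) : Linked φ i k := by
  by_contra hik
  have hik' : compHom φ i (Pi.single k 1) = 0 := not_not.1 hik
  have hd : (Twist.diagMatrix φ (Pi.single k 1)).map (Pi.evalRingHom A i) = 0 := by
    ext x y
    have h2 : φ (Pi.single k 1) x.2 y.2 i = 0 := congrFun (congrFun hik' x.2) y.2
    change (if x.1 = y.1 then φ (Pi.single k 1) x.2 y.2 else 0) i = 0
    split_ifs
    · exact h2
    · rfl
  have hit : (Twist.iterMatrix φ (Pi.single k 1)).map (Pi.evalRingHom A i) = 0 := by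
    have hconj := mul_eq_of_intertwining h1 (hθ (Pi.single k 1))
    rw [map_evalRingHom_eq_mul hconj i, hd, Matrix.mul_zero, Matrix.zero_mul]
  have h3 : ∀ p q, compHom φ i (φ (Pi.single k 1) p q) = 0 := by
    intro p q
    ext s t
    exact congrFun (congrFun hit (p, s)) (q, t)
  refine hjk ?_
  ext p q
  exact (compHom_eq_zero_iff i _).1 (h3 p q) j hij

theorem compHom_linkedIdem (h1 : θ * θ' = 1)
    (hθ : ∀ x, Twist.iterMatrix φ x * θ = θ * Twist.diagMatrix φ x) {i j : ι}
    (hij : Linked φ i j) : compHom φ j (linkedIdem φ i) = 1 := by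
  rw [← sub_eq_zero, ← map_one (compHom φ j), ← map_sub, compHom_eq_zero_iff]
  intro k hk
  rw [Pi.sub_apply, linkedIdem_apply_of_linked (hij.trans h1 hθ hk), Pi.one_apply, sub_self]

theorem compHom_linkedIdem_self (i : ι) : compHom φ i (linkedIdem φ i) = 1 := by
  rw [← sub_eq_zero, ← map_one (compHom φ i), ← map_sub, compHom_eq_zero_iff]
  intro k hk
  rw [Pi.sub_apply, linkedIdem_apply_of_linked hk, Pi.one_apply, sub_self]

/-- By transitivity φ(e) = e + y with y supported off e. Applying φ to the entries gives diag φ(e) +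
Y, with Y orthogonal to diag φ(e). This sum is also conjugate to diag φ(e) by θ, so Y = 0 by
comparison of ranks, and y = 0 by injectivity. -/
theorem map_linkedIdem [∀ i, FiniteDimensional (L i) (A i)] (hφ : Function.Injective φ)
    (h1 : θ * θ' = 1)
    (hθ : ∀ x, Twist.iterMatrix φ x * θ = θ * Twist.diagMatrix φ x) (i : ι) :
    φ (linkedIdem φ i) = Matrix.scalar (Fin d) (linkedIdem φ i) := by
  set e := linkedIdem φ i with he
  have hee : e * e = e := linkedIdem_mul_self i
  have hφe : φ e * φ e = φ e := by rw [← map_mul, hee]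
  let y : Fin d → Fin d → ∀ i, A i := fun p q => (1 - e) * φ e p q
  have hey : ∀ p q, e * y p q = 0 := fun p q => by
    simp only [y]
    rw [← mul_assoc, mul_sub, mul_one, hee, sub_self, zero_mul]
  have hye : ∀ p q, y p q * e = 0 := fun p q => by
    rw [← (linkedIdem_commute i (y p q)).eq, hey]
  have hdecomp : ∀ p q, φ e p q = Matrix.scalar (Fin d) e p q + y p q := by
    intro p q
    ext j
    by_cases hj : Linked φ i j
    · have h2 := congrFun (congrFun (compHom_linkedIdem h1 hθ hj) p) q
      rw [compHom_apply] at h2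
      rw [h2]
      by_cases hpq : p = q
      · subst hpq
        simp [y, e, linkedIdem, hj]
      · simp [y, e, linkedIdem, hj, hpq]
    · by_cases hpq : p = q
      · subst hpq
        simp [y, e, linkedIdem, hj]
      · simp [y, e, linkedIdem, hj, hpq]
  have hit : Twist.iterMatrix φ e = Twist.diagMatrix φ e +
      Matrix.of fun x z => φ (y x.1 z.1) x.2 z.2 := by
    ext1 x z
    simp only [Twist.iterMatrix, Twist.diagMatrix, Matrix.of_apply, Matrix.add_apply]
    rw [hdecomp, map_add, Matrix.add_apply]
    congr 1
    by_cases hxz : x.1 = z.1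
    · simp [hxz]
    · simp [hxz]
  set Y : Matrix (Fin d × Fin d) (Fin d × Fin d) (∀ i, A i) :=
    Matrix.of fun x z => φ (y x.1 z.1) x.2 z.2 with hY
  have hQY : Twist.diagMatrix φ e * Y = 0 := by
    ext1 x z
    rw [Matrix.mul_apply, Fintype.sum_prod_type, Finset.sum_eq_single x.1]
    · have := congrFun (congrFun (congrArg φ (hey x.1 z.1)) x.2) z.2
      rw [map_mul, map_zero, Matrix.mul_apply] at this
      simpa [Twist.diagMatrix, Y] using this
    · intro p _ hp
      exact Finset.sum_eq_zero fun q _ => by simp [Twist.diagMatrix, hp.symm]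
    · simp
  have hYQ : Y * Twist.diagMatrix φ e = 0 := by
    ext1 x z
    rw [Matrix.mul_apply, Fintype.sum_prod_type, Finset.sum_eq_single z.1]
    · have := congrFun (congrFun (congrArg φ (hye x.1 z.1)) x.2) z.2
      rw [map_mul, map_zero, Matrix.mul_apply] at this
      simpa [Twist.diagMatrix, Y] using this
    · intro p _ hp
      exact Finset.sum_eq_zero fun q _ => by simp [Twist.diagMatrix, hp]
    · simp
  have hQQ : Twist.diagMatrix φ e * Twist.diagMatrix φ e = Twist.diagMatrix φ e := by
    ext1 x z
    rw [Matrix.mul_apply, Fintype.sum_prod_type, Finset.sum_eq_single x.1]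
    · have := congrFun (congrFun hφe x.2) z.2
      rw [Matrix.mul_apply] at this
      by_cases hxz : x.1 = z.1
      · simpa [Twist.diagMatrix, hxz] using this
      · simp [Twist.diagMatrix, hxz]
    · intro p _ hp
      exact Finset.sum_eq_zero fun q _ => by simp [Twist.diagMatrix, hp.symm]
    · simp
  have hconj := mul_eq_of_intertwining h1 (hθ e)
  -- The rank argument needs a finite-dimensional algebra over one field, hence the passage to a
  -- single coordinate.
  have hcomp : ∀ j, Y.map (Pi.evalRingHom A j) = 0 := by
    intro j
    let ev : Matrix (Fin d × Fin d) (Fin d × Fin d) (∀ i, A i) →+* _ :=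
      (Pi.evalRingHom A j).mapMatrix
    have h3 : ev (Twist.iterMatrix φ e) = ev (Twist.diagMatrix φ e) := by
      refine eq_of_eq_mul_mul_idempotent (L j) (u := ev θ) (v := ev θ') ?_ ?_ ?_ ?_
      · rw [← map_mul, hQQ]
      · rw [← map_mul, hit, mul_add, hQQ, hQY, add_zero]
      · rw [← map_mul, hit, add_mul, hQQ, hYQ, add_zero]
      · rw [hconj, map_mul, map_mul]
    rw [hit, map_add, add_eq_left] at h3
    exact h3
  have hy : ∀ p q, y p q = 0 := by
    intro p q
    refine injective_iff_compHom.1 hφ _ fun j => ?_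
    ext s t
    exact congrFun (congrFun (hcomp j) (p, s)) (q, t)
  ext1 p q
  rw [hdecomp, hy, add_zero]

/-- Otherwise the idempotent e attached to i has i-th coordinate 0, so φ_i(e) = 0 by
`map_linkedIdem`; but φ_i(e) = 1. -/
theorem Linked.refl [NeZero d] [∀ i, FiniteDimensional (L i) (A i)]
    (hφ : Function.Injective φ) (h1 : θ * θ' = 1)
    (hθ : ∀ x, Twist.iterMatrix φ x * θ = θ * Twist.diagMatrix φ x) (i : ι) :
    Linked φ i i := by
  by_contra h
  have h2 := congrFun (congrFun (compHom_linkedIdem_self (φ := φ) i) 0) 0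
  rw [compHom_apply, map_linkedIdem (L := L) hφ h1 hθ] at h2
  simp [linkedIdem, h] at h2

/-- If j is not linked to i, then φ_i kills the idempotent attached to j. That idempotent is 1 at j
by reflexivity, whereas φ_i is injective on A_j. -/
theorem Linked.symm [NeZero d] [∀ i, FiniteDimensional (L i) (A i)]
    (hφ : Function.Injective φ) (h1 : θ * θ' = 1)
    (hθ : ∀ x, Twist.iterMatrix φ x * θ = θ * Twist.diagMatrix φ x) {i j : ι}
    (hij : Linked φ i j) : Linked φ j i := by
  by_contra h
  have h2 : compHom φ i (linkedIdem φ j) = 0 := by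
    ext p q
    rw [compHom_apply, map_linkedIdem (L := L) hφ h1 hθ]
    by_cases hpq : p = q
    · simp [hpq, linkedIdem, h]
    · simp [hpq]
  have h3 := (compHom_eq_zero_iff i _).1 h2 j hij
  rw [linkedIdem_apply_of_linked (Linked.refl (L := L) hφ h1 hθ j)] at h3
  exact one_ne_zero h3

end Linked

/-! ### Reduction to a single linkage class -/

section Reduction

open Module

/-- The projection of a product of rings onto the product of the factors with index in `s`. -/
def piRestrict {ι : Type*} (A : ι → Type*) [∀ i, Ring (A i)] (s : ι → Prop) :
    (∀ i, A i) →+* ∀ i : {j // s j}, A i :=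
  RingHom.pi fun i => Pi.evalRingHom A i

theorem piRestrict_apply {ι : Type*} {A : ι → Type*} [∀ i, Ring (A i)] {s : ι → Prop}
    (x : ∀ i, A i) (i : {j // s j}) : piRestrict A s x i = x i := rfl

theorem piRestrict_surjective {ι : Type*} {A : ι → Type*} [∀ i, Ring (A i)] {s : ι → Prop} :
    Function.Surjective (piRestrict A s) := by
  classical
  intro x
  refine ⟨fun i => if h : s i then x ⟨i, h⟩ else 0, funext fun i => ?_⟩
  rw [piRestrict_apply, dif_pos i.2]

variable {ι : Type*} [Fintype ι] [DecidableEq ι] {L : ι → Type*} [∀ i, Field (L i)]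
  {A : ι → Type*} [∀ i, Ring (A i)] [∀ i, Algebra (L i) (A i)] {d : ℕ}
  {φ : (∀ i, A i) →+* Matrix (Fin d) (Fin d) (∀ i, A i)}
  [∀ i, IsSimpleRing (A i)]
  {θ θ' : Matrix (Fin d × Fin d) (Fin d × Fin d) (∀ i, A i)}

/-- By transitivity, for i in the class of i₀ the map φ_i sees only factors in that class, so φ
descends to the product over the class. -/
theorem exists_restrict (h1 : θ * θ' = 1)
    (hθ : ∀ x, Twist.iterMatrix φ x * θ = θ * Twist.diagMatrix φ x) (i₀ : ι) :
    ∃ φ' : (∀ i : {j // Linked φ i₀ j}, A i) →+*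
        Matrix (Fin d) (Fin d) (∀ i : {j // Linked φ i₀ j}, A i),
      ∀ x, φ' (piRestrict A _ x) = (φ x).map (piRestrict A _) := by
  refine ⟨RingHom.liftOfSurjective (piRestrict A (Linked φ i₀)) piRestrict_surjective
    ⟨(piRestrict A (Linked φ i₀)).mapMatrix.comp φ, fun x hx => ?_⟩,
    fun x => RingHom.liftOfSurjective_comp_apply _ _ _ x⟩
  rw [RingHom.mem_ker] at hx ⊢
  ext p q i
  have h : compHom φ i x = 0 := (compHom_eq_zero_iff (i : ι) x).2 fun j hj =>
    congrFun hx ⟨j, i.2.trans h1 hθ hj⟩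
  exact congrFun (congrFun h p) q

/-- Being a central scalar is checked one coordinate i₀ at a time, and that coordinate of φ depends
only on the class of i₀, where the connected case applies. -/
theorem charpoly_pow_coeff_mem_centralScalars_of_injective [NeZero d]
    [∀ i, Algebra.IsCentral (L i) (A i)] [∀ i, FiniteDimensional (L i) (A i)]
    (m : ι → ℕ) (hm : ∀ i, finrank (L i) (A i) = m i ^ 2) (M : ℕ)
    (hM : ∀ i, m i ∣ M) (hφ : Function.Injective φ) (h1 : θ * θ' = 1)
    (h2 : θ' * θ = 1) (hθ : ∀ x, Twist.iterMatrix φ x * θ = θ * Twist.diagMatrix φ x)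
    (a : ∀ i, L i) (n : ℕ) :
    (fun i => ((vecEnd (L i) φ (Pi.evalRingHom A i) (centerEmb L A a)).charpoly ^
      (M ^ 2 / m i ^ 2)).coeff n) ∈ centralScalars φ := by
  classical
  rw [mem_centralScalars]
  ext p q i₀
  have hrefl : Linked φ i₀ i₀ := Linked.refl (L := L) hφ h1 hθ i₀
  obtain ⟨φ', hφ'⟩ := exists_restrict h1 hθ i₀
  let A' : {j // Linked φ i₀ j} → Type _ := fun i => A i
  let res : (∀ i, A i) →+* ∀ i, A' i := piRestrict A (Linked φ i₀)
  have hφ'app : ∀ x p q, φ' (res x) p q = res (φ x p q) := fun x p q =>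
    congrFun (congrFun (hφ' x) p) q
  have hsurj : Function.Surjective res := piRestrict_surjective
  have hinj : Function.Injective φ' := by
    rw [injective_iff_map_eq_zero]
    intro y hy
    obtain ⟨x, rfl⟩ := hsurj y
    have h3 : compHom φ i₀ x = 0 := by
      ext p q
      have h4 := congrFun (congrFun hy p) q
      exact congrFun ((hφ'app x p q).symm.trans h4) ⟨i₀, hrefl⟩
    exact funext fun j => (compHom_eq_zero_iff i₀ x).1 h3 j j.2
  have hθ' : ∀ y, Twist.iterMatrix φ' y * θ.map res = θ.map res * Twist.diagMatrix φ' y := by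
    intro y
    obtain ⟨x, rfl⟩ := hsurj y
    have hi : Twist.iterMatrix φ' (res x) = (Twist.iterMatrix φ x).map res := by
      ext1 s t
      simp only [Twist.iterMatrix, Matrix.of_apply, Matrix.map_apply]
      rw [hφ'app, hφ'app]
    have hd : Twist.diagMatrix φ' (res x) = (Twist.diagMatrix φ x).map res := by
      ext1 s t
      simp only [Twist.diagMatrix, Matrix.of_apply, Matrix.map_apply]
      split_ifs
      · exact hφ'app _ _ _
      · exact (map_zero res).symm
    rw [hi, hd, ← Matrix.map_mul, ← Matrix.map_mul, hθ]
  have hsingle : ∀ j : {j // Linked φ i₀ j},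
      res (Pi.single (j : ι) 1) = (Pi.single j 1 : ∀ i, A' i) := by
    intro j
    ext l
    change (Pi.single (j : ι) 1 : ∀ i, A i) l = _
    by_cases hl : l = j
    · subst hl
      simp
    · have : (l : ι) ≠ j := fun h => hl (Subtype.ext h)
      rw [Pi.single_eq_of_ne this, Pi.single_eq_of_ne hl]
  have hconn : ∀ i j, compHom φ' i (Pi.single j 1 : ∀ i, A' i) ≠ 0 := by
    intro i j h
    -- Two members of the class are linked to each other by going back through i₀.
    refine (Linked.trans h1 hθ (Linked.symm (L := L) hφ h1 hθ i.2) j.2 : Linked φ i j) ?_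
    ext p q
    have h4 := congrFun (congrFun h p) q
    rw [compHom_apply, ← hsingle, hφ'app] at h4
    exact h4
  have key := charpoly_pow_coeff_mem_centralScalars (L := fun i : {j // Linked φ i₀ j} => L i) φ'
    (fun i => m i) (fun i => hm i) M (fun i => hM i) hinj (θ.map res) (θ'.map res)
    (by rw [← Matrix.map_mul, h1, Matrix.map_one _ (map_zero res) (map_one res)])
    (by rw [← Matrix.map_mul, h2, Matrix.map_one _ (map_zero res) (map_one res)])
    hθ' hconn (fun i => a i) n
  rw [mem_centralScalars] at key
  have hvec : ∀ i : {j // Linked φ i₀ j},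
      vecEnd (L i) φ' (Pi.evalRingHom A' i) (centerEmb (fun i : {j // Linked φ i₀ j} => L i) A'
        fun i => a i) = vecEnd (L i) φ (Pi.evalRingHom A i) (centerEmb L A a) := by
    intro i
    refine LinearMap.ext fun y => funext fun p => ?_
    rw [vecEnd_apply, vecEnd_apply]
    refine Finset.sum_congr rfl fun q _ => congrArg (· * y q) ?_
    exact congrFun (hφ'app (centerEmb L A a) p q) i
  simp only [A'] at hvec
  simp only [hvec] at key
  have h5 := congrFun (congrFun (congrFun key p) q) ⟨i₀, hrefl⟩
  have h6 := congrFun (hφ'app (centerEmb L A fun i =>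
    ((vecEnd (L i) φ (Pi.evalRingHom A i) (centerEmb L A a)).charpoly ^
      (M ^ 2 / m i ^ 2)).coeff n) p q) ⟨i₀, hrefl⟩
  refine h6.symm.trans (h5.trans ?_)
  by_cases hpq : p = q
  · subst hpq
    simp [centerEmb_apply]
  · simp [hpq]

end Reduction

/-! ### The right action in a left basis -/

section OpMatrix

open Module

variable {R A : Type*} [Ring R] [Ring A] (τ : Rᵐᵒᵖ ≃+* A) {n : Type*} [Fintype n] [DecidableEq n]

theorem end_pi_apply (f : End R (n → R)) (v : n → R) (p : n) :
    f v p = ∑ q, v q * f (Pi.single q 1) p := by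
  have h : v = ∑ q, v q • (Pi.single q 1 : n → R) := by
    ext p
    simp [Finset.sum_apply, Pi.single_apply]
  conv_lhs => rw [h]
  simp [Finset.sum_apply]

/-- Endomorphisms of the free left module `R ^ n` as matrices over the opposite ring. -/
def opMatrix : End R (n → R) →+* Matrix n n A where
  toFun f := Matrix.of fun p q => τ (op (f (Pi.single q 1) p))
  map_one' := by
    ext p q
    simp only [Matrix.of_apply, End.one_apply, Pi.single_apply, Matrix.one_apply]
    split_ifs <;> simp
  map_mul' f g := by
    ext p q
    simp only [Matrix.of_apply, End.mul_apply, Matrix.mul_apply]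
    rw [end_pi_apply f, Finset.op_sum, map_sum]
    exact Finset.sum_congr rfl fun r _ => by rw [op_mul, map_mul]
  map_zero' := by
    ext p q
    simp
  map_add' f g := by
    ext p q
    simp

variable {P : Type*} [AddCommGroup P] [Module R P] {d : ℕ} (e : P ≃ₗ[R] (Fin d → R))

/-- The elements of the left basis corresponding to `e`. -/
def basisVec (q : Fin d) : P := e.symm (Pi.single q 1)

theorem sum_smul_basisVec (x : P) : ∑ q, e x q • basisVec e q = x := by
  apply e.injective
  rw [map_sum]
  ext p
  simp [basisVec, Finset.sum_apply, Pi.single_apply]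

theorem apply_basisVec (p q : Fin d) : e (basisVec e q) p = if p = q then 1 else 0 := by
  simp [basisVec, Pi.single_apply]

/-- Coordinates on `P ^ d`. -/
def powEquiv : (Fin d → P) ≃ₗ[R] (Fin d × Fin d → R) :=
  (LinearEquiv.piCongrRight fun _ => e).trans (LinearEquiv.curry R R (Fin d) (Fin d)).symm

theorem powEquiv_apply (z : Fin d → P) (x : Fin d × Fin d) : powEquiv e z x = e (z x.1) x.2 := rfl

theorem powEquiv_symm_single (x : Fin d × Fin d) :
    (powEquiv e).symm (Pi.single x 1) = Pi.single x.1 (basisVec e x.2) := by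
  rw [LinearEquiv.symm_apply_eq]
  ext y
  rw [powEquiv_apply]
  by_cases h : y.1 = x.1
  · rw [h, Pi.single_eq_same, apply_basisVec, Pi.single_apply]
    simp [Prod.ext_iff, h]
  · rw [Pi.single_eq_of_ne h, Pi.single_eq_of_ne (fun h' => h (congrArg Prod.fst h')), map_zero]
    rfl

variable [Module Rᵐᵒᵖ P] [SMulCommClass R Rᵐᵒᵖ P]

/-- The right action on a bimodule with a finite left basis, as matrices over the opposite ring. -/
def bimoduleMatrix : A →+* Matrix (Fin d) (Fin d) A :=
  haveI := SMulCommClass.symm R Rᵐᵒᵖ P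
  (opMatrix τ).comp ((e.conjRingEquiv : End R P →+* End R (Fin d → R)).comp
    ((Module.toModuleEnd R P).comp (τ.symm : A →+* Rᵐᵒᵖ)))

theorem bimoduleMatrix_apply (b : Rᵐᵒᵖ) (p q : Fin d) :
    bimoduleMatrix τ e (τ b) p q = τ (op (e (b • basisVec e q) p)) := by
  change τ (op (e (τ.symm (τ b) • basisVec e q) p)) = _
  rw [RingEquiv.symm_apply_apply]

theorem op_smul_apply (b : Rᵐᵒᵖ) (x : P) (p : Fin d) :
    e (b • x) p = ∑ q, e x q * e (b • basisVec e q) p := by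
  conv_lhs => rw [← sum_smul_basisVec e x]
  rw [Finset.smul_sum, map_sum, Finset.sum_apply]
  refine Finset.sum_congr rfl fun q _ => ?_
  rw [← smul_comm (e x q) b, map_smul]
  rfl

/-- The matrix condition says that z acts equally from the left and from the right on the left
basis. Centrality of z makes both actions left linear, so this extends to all of P. -/
theorem bimoduleMatrix_eq_scalar_iff {z : R} (hz : ∀ x : R, Commute z x) :
    bimoduleMatrix τ e (τ (op z)) = Matrix.scalar (Fin d) (τ (op z)) ↔
      z ∈ bimoduleCenter R P := by
  have hbasis : bimoduleMatrix τ e (τ (op z)) = Matrix.scalar (Fin d) (τ (op z)) ↔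
      ∀ q, op z • basisVec e q = z • basisVec e q := by
    constructor
    · intro h q
      apply e.injective
      ext p
      have h2 := congrFun (congrFun h p) q
      rw [bimoduleMatrix_apply] at h2
      rw [map_smul e z, Pi.smul_apply, apply_basisVec]
      by_cases hpq : p = q
      · subst hpq
        simpa using h2
      · simpa [hpq] using h2
    · intro h
      ext p q
      rw [bimoduleMatrix_apply, h, map_smul e z, Pi.smul_apply, apply_basisVec]
      by_cases hpq : p = q
      · subst hpq
        simp
      · simp [hpq]
  rw [hbasis]
  refine ⟨fun h x => ?_, fun h q => (h _).symm⟩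
  rw [← sum_smul_basisVec e x, Finset.smul_sum, Finset.smul_sum]
  refine Finset.sum_congr rfl fun q _ => ?_
  rw [← smul_comm (e x q) (op z), h, smul_smul, smul_smul, (hz _).eq]

/-- A nonzero free right module is faithful; this is the role of right freeness and of d ≥ 1. -/
theorem bimoduleMatrix_injective (e' : P ≃ₗ[Rᵐᵒᵖ] (Fin d → R)) [NeZero d] :
    Function.Injective (bimoduleMatrix τ e) := by
  rw [injective_iff_map_eq_zero]
  intro x hx
  obtain ⟨b, rfl⟩ := τ.surjective x
  have h1 : ∀ q, b • basisVec e q = 0 := by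
    intro q
    apply e.injective
    rw [map_zero]
    ext p
    have h2 := congrFun (congrFun hx p) q
    rw [bimoduleMatrix_apply] at h2
    simpa using h2
  have h3 : ∀ x : P, b • x = 0 := by
    intro x
    rw [← sum_smul_basisVec e x, Finset.smul_sum]
    exact Finset.sum_eq_zero fun q _ => by
      rw [← smul_comm (e x q) b, h1, smul_zero]
  have h4 := congrFun (congrArg e' (h3 (e'.symm fun _ => 1))) 0
  rw [map_smul, LinearEquiv.apply_symm_apply, map_zero] at h4
  have h5 : b = 0 := by
    apply unop_injective
    simpa [MulOpposite.smul_eq_mul_unop] using h4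
  rw [h5, map_zero]

end OpMatrix

/-! ### The isomorphism P ⊗ P ≅ P^d as an intertwining matrix -/

section TensorPower

open Module

variable {R : Type*} [Ring R] {P : Type*} [AddCommGroup P] [Module R P] [Module Rᵐᵒᵖ P]
  {d : ℕ} (e : P ≃ₗ[R] (Fin d → R))

theorem BimodTensor.add_tmul (x x' y : P) : BimodTensor.tmul R (x + x') y =
    BimodTensor.tmul R x y + BimodTensor.tmul R x' y :=
  (congrArg (BimodTensor.mk R P P) (TensorProduct.add_tmul x x' y)).trans (map_add _ _ _)

theorem BimodTensor.tmul_add (x y y' : P) : BimodTensor.tmul R x (y + y') =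
    BimodTensor.tmul R x y + BimodTensor.tmul R x y' :=
  (congrArg (BimodTensor.mk R P P) (TensorProduct.tmul_add x y y')).trans (map_add _ _ _)

theorem BimodTensor.smul_tmul (x : P) (a : R) (y : P) :
    BimodTensor.tmul R (op a • x) y = BimodTensor.tmul R x (a • y) := by
  rw [← sub_eq_zero]
  refine (map_sub (BimodTensor.mk R P P) _ _).symm.trans ?_
  exact (QuotientAddGroup.eq_zero_iff _).2 (AddSubgroup.subset_closure ⟨x, a, y, rfl⟩)

/-- `y ↦ x ⊗ y` as an additive map. -/
noncomputable def BimodTensor.tmulHom (x : P) : P →+ BimodTensor R P P :=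
  AddMonoidHom.mk' (BimodTensor.tmul R x) (BimodTensor.tmul_add x)

theorem BimodTensor.tmul_sum {ι : Type*} (s : Finset ι) (x : P) (y : ι → P) :
    BimodTensor.tmul R x (∑ i ∈ s, y i) = ∑ i ∈ s, BimodTensor.tmul R x (y i) :=
  map_sum (BimodTensor.tmulHom x) y s

/-- `x ↦ x ⊗ y` as an additive map. -/
noncomputable def BimodTensor.homTmul (y : P) : P →+ BimodTensor R P P :=
  AddMonoidHom.mk' (fun x => BimodTensor.tmul R x y) fun x x' => BimodTensor.add_tmul x x' y

theorem BimodTensor.sum_tmul {ι : Type*} (s : Finset ι) (x : ι → P) (y : P) :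
    BimodTensor.tmul R (∑ i ∈ s, x i) y = ∑ i ∈ s, BimodTensor.tmul R (x i) y :=
  map_sum (BimodTensor.homTmul y) x s

/-- The coordinates of an element of `P ⊗ P` with respect to a left basis of the second factor. -/
noncomputable def tensorCoord : BimodTensor R P P →+ (Fin d → P) :=
  QuotientAddGroup.lift (balancedRel R P P)
    (TensorProduct.lift (LinearMap.mk₂ ℤ (fun x y q => op (e y q) • x)
      (fun x x' y => by ext q; simp)
      (fun c x y => by ext q; exact map_zsmul (DistribSMul.toAddMonoidHom P (op (e y q))) c x)
      (fun x y y' => by ext q; simp [add_smul])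
      (fun c x y => by
        ext q
        rw [map_zsmul, Pi.smul_apply, op_smul, smul_assoc]
        rfl))).toAddMonoidHom (by
    rw [balancedRel, AddSubgroup.closure_le]
    rintro _ ⟨x, a, y, rfl⟩
    rw [SetLike.mem_coe, AddMonoidHom.mem_ker, map_sub, sub_eq_zero]
    ext q
    simp [mul_smul])

theorem tensorCoord_tmul (x y : P) (q : Fin d) :
    tensorCoord e (BimodTensor.tmul R x y) q = op (e y q) • x := rfl

variable [SMulCommClass R Rᵐᵒᵖ P]

/-- `P ⊗ P` is `P ^ d` as a left module. -/
noncomputable def tensorEquiv : (Fin d → P) ≃ₗ[R] BimodTensor R P P where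
  toFun z := ∑ q, BimodTensor.tmul R (z q) (basisVec e q)
  map_add' z z' := by
    simp only [Pi.add_apply, BimodTensor.add_tmul, Finset.sum_add_distrib]
  map_smul' b z := by
    rw [RingHom.id_apply, Finset.smul_sum]
    rfl
  invFun := tensorCoord e
  left_inv z := by
    ext r
    rw [map_sum, Finset.sum_apply, Finset.sum_eq_single r]
    · rw [tensorCoord_tmul, apply_basisVec, if_pos rfl, op_one, one_smul]
    · intro q _ hq
      rw [tensorCoord_tmul, apply_basisVec, if_neg hq.symm, op_zero, zero_smul]
    · simp
  right_inv := by
    let F : (Fin d → P) →+ BimodTensor R P P :=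
      ∑ q, (BimodTensor.homTmul (basisVec e q)).comp (Pi.evalAddMonoidHom _ q)
    have hF : ∀ z, F z = ∑ q, BimodTensor.tmul R (z q) (basisVec e q) := by
      intro z
      simp only [F, AddMonoidHom.finsetSum_apply]
      rfl
    have h : F.comp (tensorCoord e) = AddMonoidHom.id _ := by
      refine BimodTensor.hom_ext fun x y => ?_
      rw [AddMonoidHom.comp_apply, hF, AddMonoidHom.id_apply]
      simp only [tensorCoord_tmul, BimodTensor.smul_tmul]
      rw [← BimodTensor.tmul_sum, sum_smul_basisVec]
    intro t
    exact (hF _).symm.trans (DFunLike.congr_fun h t)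

/-- Expand v_q b in the left basis v_r and move the coefficients across the tensor sign, where they
act on the first factor from the right. This is the source of the iterated matrix φ(φ(b)_pq). -/
theorem op_smul_tensorEquiv (b : Rᵐᵒᵖ) (z : Fin d → P) :
    b • tensorEquiv e z =
      tensorEquiv e fun r => ∑ q, op (e (b • basisVec e q) r) • z q := by
  change b • ∑ q, BimodTensor.tmul R (z q) (basisVec e q) =
    ∑ r, BimodTensor.tmul R (∑ q, op (e (b • basisVec e q) r) • z q) (basisVec e r)
  simp only [BimodTensor.sum_tmul, BimodTensor.smul_tmul]
  rw [Finset.sum_comm, Finset.smul_sum]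
  refine Finset.sum_congr rfl fun q _ => ?_
  rw [← BimodTensor.tmul_sum, sum_smul_basisVec]
  rfl

theorem exists_intertwining_matrix {A : Type*} [Ring A] (τ : Rᵐᵒᵖ ≃+* A)
    (t : BimodTensor R P P ≃ₗ[R] (Fin d → P)) (ht : ∀ (b : Rᵐᵒᵖ) x, t (b • x) = b • t x) :
    ∃ θ θ' : Matrix (Fin d × Fin d) (Fin d × Fin d) A, θ * θ' = 1 ∧ θ' * θ = 1 ∧
      ∀ x, Twist.iterMatrix (bimoduleMatrix τ e) x * θ =
        θ * Twist.diagMatrix (bimoduleMatrix τ e) x := by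
  let G : (Fin d → P) ≃ₗ[R] (Fin d → P) := (tensorEquiv e).trans t
  let c : End R (Fin d → P) →+* Matrix (Fin d × Fin d) (Fin d × Fin d) A :=
    (opMatrix τ).comp ((powEquiv e).conjRingEquiv : End R (Fin d → P) →+* _)
  have hc : ∀ f x y, c f x y = τ (op (e (f (Pi.single y.1 (basisVec e y.2)) x.1) x.2)) := by
    intro f x y
    rw [← powEquiv_symm_single]
    rfl
  let S : Rᵐᵒᵖ → End R (Fin d → P) := fun b =>
    { toFun := fun z r => ∑ q, op (e (b • basisVec e q) r) • z q
      map_add' := fun z z' => by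
        ext r
        simp [Finset.sum_add_distrib]
      map_smul' := fun a z => by
        ext r
        simp [Finset.smul_sum, smul_comm a] }
  let D : Rᵐᵒᵖ → End R (Fin d → P) := fun b =>
    { toFun := fun z => b • z
      map_add' := smul_add b
      map_smul' := fun a z => funext fun r => (smul_comm a b (z r)).symm }
  have hGS : ∀ b, (G : (Fin d → P) →ₗ[R] (Fin d → P)) * S b = D b * (G : _ →ₗ[R] _) := by
    intro b
    refine LinearMap.ext fun z => ?_
    refine (congrArg t (op_smul_tensorEquiv e b z)).symm.trans ?_
    exact ht b _
  have h1 : (G.symm : (Fin d → P) →ₗ[R] (Fin d → P)) * (G : (Fin d → P) →ₗ[R] (Fin d → P)) = 1 :=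
    LinearMap.ext fun z => G.symm_apply_apply z
  have h2 : (G : (Fin d → P) →ₗ[R] (Fin d → P)) * (G.symm : (Fin d → P) →ₗ[R] (Fin d → P)) = 1 :=
    LinearMap.ext fun z => G.apply_symm_apply z
  -- G carries the tensor action to the diagonal one, so θ, which goes from the diagonal side to the
  -- iterated side, is the matrix of its inverse.
  refine ⟨c (G.symm : _ →ₗ[R] _), c (G : _ →ₗ[R] _), ?_, ?_, fun x => ?_⟩
  · rw [← map_mul, h1, map_one]
  · rw [← map_mul, h2, map_one]
  obtain ⟨b, rfl⟩ := τ.surjective x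
  have hS : Twist.iterMatrix (bimoduleMatrix τ e) (τ b) = c (S b) := by
    ext x y
    rw [hc, Twist.iterMatrix, Matrix.of_apply, bimoduleMatrix_apply, bimoduleMatrix_apply]
    congr 3
    refine congrFun (congrArg e ?_) x.2
    change _ = ∑ q, op (e (b • basisVec e q) x.1) • (Pi.single y.1 (basisVec e y.2) : Fin d → P) q
    rw [Finset.sum_eq_single y.1]
    · rw [Pi.single_eq_same]
    · intro q _ hq
      rw [Pi.single_eq_of_ne hq, smul_zero]
    · simp
  have hD : Twist.diagMatrix (bimoduleMatrix τ e) (τ b) = c (D b) := by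
    ext x y
    rw [hc, Twist.diagMatrix, Matrix.of_apply, bimoduleMatrix_apply]
    change _ = τ (op (e (b • (Pi.single y.1 (basisVec e y.2) : Fin d → P) x.1) x.2))
    split_ifs with h
    · rw [h, Pi.single_eq_same]
    · rw [Pi.single_eq_of_ne h, smul_zero, map_zero, Pi.zero_apply, op_zero, map_zero]
  rw [hS, hD, ← map_mul, ← map_mul]
  congr 1
  calc S b * (G.symm : (Fin d → P) →ₗ[R] (Fin d → P)) =
      (G.symm : (Fin d → P) →ₗ[R] (Fin d → P)) * ((G : (Fin d → P) →ₗ[R] (Fin d → P)) * S b) *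
        (G.symm : (Fin d → P) →ₗ[R] (Fin d → P)) := by
        rw [← mul_assoc, h1, one_mul]
    _ = _ := by rw [hGS, mul_assoc, mul_assoc, h2, mul_one]

end TensorPower

/-! ### The summands e_i P in coordinates, and the conclusion -/

section Component

open Module

theorem piMulOpposite_op_centerEmb {ι : Type*} {L : ι → Type*} [∀ i, Field (L i)]
    {B : ι → Type*} [∀ i, Ring (B i)] [∀ i, Algebra (L i) (B i)] (a : ∀ i, L i) :
    RingEquiv.piMulOpposite B (op (centerEmb L B a)) = centerEmb L (fun i => (B i)ᵐᵒᵖ) a := rfl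

variable {ι : Type*} [DecidableEq ι] {L : ι → Type*} [∀ i, Field (L i)]
  {B : ι → Type*} [∀ i, Ring (B i)] [∀ i, Algebra (L i) (B i)]
  {P : Type*} [AddCommGroup P] [Module (∀ i, B i) P] {d : ℕ} (e : P ≃ₗ[∀ i, B i] (Fin d → ∀ i, B i))

/-- Coordinates on the `i`-th component of a free module over a product. -/
def componentEquiv (i : ι) : component B P i ≃ₗ[L i] (Fin d → (B i)ᵐᵒᵖ) where
  toFun x p := op (e (x : P) p i)
  map_add' x y := by
    ext p
    simp
  map_smul' z x := by
    ext p
    rw [coe_component_smul, map_smul, RingHom.id_apply]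
    change op ((Pi.single i (algebraMap (L i) (B i) z) : ∀ i, B i) i * e (x : P) p i) =
      z • op (e (x : P) p i)
    rw [Pi.single_eq_same, ← Algebra.smul_def, op_smul]
  invFun f := ⟨e.symm fun p => Pi.single i (unop (f p)), by
    change (Pi.single i 1 : ∀ i, B i) • _ = _
    rw [← map_smul]
    congr 1
    ext1 p
    change (Pi.single i 1 : ∀ i, B i) * Pi.single i _ = _
    rw [← Pi.single_mul, one_mul]⟩
  left_inv x := by
    refine Subtype.ext ?_
    rw [LinearEquiv.symm_apply_eq]
    have hx : (Pi.single i 1 : ∀ i, B i) • e (x : P) = e x := by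
      rw [← map_smul]
      exact congrArg e x.2
    ext p j
    rw [← hx]
    by_cases hj : j = i
    · subst hj
      simp
    · simp [hj]
  right_inv f := by
    ext p
    simp

theorem componentEquiv_apply (i : ι) (x : component B P i) (p : Fin d) :
    componentEquiv (L := L) e i x p = op (e (x : P) p i) := rfl

variable [Module (∀ i, B i)ᵐᵒᵖ P] [SMulCommClass (∀ i, B i) (∀ i, B i)ᵐᵒᵖ P]

/-- This identifies the polynomial of the theorem, defined intrinsically on e_i P, with the
characteristic polynomial of the coordinate model F(A_i). -/
theorem componentEquiv_conj (i : ι) (b : ∀ i, B i) :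
    (componentEquiv (L := L) e i).conj (componentEnd (L i) i (rightAction (∀ i, B i) P b)) =
      vecEnd (L i) (bimoduleMatrix (RingEquiv.piMulOpposite B) e)
        (Pi.evalRingHom (fun i => (B i)ᵐᵒᵖ) i) (RingEquiv.piMulOpposite B (op b)) := by
  refine LinearMap.ext fun y => ?_
  obtain ⟨x, rfl⟩ := (componentEquiv (L := L) e i).surjective y
  rw [LinearEquiv.conj_apply_apply, LinearEquiv.symm_apply_apply]
  ext p
  rw [vecEnd_apply, componentEquiv_apply]
  change op (e (op b • (x : P)) p i) = _
  rw [op_smul_apply, Finset.sum_apply, Finset.op_sum]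
  refine Finset.sum_congr rfl fun q _ => ?_
  rw [bimoduleMatrix_apply]
  rfl

variable [∀ i, FiniteDimensional (L i) (B i)]

theorem componentCharpoly_eq (h : IsGaloisBimodule (∀ i, B i) P d) (a : ∀ i, L i) (i : ι) :
    componentCharpoly h a i = (vecEnd (L i) (bimoduleMatrix (RingEquiv.piMulOpposite B) e)
      (Pi.evalRingHom (fun i => (B i)ᵐᵒᵖ) i) (centerEmb L (fun i => (B i)ᵐᵒᵖ) a)).charpoly := by
  have := h.finite_component (L i) i
  rw [← piMulOpposite_op_centerEmb, ← componentEquiv_conj, LinearEquiv.charpoly_conj]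
  rfl

variable [Fintype ι]

theorem map_normalizedCharpoly (m : ι → ℕ) (h : IsGaloisBimodule (∀ i, B i) P d)
    (a : ∀ i, L i) (i : ι) : (normalizedCharpoly m h a).map (Pi.evalRingHom L i) =
      componentCharpoly h a i ^ ((Finset.univ.lcm m) ^ 2 / m i ^ 2) :=
  congrFun ((Polynomial.piEquiv L).apply_symm_apply _) i

theorem coeff_normalizedCharpoly (m : ι → ℕ) (h : IsGaloisBimodule (∀ i, B i) P d)
    (a : ∀ i, L i) (k : ℕ) (i : ι) : (normalizedCharpoly m h a).coeff k i =
      (componentCharpoly h a i ^ ((Finset.univ.lcm m) ^ 2 / m i ^ 2)).coeff k := by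
  rw [← map_normalizedCharpoly, Polynomial.coeff_map]
  rfl

end Component
end GaloisBimod

theorem mainTheorem9 {ι : Type*} [Fintype ι] [DecidableEq ι]
    (L : ι → Type*) [∀ i, Field (L i)]
    (B : ι → Type*) [∀ i, Ring (B i)] [∀ i, Algebra (L i) (B i)]
    [∀ i, IsSimpleRing (B i)] [∀ i, Algebra.IsCentral (L i) (B i)]
    [∀ i, FiniteDimensional (L i) (B i)]
    (m : ι → ℕ) (hm : ∀ i, Module.finrank (L i) (B i) = m i ^ 2)
    (P : Type*) [AddCommGroup P] [Module (∀ i, B i) P] [Module (∀ i, B i)ᵐᵒᵖ P]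
    [SMulCommClass (∀ i, B i) (∀ i, B i)ᵐᵒᵖ P]
    (d : ℕ) (hP : GaloisBimod.IsGaloisBimodule (∀ i, B i) P d) (a : ∀ i, L i) :
    (∀ i, ((GaloisBimod.normalizedCharpoly m hP a).map (Pi.evalRingHom L i)).Monic ∧
      ((GaloisBimod.normalizedCharpoly m hP a).map (Pi.evalRingHom L i)).natDegree =
        d * (Finset.univ.lcm m) ^ 2) ∧
    ∀ k : ℕ, GaloisBimod.centerEmb L B ((GaloisBimod.normalizedCharpoly m hP a).coeff k) ∈
      GaloisBimod.bimoduleCenter (∀ i, B i) P := by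
  obtain ⟨e⟩ := hP.left_free
  obtain ⟨e'⟩ := hP.right_free
  obtain ⟨t, ht⟩ := hP.tensor_iso
  have : NeZero d := ⟨Nat.one_le_iff_ne_zero.1 hP.one_le⟩
  have hdvd : ∀ i, m i ∣ Finset.univ.lcm m := fun i => Finset.dvd_lcm (Finset.mem_univ i)
  have hfin : ∀ i, Module.finrank (L i) (B i)ᵐᵒᵖ = m i ^ 2 := fun i => by
    rw [← hm i]
    exact (MulOpposite.opLinearEquiv (L i)).finrank_eq.symm
  have hfd : ∀ i, FiniteDimensional (L i) (B i)ᵐᵒᵖ := fun i =>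
    Module.Finite.equiv (MulOpposite.opLinearEquiv (L i) (M := B i))
  refine ⟨fun i => ?_, fun k => ?_⟩
  · have hmon : (GaloisBimod.componentCharpoly hP a i).Monic := by
      rw [GaloisBimod.componentCharpoly_eq e]
      exact LinearMap.charpoly_monic _
    rw [GaloisBimod.map_normalizedCharpoly]
    refine ⟨hmon.pow _, ?_⟩
    have hpos : 0 < m i ^ 2 := by
      rw [← hm]
      exact Module.finrank_pos
    -- The degree before normalization is d · m_i², and the division in the exponent is exact
    -- because m_i divides m.
    rw [hmon.natDegree_pow, GaloisBimod.componentCharpoly_eq e, LinearMap.charpoly_natDegree,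
      Module.finrank_pi_fintype, Finset.sum_const, hfin, Finset.card_univ, Fintype.card_fin,
      smul_eq_mul, mul_comm, mul_assoc, Nat.mul_div_cancel' (pow_dvd_pow_of_dvd (hdvd i) 2)]
  · obtain ⟨θ, θ', h1, h2, hθ⟩ :=
      GaloisBimod.exists_intertwining_matrix e (RingEquiv.piMulOpposite B) t ht
    have key := GaloisBimod.charpoly_pow_coeff_mem_centralScalars_of_injective (L := L)
      m hfin _ hdvd
      (GaloisBimod.bimoduleMatrix_injective (RingEquiv.piMulOpposite B) e e') h1 h2 hθ a k
    rw [← GaloisBimod.bimoduleMatrix_eq_scalar_iff (RingEquiv.piMulOpposite B) e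
      (GaloisBimod.centerEmb_commute _), GaloisBimod.piMulOpposite_op_centerEmb]
    have hcoeff : (GaloisBimod.normalizedCharpoly m hP a).coeff k = fun i =>
        ((GaloisBimod.vecEnd (L i) (GaloisBimod.bimoduleMatrix (RingEquiv.piMulOpposite B) e)
          (Pi.evalRingHom (fun i => (B i)ᵐᵒᵖ) i)
          (GaloisBimod.centerEmb L (fun i => (B i)ᵐᵒᵖ) a)).charpoly ^
            ((Finset.univ.lcm m) ^ 2 / m i ^ 2)).coeff k := by
      ext i
      rw [GaloisBimod.coeff_normalizedCharpoly, GaloisBimod.componentCharpoly_eq e]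
    rw [hcoeff]
    exact (GaloisBimod.mem_centralScalars _).1 key
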